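/- Let $C$ be a tropical curve, i.e. a connected finite metric graph (up to subdivision) whose $1$-valent vertices are exactly the infinite ends of its leaves, all of which have infinite length; let $g=b_1(C)$ be its genus and $p_0\in C$ a base point. Divisors are finite integral combinations of points of $C$ (infinite points included), the divisor of a piecewise linear function $f$ with integral slopes is $(f)=\sum_p(\text{sum of the outward slopes of } f \text{ at } p)\,p$, and $\operatorname{Pic}(C)$ is the group of divisors modulo these principal divisors. Let $\operatorname{val}(p)$ be the valence of $p$ and $K=\sum_p(\operatorname{val}(p)-2)\,p$. A theta characteristic is a class $\mathcal K\in\operatorname{Pic}^{g-1}(C)$ with $2\mathcal K=[K]$. Let $\Omega_{\mathbb Z}(C)$ be the lattice of integral $1$-forms, $\Omega(C)^*$ the space of real functionals on it, $\Lambda=H_1(C,\mathbb Z)\subset\Omega(C)^*$ the lattice of cycles, embedded by integration, $J(C)=\Omega(C)^*/\Lambda$ the Jacobian, and $\mu$ the Abel–Jacobi map with base point $p_0$, on points and (additively) on divisors. Let $Q$ be the symmetric bilinear form on $\Omega(C)^*$ given on cycles by the length pairing, and $\Theta(x)=\max_{\lambda\in\Lambda}\{Q(\lambda,x)-\frac12Q(\lambda,\lambda)\}$.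 For $\lambda\in J(C)$ let $D_\lambda$ be the pull-back to $C$ under $\mu$ of the theta divisor (the corner locus of $\Theta$) translated by $\lambda$; that is, the multiplicity of $D_\lambda$ at $p$ is the sum of the outward slopes at $p$ of $\Theta(\tilde\mu(\cdot)-\tilde\lambda)$, where $\tilde\mu$ is a local lift of $\mu$ and $\tilde\lambda$ a lift of $\lambda$ to $\Omega(C)^*$. The Riemann constant $\kappa\in J(C)$ is the unique element with $\mu(D_\lambda)+\kappa=\lambda$ for all $\lambda\in J(C)$; it exists. Let $\mathcal K_0$ be the class in $\operatorname{Pic}^{g-1}(C)$ with $\mu(\mathcal K_0)=-\kappa$; it exists and is unique. For $0\ne\gamma\in H_1(C,\mathbb Z/2\mathbb Z)$ choose a simple lift $\bar\gamma\in H_1(C,\mathbb Z)$, i.e. a cycle that reduces to $\gamma$ modulo $2$ and contains each edge with multiplicity at most one (such a lift exists). Orient $C$ by $\bar\gamma$ on its support $|\gamma|$, and by the gradient flow of the distance to $|\gamma|$ elsewhere, and let $\mathcal K_\gamma^{\pm}=\sum_{p}(\operatorname{val}_\pm(p)-1)\,p$, where $\operatorname{val}_+(p)$ and $\operatorname{val}_-(p)$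 are the numbers of outgoing and incoming edges at $p$. Then $\mathcal K_\gamma^{+}$ and $\mathcal K_\gamma^-$ are divisors that depend only on $\gamma$ and are linearly equivalent; let $\mathcal K_\gamma$ be their class. Theorem. The map $\gamma\mapsto\mathcal K_\gamma$ is an isomorphism of affine spaces over $\mathbb Z/2\mathbb Z$ from $H_1(C,\mathbb Z/2\mathbb Z)$ onto the set of theta characteristics (a torsor under the $2$-torsion of $\operatorname{Pic}(C)$): it is a bijection, and $\mathcal K_{\gamma+\delta}=\varphi(\gamma)+\mathcal K_\delta$ for all $\gamma,\delta$, where $\varphi$ is the group isomorphism from $H_1(C,\mathbb Z/2\mathbb Z)=\frac12\Lambda/\Lambda$ onto the $2$-torsion of $\operatorname{Pic}(C)$ for which $\varphi(\gamma)$ is the unique class of degree $0$ with $\mu(\varphi(\gamma))=\frac12\gamma$. Among all the $\mathcal K_\gamma$, only $\mathcal K_0$, the class corresponding to $-\kappa$, is not linearly equivalent to an effective divisor. -/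

import Mathlib

open Filter Topology

/-- A (model of a) tropical curve: a connected finite graph with finite vertices `V`, edges `E` of
finite positive length, and infinite legs `L`. A leg is a half-line `[0, ∞]` which starts at a
vertex and is compactified by a 1-valent vertex at infinity. No finite vertex is 1-valent, so all
leaves are infinite. Loops, multiple edges and 2-valent vertices are allowed. -/
structure TropicalCurve (V E L : Type*) where
  src : E → V
  tgt : E → V
  len : E → ℝ
  len_pos : ∀ e, 0 < len e
  base : L → V
  nonempty : Nonempty V
  connected : ∀ v w, Relation.EqvGen (fun a b => ∃ e, src e = a ∧ tgt e = b) v w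
  no_finite_leaf : ∀ v,
    {e | src e = v}.ncard + {e | tgt e = v}.ncard + {l | base l = v}.ncard ≠ 1

namespace TropicalCurve

variable {V E L : Type*}

/-! ### Points and tangent directions -/

/-- The points of the curve at finite distance: vertices, interior points of edges (with the
coordinate measured from the source) and interior points of legs. -/
inductive FinPoint (C : TropicalCurve V E L) where
  | vert (v : V) : FinPoint C
  | edge (e : E) (t : ℝ) (h0 : 0 < t) (h1 : t < C.len e) : FinPoint C
  | leg (l : L) (t : ℝ) (h0 : 0 < t) : FinPoint C

/-- The points of the curve: finite points, and the infinite end of each leg. -/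
inductive Point (C : TropicalCurve V E L) where
  | fin (p : FinPoint C) : Point C
  | infty (l : L) : Point C

variable (C : TropicalCurve V E L)

open Classical in
/-- The parametrization of the closed edge `e` by `[0, len e]` (constant outside this interval). -/
noncomputable def edgePt (e : E) (t : ℝ) : C.FinPoint :=
  if h0 : t ≤ 0 then .vert (C.src e)
  else if h1 : C.len e ≤ t then .vert (C.tgt e)
  else .edge e t (lt_of_not_ge h0) (lt_of_not_ge h1)

open Classical in
/-- The parametrization of the leg `l` by `[0, ∞)` (constant for negative parameters). -/
noncomputable def legPt (l : L) (t : ℝ) : C.FinPoint :=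
  if h0 : t ≤ 0 then .vert (C.base l) else .leg l t (lt_of_not_ge h0)

theorem edgePt_zero (e : E) : C.edgePt e 0 = .vert (C.src e) := by simp [edgePt]

theorem edgePt_len (e : E) : C.edgePt e (C.len e) = .vert (C.tgt e) := by
  have := C.len_pos e
  simp [edgePt, this.not_ge]

theorem legPt_zero (l : L) : C.legPt l 0 = .vert (C.base l) := by simp [legPt]

/-- A direction: an edge or leg, together with the direction of increasing (`true`) or decreasing
(`false`) coordinate on it. -/
abbrev Dir (E L : Type*) := (E ⊕ L) × Bool

/-- The direction `d` is an outward primitive tangent direction at the point `p`. -/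
def Emanates : C.Point → Dir E L → Prop
  | .fin (.vert v), (.inl e, true) => C.src e = v
  | .fin (.vert v), (.inl e, false) => C.tgt e = v
  | .fin (.vert v), (.inr l, true) => C.base l = v
  | .fin (.vert _), (.inr _, false) => False
  | .fin (.edge e _ _ _), (a, _) => a = .inl e
  | .fin (.leg l _ _), (a, _) => a = .inr l
  | .infty l, d => d = (.inr l, false)

/-- The coordinate of the finite point `p` on the edge or leg underlying a direction at `p`. -/
def coord : C.FinPoint → Dir E L → ℝ
  | .vert _, (.inl e, false) => C.len e
  | .vert _, _ => 0
  | .edge _ t _ _, _ => t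
  | .leg _ t _, _ => t

/-- The point at distance `s` from `p` in the direction `d` (for small `s ≥ 0`). -/
noncomputable def move (p : C.FinPoint) : Dir E L → ℝ → C.FinPoint
  | (.inl e, true), s => C.edgePt e (C.coord p (.inl e, true) + s)
  | (.inl e, false), s => C.edgePt e (C.coord p (.inl e, false) - s)
  | (.inr l, true), s => C.legPt l (C.coord p (.inr l, true) + s)
  | (.inr l, false), s => C.legPt l (C.coord p (.inr l, false) - s)

/-- The function `f` (given on the finite points) is affine near `p` in the direction `d`, with
outward slope `n`. At the infinite end of a leg, the direction is that of decreasing coordinate. -/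
def HasSlope (f : C.FinPoint → ℝ) : C.Point → Dir E L → ℤ → Prop
  | .fin p, d, n => ∀ᶠ s in 𝓝[>] (0 : ℝ), f (C.move p d s) = f p + n * s
  | .infty l, _, n => ∃ a : ℝ, ∀ᶠ t in (atTop : Filter ℝ), f (C.legPt l t) = a - n * t

variable {C} in
theorem HasSlope.sum {f g : C.FinPoint → ℝ} {p : C.Point} {d : Dir E L} {m n : ℤ}
    (hf : C.HasSlope f p d m) (hg : C.HasSlope g p d n) : C.HasSlope (f + g) p d (m + n) := by
  cases p with
  | fin p =>
    simp only [HasSlope] at *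
    filter_upwards [hf, hg] with s h1 h2
    simp only [Pi.add_apply, h1, h2]
    push_cast
    ring
  | infty l =>
    simp only [HasSlope] at *
    obtain ⟨a, ha⟩ := hf
    obtain ⟨b, hb⟩ := hg
    refine ⟨a + b, ?_⟩
    filter_upwards [ha, hb] with s h1 h2
    simp only [Pi.add_apply, h1, h2]
    push_cast
    ring

variable {C} in
theorem HasSlope.opp {f : C.FinPoint → ℝ} {p : C.Point} {d : Dir E L} {m : ℤ}
    (hf : C.HasSlope f p d m) : C.HasSlope (-f) p d (-m) := by
  cases p with
  | fin p =>
    simp only [HasSlope] at *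
    filter_upwards [hf] with s h1
    simp only [Pi.neg_apply, h1]
    push_cast
    ring
  | infty l =>
    simp only [HasSlope] at *
    obtain ⟨a, ha⟩ := hf
    refine ⟨-a, ?_⟩
    filter_upwards [ha] with s h1
    simp only [Pi.neg_apply, h1]
    push_cast
    ring

theorem hasSlope_zero (p : C.Point) (d : Dir E L) : C.HasSlope 0 p d 0 := by
  cases p with
  | fin p => simp [HasSlope]
  | infty l => exact ⟨0, by simp⟩

section Divisors

variable [Fintype E] [Fintype L]

open Classical in
/-- The outward tangent directions at a point. -/
noncomputable def outDirs (p : C.Point) : Finset (Dir E L) :=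
  Finset.univ.filter (C.Emanates p)

/-- The valence of a point. -/
noncomputable def val (p : C.Point) : ℕ := (C.outDirs p).card

/-- Divisors: finite integral linear combinations of points. -/
abbrev Div := C.Point →₀ ℤ

/-- The degree of a divisor. -/
noncomputable def deg (D : C.Div) : ℤ := D.sum fun _ a => a

/-- `f` is piecewise linear with integral slopes and `D` is its principal divisor: at every point,
`f` is affine with an integral slope in each outward direction, and the multiplicity of `D` is the
sum of these slopes. (By compactness of the curve such an `f` has finitely many linear pieces.) -/
def IsDivisorOf (f : C.FinPoint → ℝ) (D : C.Div) : Prop :=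
  ∀ p, ∃ n : Dir E L → ℤ,
    (∀ d ∈ C.outDirs p, C.HasSlope f p d (n d)) ∧ D p = ∑ d ∈ C.outDirs p, n d

/-- The group of principal divisors. -/
noncomputable def principal : AddSubgroup C.Div where
  carrier := {D | ∃ f, C.IsDivisorOf f D}
  zero_mem' := ⟨0, fun p => ⟨0, fun d _ => C.hasSlope_zero p d, by simp⟩⟩
  add_mem' := by
    rintro D D' ⟨f, hf⟩ ⟨g, hg⟩
    refine ⟨f + g, fun p => ?_⟩
    obtain ⟨m, hm, hD⟩ := hf p
    obtain ⟨n, hn, hD'⟩ := hg p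
    exact ⟨m + n, fun d hd => (hm d hd).sum (hn d hd), by
      simp [hD, hD', Finset.sum_add_distrib]⟩
  neg_mem' := by
    rintro D ⟨f, hf⟩
    refine ⟨-f, fun p => ?_⟩
    obtain ⟨m, hm, hD⟩ := hf p
    exact ⟨-m, fun d hd => (hm d hd).opp, by simp [hD]⟩

/-- The Picard group: divisors modulo linear equivalence. -/
abbrev Pic := C.Div ⧸ C.principal

/-- The class of a divisor. -/
noncomputable def cls (D : C.Div) : C.Pic := QuotientAddGroup.mk D

/-- The divisor class `x` contains an effective divisor. -/
def IsEffective (x : C.Pic) : Prop := ∃ D : C.Div, 0 ≤ D ∧ C.cls D = x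

theorem val_eq_two_of_interior (p : C.Point) (hv : ∀ v, p ≠ .fin (.vert v))
    (hi : ∀ l, p ≠ .infty l) : C.val p = 2 := by
  classical
  have key : ∀ a : E ⊕ L, (∀ d, C.Emanates p d ↔ d.1 = a) → C.val p = 2 := by
    intro a ha
    have : C.outDirs p = {(a, true), (a, false)} := by
      ext ⟨b, c⟩
      cases c <;> simp [outDirs, ha]
    rw [val, this, Finset.card_pair (by simp)]
  match p with
  | .fin (.vert v) => exact absurd rfl (hv v)
  | .infty l => exact absurd rfl (hi l)
  | .fin (.edge e t _ _) => exact key (.inl e) (fun d => by simp [Emanates])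
  | .fin (.leg l t _) => exact key (.inr l) (fun d => by simp [Emanates])

theorem canonical_finite [Fintype V] :
    (Function.support fun p : C.Point => (C.val p : ℤ) - 2).Finite := by
  refine ((Set.finite_range fun v : V => (Point.fin (.vert v) : C.Point)).union
    (Set.finite_range fun l : L => (Point.infty l : C.Point))).subset fun p hp => ?_
  by_contra h
  simp only [Set.mem_union, Set.mem_range, not_or, not_exists] at h
  exact hp (by
    have := C.val_eq_two_of_interior p (fun v hv => h.1 v hv.symm) (fun l hl => h.2 l hl.symm)
    simp [this])

/-- The canonical divisor `K = ∑ (val p - 2) p`. -/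
noncomputable def canonical [Fintype V] : C.Div :=
  Finsupp.ofSupportFinite (fun p => (C.val p : ℤ) - 2) C.canonical_finite

end Divisors

/-! ### Homology, 1-forms and the Jacobian -/

section Jacobian

variable [Fintype E]

open Classical in
/-- The cellular boundary map on 1-chains supported on the finite edges. -/
noncomputable def boundary (R : Type*) [CommRing R] : (E → R) →ₗ[R] (V → R) where
  toFun c v := ∑ e with C.tgt e = v, c e - ∑ e with C.src e = v, c e
  map_add' c c' := by
    ext v
    simp only [Pi.add_apply, Finset.sum_add_distrib]
    ring
  map_smul' r c := by
    ext v
    simp only [Pi.smul_apply, smul_eq_mul, RingHom.id_apply, ← Finset.mul_sum]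
    ring

/-- The first homology with coefficients in `R`: the 1-cycles. (A cycle vanishes on every leg,
because the infinite end of a leg is 1-valent, so legs do not appear.) -/
noncomputable def H1 (R : Type*) [CommRing R] : Submodule R (E → R) :=
  LinearMap.ker (C.boundary R)

/-- The genus is the first Betti number. -/
noncomputable def genus : ℕ := Module.finrank ℤ (C.H1 ℤ)

/-- The lattice of integral 1-forms, also known as the circuit lattice. A 1-form is a constant
integral slope `ω e` on each edge `e` (with respect to its direction from source to target), with
balancing at each vertex: the outgoing slopes sum to zero. Balancing at infinity makes 1-forms
vanish on legs. This is the same condition as being an integral cycle. -/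
noncomputable abbrev OneForm : Submodule ℤ (E → ℤ) := C.H1 ℤ

/-- The space of real linear functionals on 1-forms. -/
abbrev FormDual := C.OneForm →ₗ[ℤ] ℝ

/-- The unit tangent vector of the edge `e`, as a functional on 1-forms: `ω ↦ ω e`. -/
noncomputable def unitVec (e : E) : C.FormDual where
  toFun ω := ((ω : E → ℤ) e : ℝ)
  map_add' := by simp
  map_smul' := by simp

/-- Integration of 1-forms over integral cycles: `c ↦ (ω ↦ ∑ c e * ω e * len e)`. -/
noncomputable def cycleInt : C.H1 ℤ →+ C.FormDual where
  toFun c := ∑ e, (((c : E → ℤ) e : ℝ) * C.len e) • C.unitVec e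
  map_zero' := by simp
  map_add' c c' := by
    rw [← Finset.sum_add_distrib]
    refine Finset.sum_congr rfl fun e _ => ?_
    rw [← add_smul]
    congr 1
    push_cast [Submodule.coe_add, Pi.add_apply]
    ring

/-- The lattice `Λ` of integral cycles. -/
noncomputable def lattice : AddSubgroup C.FormDual := C.cycleInt.range

/-- The tropical Jacobian. -/
abbrev Jac := C.FormDual ⧸ C.lattice

/-- The projection to the Jacobian. -/
noncomputable def toJac (x : C.FormDual) : C.Jac := QuotientAddGroup.mk x

/-- `C.IsPath p q r x`: there is a path from `p` to `q`, consisting of finitely many segments each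
running inside one closed edge or leg, of length `r`, along which integration of 1-forms is the
functional `x`. (All 1-forms vanish on legs.) -/
inductive IsPath (p : C.FinPoint) : C.FinPoint → ℝ → C.FormDual → Prop
  | nil : IsPath p p 0 0
  | edge {r : ℝ} {x : C.FormDual} (e : E) (s t : ℝ)
      (hs : s ∈ Set.Icc 0 (C.len e)) (ht : t ∈ Set.Icc 0 (C.len e))
      (h : IsPath p (C.edgePt e s) r x) :
      IsPath p (C.edgePt e t) (r + |t - s|) (x + (t - s) • C.unitVec e)
  | leg {r : ℝ} {x : C.FormDual} (l : L) (s t : ℝ) (hs : 0 ≤ s) (ht : 0 ≤ t)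
      (h : IsPath p (C.legPt l s) r x) :
      IsPath p (C.legPt l t) (r + |t - s|) x

variable {C} in
theorem IsPath.trans {p q q' : C.FinPoint} {r r' : ℝ} {x x' : C.FormDual}
    (h : C.IsPath p q r x) (h' : C.IsPath q q' r' x') : C.IsPath p q' (r + r') (x + x') := by
  induction h' with
  | nil => simpa using h
  | edge e s t hs ht _ ih =>
    rw [← add_assoc, ← add_assoc]
    exact .edge e s t hs ht ih
  | leg l s t hs ht _ ih =>
    rw [← add_assoc]
    exact .leg l s t hs ht ih

variable {C} in
theorem IsPath.reverse {p q : C.FinPoint} {r : ℝ} {x : C.FormDual}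
    (h : C.IsPath p q r x) : C.IsPath q p r (-x) := by
  induction h with
  | nil => simpa using IsPath.nil
  | edge e s t hs ht _ ih =>
    have := (IsPath.edge e t s ht hs (IsPath.nil (C := C))).trans ih
    convert this using 1
    · rw [abs_sub_comm]; ring
    · rw [neg_add, ← neg_smul, neg_sub]; abel
  | leg l s t hs ht _ ih =>
    have := (IsPath.leg l t s ht hs (IsPath.nil (C := C))).trans ih
    convert this using 1
    · rw [abs_sub_comm]; ring
    · simp

theorem exists_path_vert (v w : V) : ∃ r x, C.IsPath (.vert v) (.vert w) r x := by
  induction C.connected v w with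
  | rel a b h =>
    obtain ⟨e, rfl, rfl⟩ := h
    have hl := (C.len_pos e).le
    have h := IsPath.edge e 0 (C.len e) ⟨le_rfl, hl⟩ ⟨hl, le_rfl⟩ (IsPath.nil (C := C))
    rw [edgePt_zero, edgePt_len] at h
    exact ⟨_, _, h⟩
  | refl a => exact ⟨_, _, .nil⟩
  | symm a b _ ih =>
    obtain ⟨r, x, h⟩ := ih
    exact ⟨_, _, h.reverse⟩
  | trans a b c _ _ ih ih' =>
    obtain ⟨r, x, h⟩ := ih
    obtain ⟨r', x', h'⟩ := ih'
    exact ⟨_, _, h.trans h'⟩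

theorem exists_path_to_vert (p : C.FinPoint) : ∃ v r x, C.IsPath (.vert v) p r x := by
  cases p with
  | vert v => exact ⟨v, _, _, .nil⟩
  | edge e t h0 h1 =>
    have h := IsPath.edge e 0 t ⟨le_rfl, (C.len_pos e).le⟩ ⟨h0.le, h1.le⟩ (IsPath.nil (C := C))
    have he : C.edgePt e t = .edge e t h0 h1 := by simp [edgePt, h0.not_ge, h1.not_ge]
    rw [edgePt_zero, he] at h
    exact ⟨_, _, _, h⟩
  | leg l t h0 =>
    have h := IsPath.leg l 0 t le_rfl h0.le (IsPath.nil (C := C))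
    have he : C.legPt l t = .leg l t h0 := by simp [legPt, h0.not_ge]
    rw [legPt_zero, he] at h
    exact ⟨_, _, _, h⟩

theorem exists_path (p q : C.FinPoint) : ∃ x r, C.IsPath p q r x := by
  obtain ⟨v, _, _, hv⟩ := C.exists_path_to_vert p
  obtain ⟨w, _, _, hw⟩ := C.exists_path_to_vert q
  obtain ⟨_, _, h⟩ := C.exists_path_vert v w
  exact ⟨_, _, (hv.reverse.trans h).trans hw⟩

/-- The identity on finite points; the infinite end of a leg goes to the base vertex of the leg.
Since 1-forms vanish on legs, this does not change integrals of 1-forms along paths. -/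
def finPart : C.Point → C.FinPoint
  | .fin p => p
  | .infty l => .vert (C.base l)

/-- Integration of 1-forms along a chosen path from `p₀` to `p`: a lift of the Abel-Jacobi image
of `p`. -/
noncomputable def pathInt (p₀ p : C.Point) : C.FormDual :=
  (C.exists_path (C.finPart p₀) (C.finPart p)).choose

/-- The Abel-Jacobi map on divisors, with base point `p₀`. -/
noncomputable def abelJacobi (p₀ : C.Point) (D : C.Div) : C.Jac :=
  C.toJac (D.sum fun p a => a • C.pathInt p₀ p)

/-! ### The theta function and the Riemann constant -/

/-- The bilinear form `Q(λ, x)`, for `x` a functional on 1-forms and `λ` the lattice vector given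
by the cycle `c`. Since cycles and 1-forms are the same thing, it is evaluation of `x` at `c`;
see `Q_cycleInt`. -/
noncomputable def Q (c : C.H1 ℤ) (x : C.FormDual) : ℝ := x c

/-- The form `Q` on the lattice is the length pairing. -/
theorem Q_cycleInt (c c' : C.H1 ℤ) :
    C.Q c (C.cycleInt c') = ∑ e, ((c : E → ℤ) e : ℝ) * ((c' : E → ℤ) e : ℝ) * C.len e := by
  simp only [Q, cycleInt, AddMonoidHom.coe_mk, ZeroHom.coe_mk, LinearMap.sum_apply,
    LinearMap.smul_apply, unitVec, LinearMap.coe_mk, AddHom.coe_mk, smul_eq_mul]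
  exact Finset.sum_congr rfl fun e _ => by ring

/-- The tropical theta function `Θ(x) = max_λ (Q(λ, x) - Q(λ, λ) / 2)`. -/
noncomputable def theta (x : C.FormDual) : ℝ :=
  ⨆ c : C.H1 ℤ, (C.Q c x - C.Q c (C.cycleInt c) / 2)

/-- The derivative of the Abel-Jacobi map in a direction. -/
noncomputable def tangent : Dir E L → C.FormDual
  | (.inl e, true) => C.unitVec e
  | (.inl e, false) => -C.unitVec e
  | (.inr _, _) => 0

/-- `D` is the pull-back to the curve, under the Abel-Jacobi map, of the theta divisor translated by
the class of `x`: its multiplicity at each point is the sum of the outward slopes there of the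
pulled back local section `Θ(· - x)`. (This does not depend on the local lifts.) -/
def IsThetaPullback [Fintype L] (p₀ : C.Point) (x : C.FormDual) (D : C.Div) : Prop :=
  ∀ p, ∃ n : Dir E L → ℤ,
    (∀ d ∈ C.outDirs p, ∀ᶠ s in 𝓝[>] (0 : ℝ),
      C.theta (C.pathInt p₀ p - x + s • C.tangent d) = C.theta (C.pathInt p₀ p - x) + n d * s) ∧
    D p = ∑ d ∈ C.outDirs p, n d

/-- `κ` is the Riemann constant (for the base point `p₀`): if `D` is the pull-back of the theta
divisor translated by `x`, then the Abel-Jacobi image of `D` plus `κ` is the class of `x`, for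
all `x`. -/
def IsRiemannConstant [Fintype L] (p₀ : C.Point) (κ : C.Jac) : Prop :=
  ∀ x : C.FormDual, ∃ D : C.Div,
    C.IsThetaPullback p₀ x D ∧ C.abelJacobi p₀ D + κ = C.toJac x

/-- Theta characteristics: the divisor classes of degree `g - 1` whose double is the canonical
class. -/
def thetaChars [Fintype V] [Fintype L] : Set C.Pic :=
  {x | (∃ D, C.deg D = (C.genus : ℤ) - 1 ∧ C.cls D = x) ∧ 2 • x = C.cls C.canonical}

/-! ### The orientation attached to a cycle -/

/-- The integral cycle `c` reduces to `γ` modulo 2. -/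
def IsLift (γ : C.H1 (ZMod 2)) (c : C.H1 ℤ) : Prop :=
  ∀ e, (((c : E → ℤ) e : ℤ) : ZMod 2) = (γ : E → ZMod 2) e

/-- The integral cycle `c` is a simple representative of `γ`: it contains each edge with
multiplicity at most one. -/
def IsSimpleLift (γ : C.H1 (ZMod 2)) (c : C.H1 ℤ) : Prop :=
  C.IsLift γ c ∧ ∀ e, |(c : E → ℤ) e| ≤ 1

/-- The support of a cycle: the union of the closed edges that occur in it. -/
def cycleSupport (c : C.H1 ℤ) : Set C.FinPoint :=
  {p | ∃ e, (c : E → ℤ) e ≠ 0 ∧ ∃ t ∈ Set.Icc 0 (C.len e), p = C.edgePt e t}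

/-- The distance to a nonempty set, for the path metric. -/
noncomputable def distTo (S : Set C.FinPoint) (p : C.FinPoint) : ℝ :=
  sInf {r | ∃ q ∈ S, ∃ x, C.IsPath q p r x}

/-- At the point `p`, the direction `d` agrees with the orientation given by the simple cycle `c`:
on the support of `c` this is the orientation of `c`, elsewhere it is the gradient flow of the
distance to the support, so that the distance grows with slope `1` along `d`. -/
def IsOut (c : C.H1 ℤ) (p : C.Point) (d : Dir E L) : Prop :=
  match d with
  | (.inl e, b) =>
    ((c : E → ℤ) e = 1 ∧ b = true) ∨ ((c : E → ℤ) e = -1 ∧ b = false) ∨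
      ((c : E → ℤ) e = 0 ∧ C.HasSlope (C.distTo (C.cycleSupport c)) p (.inl e, b) 1)
  | (.inr l, b) => C.HasSlope (C.distTo (C.cycleSupport c)) p (.inr l, b) 1

/-- At the point `p`, the direction `d` is opposite to the orientation given by the simple
cycle `c`. -/
def IsIn (c : C.H1 ℤ) (p : C.Point) (d : Dir E L) : Prop :=
  match d with
  | (.inl e, b) =>
    ((c : E → ℤ) e = 1 ∧ b = false) ∨ ((c : E → ℤ) e = -1 ∧ b = true) ∨
      ((c : E → ℤ) e = 0 ∧ C.HasSlope (C.distTo (C.cycleSupport c)) p (.inl e, b) (-1))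
  | (.inr l, b) => C.HasSlope (C.distTo (C.cycleSupport c)) p (.inr l, b) (-1)

open Classical in
/-- The number of outgoing edges at `p`. -/
noncomputable def valOut [Fintype L] (c : C.H1 ℤ) (p : C.Point) : ℕ :=
  ((C.outDirs p).filter (C.IsOut c p)).card

open Classical in
/-- The number of incoming edges at `p`. -/
noncomputable def valIn [Fintype L] (c : C.H1 ℤ) (p : C.Point) : ℕ :=
  ((C.outDirs p).filter (C.IsIn c p)).card

end Jacobian

end TropicalCurve

/-! Linear equivalence is controlled by two invariants. A divisor of degree 0 is always the divisor
of a multivalued piecewise linear function: initial slopes can be prescribed on edges and legs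
subject to one condition per vertex and per infinite end (`IsFlow`), and the rises along the edges,
read as a functional on 1-forms, represent minus the Abel-Jacobi image (`IsFlow.refJac_eq`).
Changing the slopes by a cycle changes this functional by a period, and edge weights induce the zero
functional exactly when they are a gradient. This gives Abel's theorem `cls_eq_iff`: a class is
determined by its degree and its image in the Jacobian.

The divisor of incoming directions puts exactly one "head" on each edge: the end into which the edge
points, or the interior point where the distance `d` peaks. The head lies at `(1 + c e) * len e / 2`
on the support of the cycle `c`, and at `(len e + d (tgt e) - d (src e)) / 2` elsewhere. Compared
with a fixed divisor, the rise along `e` is therefore half of `len e`, minus half of the cycle,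
minus half of a gradient (`IsOrientation.rise_eq`). The gradient is invisible in the Jacobian. Hence
the class has degree `g - 1`, doubles to `K`, and depends on the cycle only through its half modulo
the lattice. Differences of these classes run exactly through the 2-torsion. The case of the zero
cycle is included by letting `d` be the distance to one vertex `q`.

For a nonzero cycle every vertex has an incoming edge, either by balance of the cycle or as the last
edge of a shortest path, so the divisor is effective. For the zero cycle a maximum principle
excludes effectivity (`IsOrientation.not_isEffective`).

The Riemann constant takes two steps. Quasi-periodicity of the theta function shows that pull-backs
of translates have constant degree and that their Jacobian images follow the translation up to a
fixed constant (`exists_theta_pullback`). The constant is read off from one translate: with shortest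
paths from `q` as lifts, theta is explicit on every edge, and the pull-back is the divisor of
incoming directions for `q`, plus `q` itself (`IsDist.thetaSlopeSum`). -/

namespace TropicalCurve

/-! ### Piecewise linear functions of one variable -/

/-- A function on `[0, ℓ]` which vanishes near `0` and is locally affine vanishes. -/
theorem eq_zero_of_locally_affine {h : ℝ → ℝ} {ℓ : ℝ} (h0 : h 0 = 0)
    (h0' : ∀ᶠ s in 𝓝[>] (0 : ℝ), h (0 + s) = 0)
    (hI : ∀ t ∈ Set.Ioo 0 ℓ, ∃ p : ℝ, (∀ᶠ s in 𝓝[>] (0 : ℝ), h (t + s) = h t + p * s) ∧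
      ∀ᶠ s in 𝓝[>] (0 : ℝ), h (t - s) = h t - p * s)
    (hL : ∃ q : ℝ, ∀ᶠ s in 𝓝[>] (0 : ℝ), h (ℓ - s) = h ℓ + q * s) :
    ∀ t ∈ Set.Icc 0 ℓ, h t = 0 := by
  have left : ∀ t ∈ Set.Ioc 0 ℓ, ∃ q : ℝ, ∀ᶠ s in 𝓝[>] (0 : ℝ), h (t - s) = h t + q * s := by
    intro t ht
    rcases eq_or_lt_of_le ht.2 with rfl | hlt
    · exact hL
    · obtain ⟨p, -, hp⟩ := hI t ⟨ht.1, hlt⟩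
      exact ⟨-p, by filter_upwards [hp] with s hs; rw [hs]; ring⟩
  -- No continuity is assumed; the affine germ to the left of `t` replaces it. An affine germ that
  -- vanishes at two points is zero, including its value at `t`.
  have vanish : ∀ t, 0 < t → (∀ u ∈ Set.Ico 0 t, h u = 0) → ∀ q : ℝ,
      (∀ᶠ s in 𝓝[>] (0 : ℝ), h (t - s) = h t + q * s) → h t = 0 ∧ q = 0 := by
    intro t ht hu q hq
    have hev : ∀ᶠ s in 𝓝[>] (0 : ℝ), s ∈ Set.Ioo 0 t := Ioo_mem_nhdsGT ht
    have : ∀ᶠ s in 𝓝[>] (0 : ℝ), h t + q * s = 0 := by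
      filter_upwards [hq, hev] with s hs hs'
      rw [← hs]
      exact hu _ ⟨by linarith [hs'.2], by linarith [hs'.1]⟩
    obtain ⟨ε, hε, hsub⟩ := mem_nhdsGT_iff_exists_Ioo_subset.1 this
    have hε' : (0 : ℝ) < ε := hε
    have e1 : h t + q * (ε / 2) = 0 := hsub ⟨by positivity, by linarith⟩
    have e2 : h t + q * (ε / 3) = 0 := hsub ⟨by positivity, by linarith⟩
    have : q * (ε / 6) = 0 := by linarith
    have hq0 : q = 0 := by
      rcases mul_eq_zero.1 this with h | h
      · exact h
      · linarith
    subst hq0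
    exact ⟨by linarith, rfl⟩
  rcases lt_or_ge ℓ 0 with hneg | hpos
  · intro t ht
    linarith [ht.1, ht.2]
  -- Continuous induction: left germs make the set of good `t` closed, and right germs extend it.
  -- The extension works because both sides of an interior point share one slope, which is zero as
  -- soon as the left side vanishes.
  have key : Set.Icc 0 ℓ ⊆ {t | ∀ u ∈ Set.Icc 0 t, h u = 0} := by
    apply IsClosed.Icc_subset_of_forall_exists_gt
    · refine isClosed_of_closure_subset fun x hx => ?_
      have hxI : x ∈ Set.Icc 0 ℓ :=
        isClosed_Icc.closure_subset_iff.2 Set.inter_subset_right hx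
      refine ⟨?_, hxI⟩
      have hlt : ∀ u ∈ Set.Ico 0 x, h u = 0 := by
        intro u hu
        obtain ⟨y, hy1, hy2⟩ := mem_closure_iff.1 hx (Set.Ioi u) isOpen_Ioi hu.2
        exact hy2.1 u ⟨hu.1, le_of_lt hy1⟩
      intro u hu
      rcases eq_or_lt_of_le hu.2 with rfl | h'
      · rcases eq_or_lt_of_le hu.1 with rfl | h''
        · exact h0
        · obtain ⟨q, hq⟩ := left u ⟨h'', hxI.2⟩
          exact (vanish u h'' hlt q hq).1
      · exact hlt u ⟨hu.1, h'⟩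
    · intro u hu
      obtain rfl : u = 0 := le_antisymm hu.2 hu.1
      exact h0
    · rintro x ⟨hx, hxI⟩ y hy
      have hright : ∀ᶠ s in 𝓝[>] (0 : ℝ), h (x + s) = 0 := by
        rcases eq_or_lt_of_le hxI.1 with rfl | h'
        · exact h0'
        · obtain ⟨p, hp1, hp2⟩ := hI x ⟨h', hxI.2⟩
          have := (vanish x h' (fun u hu => hx u ⟨hu.1, hu.2.le⟩) (-p)
            (by filter_upwards [hp2] with s hs; rw [hs]; ring)).2
          obtain rfl : p = 0 := by linarith
          filter_upwards [hp1] with s hs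
          rw [hs, hx x ⟨hxI.1, le_rfl⟩]
          ring
      obtain ⟨ε, hε, hsub⟩ := mem_nhdsGT_iff_exists_Ioo_subset.1 hright
      have hε' : (0 : ℝ) < ε := hε
      have hy' : x < y := hy
      have hm : 0 < min (ε / 2) (y - x) := lt_min (by linarith) (by linarith)
      refine ⟨x + min (ε / 2) (y - x), ?_, by linarith, by linarith [min_le_right (ε / 2) (y - x)]⟩
      intro u hu
      rcases le_or_gt u x with h' | h'
      · exact hx u ⟨hu.1, h'⟩
      · have : h (x + (u - x)) = 0 :=
          hsub ⟨by linarith, by linarith [hu.2, min_le_left (ε / 2) (y - x)]⟩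
        rwa [add_sub_cancel] at this
  exact fun t ht => key ht t ⟨ht.1, le_rfl⟩

/-- The total mass of a finite integral combination of points of the line. -/
noncomputable def mass : (ℝ →₀ ℤ) →+ ℤ := Finsupp.liftAddHom fun _ => AddMonoidHom.id ℤ

open Classical in
/-- The mass of the part in `(-∞, t]`. -/
noncomputable def massLE (t : ℝ) : (ℝ →₀ ℤ) →+ ℤ :=
  Finsupp.liftAddHom fun s => if s ≤ t then AddMonoidHom.id ℤ else 0

open Classical in
/-- The mass of the part in `(-∞, t)`. -/
noncomputable def massLT (t : ℝ) : (ℝ →₀ ℤ) →+ ℤ :=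
  Finsupp.liftAddHom fun s => if s < t then AddMonoidHom.id ℤ else 0

/-- The piecewise linear function `t ↦ ∑ a_s max (t - s) 0`, with slope `0` near `-∞` and bending
`a`. -/
noncomputable def ramp (t : ℝ) : (ℝ →₀ ℤ) →+ ℝ :=
  Finsupp.liftAddHom fun s => (AddMonoidHom.mulRight (max (t - s) 0)).comp (Int.castAddHom ℝ)

theorem mass_eq_sum (a : ℝ →₀ ℤ) : mass a = a.sum fun _ k => k := by
  rw [mass, Finsupp.liftAddHom_apply]
  rfl

theorem ramp_eq_sum (t : ℝ) (a : ℝ →₀ ℤ) : ramp t a = a.sum fun s k => (k : ℝ) * max (t - s) 0 := by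
  rw [ramp, Finsupp.liftAddHom_apply]
  rfl

@[simp] theorem mass_single (s : ℝ) (k : ℤ) : mass (Finsupp.single s k) = k := by
  simp [mass]

@[simp] theorem ramp_single (t s : ℝ) (k : ℤ) :
    ramp t (Finsupp.single s k) = k * max (t - s) 0 := by
  simp [ramp]

theorem massLE_single (t s : ℝ) (k : ℤ) :
    massLE t (Finsupp.single s k) = if s ≤ t then k else 0 := by
  rw [massLE, Finsupp.liftAddHom_apply_single]
  split_ifs <;> simp

theorem massLT_single (t s : ℝ) (k : ℤ) :
    massLT t (Finsupp.single s k) = if s < t then k else 0 := by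
  rw [massLT, Finsupp.liftAddHom_apply_single]
  split_ifs <;> simp

/-- `massLE` and `massLT` are the right and left slopes of `ramp`, so the change of slope at a point
is the coefficient there. -/
theorem massLE_sub_massLT (t : ℝ) (a : ℝ →₀ ℤ) : massLE t a - massLT t a = a t := by
  induction a using Finsupp.induction_linear with
  | zero => simp
  | add a b ha hb => simp only [map_add, Finsupp.add_apply, ← ha, ← hb]; ring
  | single s k =>
    rw [massLE_single, massLT_single, Finsupp.single_apply]
    rcases lt_trichotomy s t with h | rfl | h
    · simp [h, h.le, h.ne]
    · simp
    · simp [h.not_ge, h.not_gt, h.ne']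

theorem ramp_right (t : ℝ) (a : ℝ →₀ ℤ) :
    ∀ᶠ s in 𝓝[>] (0 : ℝ), ramp (t + s) a = ramp t a + massLE t a * s := by
  induction a using Finsupp.induction_linear with
  | zero => simp
  | add a b ha hb =>
    filter_upwards [ha, hb] with s h1 h2
    simp only [map_add, h1, h2]
    push_cast
    ring
  | single u k =>
    rw [massLE_single]
    split_ifs with h
    · filter_upwards [self_mem_nhdsWithin] with s hs
      have hs' : (0 : ℝ) < s := hs
      rw [ramp_single, ramp_single, max_eq_left (by linarith), max_eq_left (by linarith)]
      ring
    · push Not at h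
      filter_upwards [Ioo_mem_nhdsGT (sub_pos.2 h)] with s hs
      rw [ramp_single, ramp_single, max_eq_right (by linarith [hs.2]),
        max_eq_right (by linarith)]
      simp

theorem ramp_left (t : ℝ) (a : ℝ →₀ ℤ) :
    ∀ᶠ s in 𝓝[>] (0 : ℝ), ramp (t - s) a = ramp t a - massLT t a * s := by
  induction a using Finsupp.induction_linear with
  | zero => simp
  | add a b ha hb =>
    filter_upwards [ha, hb] with s h1 h2
    simp only [map_add, h1, h2]
    push_cast
    ring
  | single u k =>
    rw [massLT_single]
    split_ifs with h
    · filter_upwards [Ioo_mem_nhdsGT (sub_pos.2 h)] with s hs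
      rw [ramp_single, ramp_single, max_eq_left (by linarith [hs.2]), max_eq_left (by linarith)]
      ring
    · push Not at h
      filter_upwards [self_mem_nhdsWithin] with s hs
      have hs' : (0 : ℝ) < s := hs
      rw [ramp_single, ramp_single, max_eq_right (by linarith),
        max_eq_right (by linarith)]
      simp

theorem massLE_eq_zero {a : ℝ →₀ ℤ} {t : ℝ} (h : ∀ s ≤ t, a s = 0) : massLE t a = 0 := by
  rw [massLE, Finsupp.liftAddHom_apply]
  refine Finset.sum_eq_zero fun s _ => ?_
  dsimp only
  split_ifs with hs
  · simp [h s hs]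
  · rfl

theorem massLT_eq_mass {a : ℝ →₀ ℤ} {t : ℝ} (h : ∀ s, t ≤ s → a s = 0) : massLT t a = mass a := by
  rw [massLT, mass, Finsupp.liftAddHom_apply, Finsupp.liftAddHom_apply]
  refine Finset.sum_congr rfl fun s _ => ?_
  dsimp only
  split_ifs with hs
  · rfl
  · simp [h s (not_lt.1 hs)]

theorem ramp_eq_zero {a : ℝ →₀ ℤ} {t : ℝ} (h : ∀ s ≤ t, a s = 0) : ramp t a = 0 := by
  rw [ramp_eq_sum]
  refine Finset.sum_eq_zero fun s _ => ?_
  rcases le_or_gt s t with hs | hs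
  · simp [h s hs]
  · simp [max_eq_right (show t - s ≤ 0 by linarith)]

theorem ramp_of_large {a : ℝ →₀ ℤ} {t : ℝ} (h : ∀ s, t ≤ s → a s = 0) :
    ramp t a = a.sum fun s k => (k : ℝ) * (t - s) := by
  rw [ramp_eq_sum]
  refine Finset.sum_congr rfl fun s hs => ?_
  rcases le_or_gt t s with hs' | hs'
  · simp [h s hs']
  · simp [max_eq_left (show 0 ≤ t - s by linarith)]

/-- Affine germs have a unique slope. -/
theorem slope_unique {f : ℝ → ℝ} {b p q : ℝ} (hp : ∀ᶠ s in 𝓝[>] (0 : ℝ), f s = b + p * s)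
    (hq : ∀ᶠ s in 𝓝[>] (0 : ℝ), f s = b + q * s) : p = q := by
  obtain ⟨s, ⟨h1, h2⟩, hs⟩ := ((hp.and hq).and self_mem_nhdsWithin).exists
  have hs' : (0 : ℝ) < s := hs
  have : (p - q) * s = 0 := by linarith
  rcases mul_eq_zero.1 this with h | h <;> linarith

/-- A function on `[0, ℓ]` with integral affine germs is determined by its initial slope and its
bending. -/
theorem eq_add_ramp {f : ℝ → ℝ} {ℓ : ℝ} {a : ℝ →₀ ℤ} {n : ℤ}
    (ha : ∀ s ≤ 0, a s = 0)
    (h0 : ∀ᶠ s in 𝓝[>] (0 : ℝ), f (0 + s) = f 0 + n * s)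
    (hI : ∀ t ∈ Set.Ioo 0 ℓ, ∃ p q : ℤ, (∀ᶠ s in 𝓝[>] (0 : ℝ), f (t + s) = f t + p * s) ∧
      (∀ᶠ s in 𝓝[>] (0 : ℝ), f (t - s) = f t + q * s) ∧ p + q = a t)
    (hL : ∃ q : ℤ, ∀ᶠ s in 𝓝[>] (0 : ℝ), f (ℓ - s) = f ℓ + q * s) :
    ∀ t ∈ Set.Icc 0 ℓ, f t = f 0 + n * t + ramp t a := by
  -- The difference of the two sides has matching slopes at every interior point, since `ramp`
  -- absorbs the bending `a`.
  have key := eq_zero_of_locally_affine (h := fun t => f t - f 0 - n * t - ramp t a) (ℓ := ℓ)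
    (by simp [ramp_eq_zero ha])
    (by
      filter_upwards [h0, ramp_right 0 a] with s h1 h2
      rw [h1, h2, ramp_eq_zero ha, massLE_eq_zero ha]
      push_cast
      ring)
    (by
      intro t ht
      obtain ⟨p, q, hp, hq, hpq⟩ := hI t ht
      refine ⟨p - n - massLE t a, ?_, ?_⟩
      · filter_upwards [hp, ramp_right t a] with s h1 h2
        rw [h1, h2]
        ring
      · filter_upwards [hq, ramp_left t a] with s h1 h2
        have : (q : ℝ) = massLE t a - massLT t a - p := by
          have := massLE_sub_massLT t a
          rw [← hpq] at this
          have : q = massLE t a - massLT t a - p := by linarith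
          exact_mod_cast this
        rw [h1, h2, this]
        ring)
    (by
      obtain ⟨q, hq⟩ := hL
      refine ⟨q + n + massLT ℓ a, ?_⟩
      filter_upwards [hq, ramp_left ℓ a] with s h1 h2
      rw [h1, h2]
      ring)
  intro t ht
  linarith [key t ht]

variable {V E L : Type*} (C : TropicalCurve V E L)

/-! ### Divisors, edge by edge -/

open Classical in
/-- The part of a divisor in the interior of an edge. -/
noncomputable def edgePart (e : E) : C.Div →+ (ℝ →₀ ℤ) :=
  Finsupp.liftAddHom fun p => match p with
    | .fin (.edge e' t _ _) => if e' = e then Finsupp.singleAddHom t else 0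
    | _ => 0

open Classical in
/-- The part of a divisor in the interior of a leg. -/
noncomputable def legPart (l : L) : C.Div →+ (ℝ →₀ ℤ) :=
  Finsupp.liftAddHom fun p => match p with
    | .fin (.leg l' t _) => if l' = l then Finsupp.singleAddHom t else 0
    | _ => 0

theorem edgePt_of_mem {e : E} {t : ℝ} (h0 : 0 < t) (h1 : t < C.len e) :
    C.edgePt e t = .edge e t h0 h1 := by
  simp [edgePt, h0.not_ge, h1.not_ge]

theorem legPt_of_pos {l : L} {t : ℝ} (h0 : 0 < t) : C.legPt l t = .leg l t h0 := by
  simp [legPt, h0.not_ge]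

theorem edgePart_apply_of_mem (e : E) (D : C.Div) {t : ℝ} (h0 : 0 < t) (h1 : t < C.len e) :
    C.edgePart e D t = D (.fin (.edge e t h0 h1)) := by
  classical
  induction D using Finsupp.induction_linear with
  | zero => simp
  | add a b ha hb => simp only [map_add, Finsupp.add_apply, ha, hb]
  | single p k =>
    rw [edgePart, Finsupp.liftAddHom_apply_single, Finsupp.single_apply]
    rcases p with (v | ⟨e', t', h0', h1'⟩ | ⟨l, t', h0'⟩) | l
    · simp
    · dsimp only
      by_cases he : e' = e
      · subst he
        simp [Finsupp.single_apply]
      · simp [he]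
    · simp
    · simp

theorem edgePart_apply_of_notMem (e : E) (D : C.Div) {t : ℝ} (h : ¬ (0 < t ∧ t < C.len e)) :
    C.edgePart e D t = 0 := by
  classical
  induction D using Finsupp.induction_linear with
  | zero => simp
  | add a b ha hb => simp only [map_add, Finsupp.add_apply, ha, hb, add_zero]
  | single p k =>
    rw [edgePart, Finsupp.liftAddHom_apply_single]
    rcases p with (v | ⟨e', t', h0', h1'⟩ | ⟨l, t', h0'⟩) | l
    · simp
    · dsimp only
      by_cases he : e' = e
      · subst he
        simp only [if_true, Finsupp.singleAddHom_apply, Finsupp.single_apply]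
        rw [if_neg]
        rintro rfl
        exact h ⟨h0', h1'⟩
      · simp [he]
    · simp
    · simp

theorem legPart_apply_of_pos (l : L) (D : C.Div) {t : ℝ} (h0 : 0 < t) :
    C.legPart l D t = D (.fin (.leg l t h0)) := by
  classical
  induction D using Finsupp.induction_linear with
  | zero => simp
  | add a b ha hb => simp only [map_add, Finsupp.add_apply, ha, hb]
  | single p k =>
    rw [legPart, Finsupp.liftAddHom_apply_single, Finsupp.single_apply]
    rcases p with (v | ⟨e', t', h0', h1'⟩ | ⟨l', t', h0'⟩) | l'
    · simp
    · simp
    · dsimp only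
      by_cases he : l' = l
      · subst he
        simp [Finsupp.single_apply]
      · simp [he]
    · simp

theorem legPart_apply_of_nonpos (l : L) (D : C.Div) {t : ℝ} (h : t ≤ 0) :
    C.legPart l D t = 0 := by
  classical
  induction D using Finsupp.induction_linear with
  | zero => simp
  | add a b ha hb => simp only [map_add, Finsupp.add_apply, ha, hb, add_zero]
  | single p k =>
    rw [legPart, Finsupp.liftAddHom_apply_single]
    rcases p with (v | ⟨e', t', h0', h1'⟩ | ⟨l', t', h0'⟩) | l'
    · simp
    · simp
    · dsimp only
      by_cases he : l' = l
      · subst he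
        simp only [if_true, Finsupp.singleAddHom_apply, Finsupp.single_apply]
        rw [if_neg]
        rintro rfl
        exact absurd h0' h.not_gt
      · simp [he]
    · simp

/-- Summation over a divisor, edge by edge. -/
theorem sum_eq_sum_parts [Fintype V] [Fintype E] [Fintype L] {G : Type*} [AddCommGroup G]
    (φ : C.Point → G) (D : C.Div) :
    (D.sum fun p k => k • φ p) = ∑ v, D (.fin (.vert v)) • φ (.fin (.vert v)) +
      ∑ e, ((C.edgePart e D).sum fun t k => k • φ (.fin (C.edgePt e t))) +
      ∑ l, ((C.legPart l D).sum fun t k => k • φ (.fin (C.legPt l t))) +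
      ∑ l, D (.infty l) • φ (.infty l) := by
  classical
  induction D using Finsupp.induction_linear with
  | zero => simp
  | add a b ha hb =>
    rw [Finsupp.sum_add_index' (by simp) (by simp [add_smul]), ha, hb]
    have h1 : ∀ e, ((C.edgePart e (a + b)).sum fun t k => k • φ (.fin (C.edgePt e t))) =
        ((C.edgePart e a).sum fun t k => k • φ (.fin (C.edgePt e t))) +
        ((C.edgePart e b).sum fun t k => k • φ (.fin (C.edgePt e t))) := fun e => by
      rw [map_add, Finsupp.sum_add_index' (by simp) (by simp [add_smul])]
    have h2 : ∀ l, ((C.legPart l (a + b)).sum fun t k => k • φ (.fin (C.legPt l t))) =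
        ((C.legPart l a).sum fun t k => k • φ (.fin (C.legPt l t))) +
        ((C.legPart l b).sum fun t k => k • φ (.fin (C.legPt l t))) := fun l => by
      rw [map_add, Finsupp.sum_add_index' (by simp) (by simp [add_smul])]
    simp only [h1, h2, Finsupp.add_apply, add_smul, Finset.sum_add_distrib]
    abel
  | single p k =>
    rw [Finsupp.sum_single_index (by simp)]
    have hE : ∀ e, C.edgePart e (Finsupp.single p k) = match p with
      | .fin (.edge e' t _ _) => if e' = e then Finsupp.single t k else 0
      | _ => 0 := by
      intro e
      rw [edgePart, Finsupp.liftAddHom_apply_single]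
      rcases p with (v | ⟨e', t', h0', h1'⟩ | ⟨l', t', h0'⟩) | l' <;> try rfl
      dsimp only
      split_ifs <;> rfl
    have hL : ∀ l, C.legPart l (Finsupp.single p k) = match p with
      | .fin (.leg l' t _) => if l' = l then Finsupp.single t k else 0
      | _ => 0 := by
      intro l
      rw [legPart, Finsupp.liftAddHom_apply_single]
      rcases p with (v | ⟨e', t', h0', h1'⟩ | ⟨l', t', h0'⟩) | l' <;> try rfl
      dsimp only
      split_ifs <;> rfl
    simp only [hE, hL]
    rcases p with (v | ⟨e', t', h0', h1'⟩ | ⟨l', t', h0'⟩) | l'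
    · simp [Finsupp.single_apply]
    · dsimp only
      rw [Finset.sum_eq_single (ι := E) e' (fun e _ h => by simp [Ne.symm h]) (by simp)]
      simp [Finsupp.sum_single_index, C.edgePt_of_mem h0' h1']
    · dsimp only
      rw [Finset.sum_eq_single (ι := L) l' (fun e _ h => by simp [Ne.symm h]) (by simp)]
      rw [if_pos rfl, Finsupp.sum_single_index (by simp), C.legPt_of_pos h0']
      simp
    · simp [Finsupp.single_apply]

theorem deg_eq_sum_parts [Fintype V] [Fintype E] [Fintype L] (D : C.Div) :
    C.deg D = ∑ v, D (.fin (.vert v)) + ∑ e, mass (C.edgePart e D) +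
      ∑ l, mass (C.legPart l D) + ∑ l, D (.infty l) := by
  have := C.sum_eq_sum_parts (fun _ => (1 : ℤ)) D
  simp only [smul_eq_mul, mul_one] at this
  simp only [deg, this, mass_eq_sum]

theorem deg_add (D D' : C.Div) : C.deg (D + D') = C.deg D + C.deg D' :=
  Finsupp.sum_add_index' (by simp) (by simp)

theorem deg_sub (D D' : C.Div) : C.deg (D - D') = C.deg D - C.deg D' :=
  Finsupp.sum_sub_index (by simp)

theorem deg_single (p : C.Point) (k : ℤ) : C.deg (Finsupp.single p k) = k :=
  Finsupp.sum_single_index rfl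

/-! ### Sums over tangent directions -/

section Directions

variable [Fintype E] [Fintype L] {M : Type*} [AddCommMonoid M]

open Classical in
theorem sum_outDirs_vert (v : V) (φ : Dir E L → M) :
    ∑ d ∈ C.outDirs (.fin (.vert v)), φ d = ∑ e with C.src e = v, φ (.inl e, true) +
      ∑ e with C.tgt e = v, φ (.inl e, false) + ∑ l with C.base l = v, φ (.inr l, true) := by
  have h : ∀ l : L, (if C.Emanates (.fin (.vert v)) (.inr l, false) then φ (.inr l, false) else 0)
      = 0 := fun l => if_neg id
  simp only [outDirs, Finset.sum_filter, Fintype.sum_prod_type, Fintype.sum_sum_type,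
    Fintype.sum_bool, h, Finset.sum_add_distrib]
  simp only [Emanates, Finset.sum_const_zero, add_zero]
  rw [add_right_comm]
  congr!

theorem sum_outDirs_edge (e : E) (t : ℝ) (h0 h1) (φ : Dir E L → M) :
    ∑ d ∈ C.outDirs (.fin (.edge e t h0 h1)), φ d = φ (.inl e, true) + φ (.inl e, false) := by
  classical
  simp [outDirs, Finset.sum_filter, Fintype.sum_prod_type, Fintype.sum_sum_type, Emanates,
    Finset.sum_add_distrib]

theorem sum_outDirs_leg (l : L) (t : ℝ) (h0) (φ : Dir E L → M) :
    ∑ d ∈ C.outDirs (.fin (.leg l t h0)), φ d = φ (.inr l, true) + φ (.inr l, false) := by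
  classical
  simp [outDirs, Finset.sum_filter, Fintype.sum_prod_type, Fintype.sum_sum_type, Emanates,
    Finset.sum_add_distrib]

theorem sum_outDirs_infty (l : L) (φ : Dir E L → M) :
    ∑ d ∈ C.outDirs (.infty l), φ d = φ (.inr l, false) := by
  have : C.outDirs (.infty l) = {(.inr l, false)} := by
    ext d
    simp [outDirs, Emanates]
  rw [this, Finset.sum_singleton]

theorem mem_outDirs {p : C.Point} {d : Dir E L} : d ∈ C.outDirs p ↔ C.Emanates p d := by
  simp [outDirs]

end Directions

end TropicalCurve

/-! ### Abel's theorem -/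

namespace TropicalCurve

variable {V E L : Type*} (C : TropicalCurve V E L)

/-! ### Chains and potentials -/

theorem toJac_eq_iff [Fintype E] {x y : C.FormDual} : C.toJac x = C.toJac y ↔ x - y ∈ C.lattice :=
  QuotientAddGroup.eq_iff_sub_mem

theorem toJac_add [Fintype E] (x y : C.FormDual) : C.toJac (x + y) = C.toJac x + C.toJac y := rfl

theorem toJac_sub [Fintype E] (x y : C.FormDual) : C.toJac (x - y) = C.toJac x - C.toJac y := rfl

theorem toJac_zero [Fintype E] : C.toJac 0 = 0 := rfl

theorem toJac_zsmul [Fintype E] (k : ℤ) (x : C.FormDual) : C.toJac (k • x) = k • C.toJac x := rfl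

theorem toJac_cycleInt [Fintype E] (c : C.H1 ℤ) : C.toJac (C.cycleInt c) = 0 :=
  (QuotientAddGroup.eq_zero_iff _).2 ⟨c, rfl⟩

open Classical in
/-- Pushing forward a function along a map and then summing. -/
theorem sum_fiber_smul {ι κ R G : Type*} [Fintype ι] [Fintype κ] [Semiring R] [AddCommMonoid G]
    [Module R G] (f : ι → κ) (k : ι → R) (φ : κ → G) :
    ∑ v, (∑ e with f e = v, k e) • φ v = ∑ e, k e • φ (f e) := by
  simp only [Finset.sum_smul]
  rw [← Finset.sum_fiberwise (s := Finset.univ) (g := f)]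
  refine Finset.sum_congr rfl fun v _ => ?_
  refine Finset.sum_congr (by congr!) fun e he => ?_
  rw [(Finset.mem_filter.1 he).2]

open Classical in
theorem sum_fiber {ι κ G : Type*} [Fintype ι] [Fintype κ] [AddCommMonoid G]
    (f : ι → κ) (k : ι → G) : ∑ v, ∑ e with f e = v, k e = ∑ e, k e := Finset.sum_fiberwise _ f k

/-- Summation by parts: the boundary map is adjoint to the gradient. -/
theorem sum_boundary_smul [Fintype V] [Fintype E] {R G : Type*} [CommRing R] [AddCommGroup G]
    [Module R G] (k : E → R) (φ : V → G) :
    ∑ v, C.boundary R k v • φ v = ∑ e, k e • (φ (C.tgt e) - φ (C.src e)) := by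
  classical
  simp only [boundary, LinearMap.coe_mk, AddHom.coe_mk, sub_smul, Finset.sum_sub_distrib, smul_sub]
  congr 1
  · exact sum_fiber_smul C.tgt k φ
  · exact sum_fiber_smul C.src k φ

open Classical in
theorem boundary_single [Fintype E] (R : Type*) [CommRing R] (e : E) (r : R) :
    C.boundary R (Pi.single e r) = Pi.single (C.tgt e) r - Pi.single (C.src e) r := by
  ext v
  simp only [boundary, LinearMap.coe_mk, AddHom.coe_mk, Pi.sub_apply, Finset.sum_filter,
    Pi.single_apply]
  congr 1
  all_goals
    rw [Finset.sum_eq_single e (fun e' _ h => by simp [h]) (by simp)]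
    simp [eq_comm]

open Classical in
theorem exists_chain [Fintype E] (v w : V) :
    ∃ k : E → ℤ, C.boundary ℤ k = Pi.single w 1 - Pi.single v 1 := by
  induction C.connected v w with
  | rel a b h =>
    obtain ⟨e, rfl, rfl⟩ := h
    exact ⟨_, C.boundary_single ℤ e 1⟩
  | refl a => exact ⟨0, by simp⟩
  | symm a b _ ih =>
    obtain ⟨k, hk⟩ := ih
    exact ⟨-k, by rw [map_neg, hk, neg_sub]⟩
  | trans a b c _ _ ih ih' =>
    obtain ⟨k, hk⟩ := ih
    obtain ⟨k', hk'⟩ := ih'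
    exact ⟨k + k', by rw [map_add, hk, hk']; abel⟩

/-- A reference vertex. -/
noncomputable def root : V := C.nonempty.some

section

variable [Fintype E]

/-- A chain from the reference vertex to `v`. -/
noncomputable def chain (v : V) : E → ℤ := (C.exists_chain C.root v).choose

open Classical in
theorem boundary_chain (v : V) :
    C.boundary ℤ (C.chain v) = Pi.single v 1 - Pi.single C.root 1 :=
  (C.exists_chain C.root v).choose_spec

open Classical in
/-- The cycle which runs to the source of `e`, along `e`, and back to the reference vertex. -/
noncomputable def edgeCycle (e : E) : C.H1 ℤ :=
  ⟨C.chain (C.src e) + Pi.single e 1 - C.chain (C.tgt e), by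
    rw [H1, LinearMap.mem_ker, map_sub, map_add, boundary_chain, boundary_chain, boundary_single]
    abel⟩

open Classical in
theorem edgeCycle_coe (e : E) :
    (C.edgeCycle e : E → ℤ) = C.chain (C.src e) + Pi.single e 1 - C.chain (C.tgt e) := rfl

/-- The functional `∑ y e • unitVec e`. -/
noncomputable def ofEdges : (E → ℝ) →ₗ[ℝ] C.FormDual where
  toFun y := ∑ e, y e • C.unitVec e
  map_add' y y' := by simp [add_smul, Finset.sum_add_distrib]
  map_smul' r y := by simp [Finset.smul_sum, smul_smul]

theorem ofEdges_eq_sum (y : E → ℝ) : C.ofEdges y = ∑ e, y e • C.unitVec e := rfl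

theorem ofEdges_apply (y : E → ℝ) (c : C.H1 ℤ) :
    C.ofEdges y c = ∑ e, y e * ((c : E → ℤ) e : ℝ) := by
  simp [ofEdges_eq_sum, unitVec, LinearMap.sum_apply, LinearMap.smul_apply]

open Classical in
theorem ofEdges_single (e : E) (r : ℝ) : C.ofEdges (Pi.single e r) = r • C.unitVec e := by
  rw [ofEdges_eq_sum, Finset.sum_eq_single e (fun e' _ h => by simp [h]) (by simp)]
  simp

theorem cycleInt_eq_ofEdges (c : C.H1 ℤ) :
    C.cycleInt c = C.ofEdges fun e => ((c : E → ℤ) e : ℝ) * C.len e := rfl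

theorem ofEdges_gradient [Fintype V] (h : V → ℝ) :
    C.ofEdges (fun e => h (C.tgt e) - h (C.src e)) = 0 := by
  ext c
  rw [ofEdges_apply, LinearMap.zero_apply]
  have := C.sum_boundary_smul (R := ℤ) (c : E → ℤ) h
  have hc : C.boundary ℤ c = 0 := c.2
  rw [hc] at this
  simp only [Pi.zero_apply, zero_smul, Finset.sum_const_zero, zsmul_eq_mul] at this
  rw [this]
  exact Finset.sum_congr rfl fun e _ => mul_comm _ _

/-- The converse of `ofEdges_gradient`. The potential at `v` is the integral of `y` along the
reference chain to `v`; testing the zero functional on the cycle that closes up `e` gives the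
identity on `e`. -/
theorem exists_potential {y : E → ℝ} (hy : C.ofEdges y = 0) :
    ∃ h : V → ℝ, ∀ e, y e = h (C.tgt e) - h (C.src e) := by
  classical
  refine ⟨fun v => ∑ e, y e * C.chain v e, fun e => ?_⟩
  have := congrArg (fun x : C.FormDual => x (C.edgeCycle e)) hy
  simp only [ofEdges_apply, edgeCycle_coe, LinearMap.zero_apply, Pi.add_apply, Pi.sub_apply,
    Int.cast_add, Int.cast_sub, mul_add, mul_sub, Finset.sum_add_distrib,
    Finset.sum_sub_distrib] at this
  rw [Finset.sum_eq_single (s := Finset.univ) (f := fun x => y x * ((Pi.single e 1 : E → ℤ) x : ℝ))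
    e (fun e' _ h => by simp [h]) (by simp)] at this
  simp only [Pi.single_eq_same, Int.cast_one, mul_one] at this
  linarith

/-- By connectedness a vertex function of total zero is a combination of differences from the
reference vertex, each bounded by a reference chain. -/
theorem exists_boundary_eq [Fintype V] {r : V → ℤ} (hr : ∑ v, r v = 0) :
    ∃ k : E → ℤ, C.boundary ℤ k = r := by
  classical
  refine ⟨∑ v, r v • C.chain v, ?_⟩
  rw [map_sum]
  simp only [map_smul, boundary_chain, smul_sub, Finset.sum_sub_distrib]
  rw [← Finset.sum_smul, hr, zero_smul, sub_zero]
  ext w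
  simp [Finset.sum_apply, Pi.single_apply]

/-! ### A lift of the Abel-Jacobi map -/

/-- The integral along the reference chain to a vertex. -/
noncomputable def refVert (v : V) : C.FormDual :=
  C.ofEdges fun e => (C.chain v e : ℝ) * C.len e

/-- A lift of the Abel-Jacobi map based at the reference vertex. -/
noncomputable def refPt : C.FinPoint → C.FormDual
  | .vert v => C.refVert v
  | .edge e t _ _ => C.refVert (C.src e) + t • C.unitVec e
  | .leg l _ _ => C.refVert (C.base l)

/-- The chosen lift jumps by a period at the target of an edge. The jump disappears in the Jacobian,
but in the theta function it is the source of the correction terms. -/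
theorem refVert_tgt (e : E) :
    C.refVert (C.src e) + C.len e • C.unitVec e =
      C.refVert (C.tgt e) + C.cycleInt (C.edgeCycle e) := by
  classical
  rw [cycleInt_eq_ofEdges, ← ofEdges_single, refVert, refVert, ← map_add, ← map_add]
  congr 1
  ext e'
  simp only [Pi.add_apply, edgeCycle_coe, Pi.sub_apply, Pi.single_apply]
  split_ifs with h
  · subst h
    push_cast
    ring
  · push_cast
    ring

theorem toJac_refPt_edgePt (e : E) {t : ℝ} (ht : t ∈ Set.Icc 0 (C.len e)) :
    C.toJac (C.refPt (C.edgePt e t)) = C.toJac (C.refVert (C.src e) + t • C.unitVec e) := by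
  rcases eq_or_lt_of_le ht.1 with rfl | h0
  · simp [edgePt_zero, refPt]
  rcases eq_or_lt_of_le ht.2 with rfl | h1
  · rw [edgePt_len, refVert_tgt, toJac_add, toJac_cycleInt, add_zero, refPt]
  · rw [C.edgePt_of_mem h0 h1, refPt]

theorem refPt_vert (v : V) : C.refPt (.vert v) = C.refVert v := rfl

theorem refPt_legPt (l : L) (t : ℝ) : C.refPt (C.legPt l t) = C.refVert (C.base l) := by
  unfold legPt
  split_ifs <;> rfl

variable {C} in
theorem IsPath.toJac_eq {p q : C.FinPoint} {r : ℝ} {x : C.FormDual} (h : C.IsPath p q r x) :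
    C.toJac x = C.toJac (C.refPt q) - C.toJac (C.refPt p) := by
  induction h with
  | nil => rw [sub_self, toJac_zero]
  | edge e s t hs ht _ ih =>
    rw [toJac_add, ih, C.toJac_refPt_edgePt e hs, C.toJac_refPt_edgePt e ht, sub_smul, toJac_add,
      toJac_add, toJac_sub]
    abel
  | leg l s t hs ht _ ih => rw [ih, refPt_legPt, refPt_legPt]

/-- Whatever path was chosen to define `pathInt`, modulo periods its integral depends only on the
endpoints. -/
theorem toJac_pathInt (p₀ p : C.Point) : C.toJac (C.pathInt p₀ p) =
    C.toJac (C.refPt (C.finPart p)) - C.toJac (C.refPt (C.finPart p₀)) :=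
  (C.exists_path (C.finPart p₀) (C.finPart p)).choose_spec.choose_spec.toJac_eq

/-- The Abel-Jacobi map on divisors, based at the reference vertex. -/
noncomputable def refJac : C.Div →+ C.Jac :=
  Finsupp.liftAddHom fun p => zmultiplesHom C.Jac (C.toJac (C.refPt (C.finPart p)))

theorem refJac_eq_sum (D : C.Div) :
    C.refJac D = D.sum fun p k => k • C.toJac (C.refPt (C.finPart p)) := by
  rw [refJac, Finsupp.liftAddHom_apply]
  rfl

theorem refJac_single (p : C.Point) (k : ℤ) :
    C.refJac (Finsupp.single p k) = k • C.toJac (C.refPt (C.finPart p)) := by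
  simp [refJac]

/-- Trades the arbitrary base point for the reference vertex, at the price of a multiple of the
degree; `refJac` is additive and free of choices of paths. -/
theorem abelJacobi_eq (p₀ : C.Point) (D : C.Div) :
    C.abelJacobi p₀ D = C.refJac D - C.deg D • C.toJac (C.refPt (C.finPart p₀)) := by
  have h : C.abelJacobi p₀ D = D.sum fun p a => a • C.toJac (C.pathInt p₀ p) :=
    map_finsuppSum (QuotientAddGroup.mk' C.lattice) _ _
  rw [h, refJac_eq_sum, deg, Finsupp.sum, Finsupp.sum, Finsupp.sum, Finset.sum_smul,
    ← Finset.sum_sub_distrib]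
  exact Finset.sum_congr rfl fun p _ => by rw [toJac_pathInt, smul_sub]

/-! ### Flows -/

open Classical in
/-- The divisor `D` is the divisor of a possibly multivalued piecewise linear function which has
initial slope `n e` on the edge `e` and `m l` on the leg `l`. -/
def IsFlow [Fintype L] (D : C.Div) (n : E → ℤ) (m : L → ℤ) : Prop :=
  (∀ v, D (.fin (.vert v)) = ∑ e with C.src e = v, n e -
    ∑ e with C.tgt e = v, (n e + mass (C.edgePart e D)) + ∑ l with C.base l = v, m l) ∧
  ∀ l, D (.infty l) = -(m l + mass (C.legPart l D))

/-- The change of the multivalued function along the edges. -/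
noncomputable def rise (D : C.Div) (n : E → ℤ) (e : E) : ℝ :=
  n e * C.len e + ramp (C.len e) (C.edgePart e D)

variable {C} in
theorem IsFlow.deg_eq_zero [Fintype V] [Fintype L] {D : C.Div} {n : E → ℤ} {m : L → ℤ}
    (h : C.IsFlow D n m) :
    C.deg D = 0 := by
  classical
  rw [deg_eq_sum_parts]
  simp only [h.1, h.2, Finset.sum_add_distrib, Finset.sum_sub_distrib, Finset.sum_neg_distrib]
  rw [sum_fiber C.src n, sum_fiber C.base m, sum_fiber C.tgt n,
    sum_fiber C.tgt (fun e => mass (C.edgePart e D))]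
  ring

/-- Evaluates a first moment: every point is pushed to the far end `ℓ`, and the distances travelled
add up to `ramp ℓ a`. -/
theorem sum_smul_affine (a : ℝ →₀ ℤ) {ℓ : ℝ} (h : ∀ s, ℓ ≤ s → a s = 0) (x u : C.FormDual) :
    (a.sum fun t k => k • (x + t • u)) =
      mass a • (x + ℓ • u) - ramp ℓ a • u := by
  rw [mass_eq_sum, ramp_of_large h, Finsupp.sum, Finsupp.sum, Finsupp.sum, Finset.sum_smul,
    Finset.sum_smul, ← Finset.sum_sub_distrib]
  refine Finset.sum_congr rfl fun t _ => ?_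
  ext c
  simp only [LinearMap.smul_apply, LinearMap.add_apply, LinearMap.sub_apply, smul_eq_mul,
    zsmul_eq_mul]
  ring

variable {C} in
-- Push the points inside `e` to its target. Their masses then cancel against the flow condition at
-- the target, and the slope `n e` contributes the image of the source minus that of the target,
-- which is minus `n e` times the whole edge. A leg maps to one point and its contributions sum to
-- zero.
theorem IsFlow.refJac_eq [Fintype V] [Fintype L] {D : C.Div} {n : E → ℤ} {m : L → ℤ}
    (h : C.IsFlow D n m) :
    C.refJac D = -C.toJac (C.ofEdges (C.rise D n)) := by
  classical
  have hedge : ∀ e, ((C.edgePart e D).sum fun t k => k • C.toJac (C.refPt (C.edgePt e t))) =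
      mass (C.edgePart e D) • C.toJac (C.refVert (C.tgt e)) -
        C.toJac (ramp (C.len e) (C.edgePart e D) • C.unitVec e) := by
    intro e
    have h1 : ((C.edgePart e D).sum fun t k => k • C.toJac (C.refPt (C.edgePt e t))) =
        C.toJac ((C.edgePart e D).sum fun t k => k • (C.refVert (C.src e) + t • C.unitVec e)) := by
      refine Eq.trans ?_ (map_finsuppSum (QuotientAddGroup.mk' C.lattice) _ _).symm
      refine Finset.sum_congr rfl fun t ht => ?_
      have : 0 < t ∧ t < C.len e := by
        by_contra hcon
        exact (Finsupp.mem_support_iff.1 ht) (C.edgePart_apply_of_notMem e D hcon)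
      dsimp only
      rw [C.toJac_refPt_edgePt e ⟨this.1.le, this.2.le⟩]
      rfl
    rw [h1, C.sum_smul_affine (C.edgePart e D) (ℓ := C.len e) (fun s hs =>
      C.edgePart_apply_of_notMem e D fun h => absurd h.2 hs.not_gt), refVert_tgt, toJac_sub,
      toJac_zsmul, toJac_add, toJac_cycleInt, add_zero]
  have hleg : ∀ l, ((C.legPart l D).sum fun t k => k • C.toJac (C.refPt (C.legPt l t))) =
      mass (C.legPart l D) • C.toJac (C.refVert (C.base l)) := by
    intro l
    rw [mass_eq_sum, Finsupp.sum, Finsupp.sum, Finset.sum_smul]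
    exact Finset.sum_congr rfl fun t _ => by rw [refPt_legPt]
  rw [refJac_eq_sum, C.sum_eq_sum_parts (fun p => C.toJac (C.refPt (C.finPart p)))]
  simp only [finPart, hedge, hleg, refPt_vert, h.1, h.2, add_smul, sub_smul, neg_smul,
    Finset.sum_add_distrib, Finset.sum_sub_distrib, Finset.sum_neg_distrib]
  rw [sum_fiber_smul C.src n (fun v => C.toJac (C.refVert v)),
    sum_fiber_smul C.base m (fun v => C.toJac (C.refVert v)),
    sum_fiber_smul C.tgt n (fun v => C.toJac (C.refVert v)),
    sum_fiber_smul C.tgt (fun e => mass (C.edgePart e D)) (fun v => C.toJac (C.refVert v))]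
  have htgt : ∀ e, C.toJac (C.refVert (C.tgt e)) =
      C.toJac (C.refVert (C.src e)) + C.toJac (C.len e • C.unitVec e) := by
    intro e
    rw [← toJac_add, refVert_tgt, toJac_add, toJac_cycleInt, add_zero]
  have hrise : C.toJac (C.ofEdges (C.rise D n)) = ∑ e, n e • C.toJac (C.len e • C.unitVec e) +
      ∑ e, C.toJac (ramp (C.len e) (C.edgePart e D) • C.unitVec e) := by
    have : C.ofEdges (C.rise D n) = ∑ e, n e • (C.len e • C.unitVec e) +
      ∑ e, ramp (C.len e) (C.edgePart e D) • C.unitVec e := by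
      rw [ofEdges_eq_sum, ← Finset.sum_add_distrib]
      refine Finset.sum_congr rfl fun e _ => ?_
      rw [rise, add_smul, mul_smul, Int.cast_smul_eq_zsmul]
    rw [this, toJac_add]
    congr 1
    · exact map_sum (QuotientAddGroup.mk' C.lattice) _ _
    · exact map_sum (QuotientAddGroup.mk' C.lattice) _ _
  rw [hrise]
  have h2 : ∑ e, n e • C.toJac (C.refVert (C.tgt e)) = ∑ e, n e • C.toJac (C.refVert (C.src e)) +
      ∑ e, n e • C.toJac (C.len e • C.unitVec e) := by
    simp only [htgt, smul_add, Finset.sum_add_distrib]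
  rw [h2]
  abel

/-- The slopes on legs are forced by the multiplicities at infinity. The conditions at the vertices
then prescribe the boundary of the chain of slopes, which is solvable because the prescribed total
is the degree up to sign. -/
theorem exists_flow [Fintype V] [Fintype L] {D : C.Div} (h : C.deg D = 0) :
    ∃ n m, C.IsFlow D n m := by
  classical
  let m : L → ℤ := fun l => -D (.infty l) - mass (C.legPart l D)
  obtain ⟨k, hk⟩ := C.exists_boundary_eq (r := fun v => -(D (.fin (.vert v)) +
    ∑ e with C.tgt e = v, mass (C.edgePart e D) - ∑ l with C.base l = v, m l)) (by
      rw [deg_eq_sum_parts] at h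
      rw [Finset.sum_neg_distrib, Finset.sum_sub_distrib, Finset.sum_add_distrib,
        sum_fiber C.tgt (fun e => mass (C.edgePart e D)), sum_fiber C.base m]
      simp only [m, Finset.sum_sub_distrib, Finset.sum_neg_distrib]
      linarith)
  refine ⟨k, m, fun v => ?_, fun l => by simp [m]⟩
  have := congrFun hk v
  simp only [boundary, LinearMap.coe_mk, AddHom.coe_mk] at this
  rw [Finset.sum_add_distrib]
  linarith

variable {C} in
theorem IsFlow.sub_cycle [Fintype L] {D : C.Div} {n : E → ℤ} {m : L → ℤ}
    (h : C.IsFlow D n m) (c : C.H1 ℤ) :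
    C.IsFlow D (n - (c : E → ℤ)) m := by
  classical
  refine ⟨fun v => ?_, h.2⟩
  have hc : C.boundary ℤ c = 0 := c.2
  have := congrFun hc v
  simp only [boundary, LinearMap.coe_mk, AddHom.coe_mk, Pi.zero_apply] at this
  rw [h.1 v]
  simp only [Pi.sub_apply, Finset.sum_add_distrib, Finset.sum_sub_distrib]
  linarith

theorem rise_sub_cycle (D : C.Div) (n : E → ℤ) (c : C.H1 ℤ) :
    C.ofEdges (C.rise D (n - (c : E → ℤ))) = C.ofEdges (C.rise D n) - C.cycleInt c := by
  rw [cycleInt_eq_ofEdges, ← map_sub]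
  congr 1
  ext e
  simp only [rise, Pi.sub_apply]
  push_cast
  ring

end

/-! ### Piecewise linear functions and Abel's theorem -/

theorem edgePart_zero (D : C.Div) (e : E) : ∀ s ≤ 0, C.edgePart e D s = 0 := fun _ hs =>
  C.edgePart_apply_of_notMem e D fun h => absurd h.1 hs.not_gt

theorem edgePart_len (D : C.Div) (e : E) : ∀ s, C.len e ≤ s → C.edgePart e D s = 0 := fun _ hs =>
  C.edgePart_apply_of_notMem e D fun h => absurd h.2 hs.not_gt

/-- The function `f` has initial slopes `n`, `m` and bends along `D` in the interior of edges and
legs. -/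
def HasForm (f : C.FinPoint → ℝ) (D : C.Div) (n : E → ℤ) (m : L → ℤ) : Prop :=
  (∀ e, ∀ t ∈ Set.Icc 0 (C.len e),
    f (C.edgePt e t) = f (.vert (C.src e)) + n e * t + ramp t (C.edgePart e D)) ∧
  ∀ l t, 0 ≤ t → f (C.legPt l t) = f (.vert (C.base l)) + m l * t + ramp t (C.legPart l D)

variable {C} {f : C.FinPoint → ℝ} {D : C.Div} {n : E → ℤ} {m : L → ℤ}

theorem HasForm.slope_src (h : C.HasForm f D n m) (e : E) :
    C.HasSlope f (.fin (.vert (C.src e))) (.inl e, true) (n e) := by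
  simp only [HasSlope, move, coord]
  filter_upwards [ramp_right 0 (C.edgePart e D), Ioo_mem_nhdsGT (C.len_pos e)] with s hs hs'
  rw [zero_add] at hs ⊢
  rw [h.1 e s ⟨hs'.1.le, hs'.2.le⟩, hs, ramp_eq_zero (C.edgePart_zero D e),
    massLE_eq_zero (C.edgePart_zero D e)]
  simp

theorem HasForm.slope_tgt (h : C.HasForm f D n m) (e : E) :
    C.HasSlope f (.fin (.vert (C.tgt e))) (.inl e, false) (-(n e + mass (C.edgePart e D))) := by
  simp only [HasSlope, move, coord]
  filter_upwards [ramp_left (C.len e) (C.edgePart e D), Ioo_mem_nhdsGT (C.len_pos e)] with s hs hs'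
  rw [h.1 e _ ⟨by linarith [hs'.2], by linarith [hs'.1]⟩, hs, ← C.edgePt_len e,
    h.1 e _ ⟨(C.len_pos e).le, le_rfl⟩, massLT_eq_mass (C.edgePart_len D e)]
  push_cast
  ring

theorem HasForm.slope_edge_right (h : C.HasForm f D n m) (e : E) (t : ℝ) (h0 h1) :
    C.HasSlope f (.fin (.edge e t h0 h1)) (.inl e, true) (n e + massLE t (C.edgePart e D)) := by
  simp only [HasSlope, move, coord]
  filter_upwards [ramp_right t (C.edgePart e D), Ioo_mem_nhdsGT (sub_pos.2 h1)] with s hs hs'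
  rw [h.1 e _ ⟨by linarith [hs'.1], by linarith [hs'.2]⟩, hs, ← C.edgePt_of_mem h0 h1,
    h.1 e _ ⟨h0.le, h1.le⟩]
  push_cast
  ring

theorem HasForm.slope_edge_left (h : C.HasForm f D n m) (e : E) (t : ℝ) (h0 h1) :
    C.HasSlope f (.fin (.edge e t h0 h1)) (.inl e, false) (-(n e + massLT t (C.edgePart e D))) := by
  simp only [HasSlope, move, coord]
  filter_upwards [ramp_left t (C.edgePart e D), Ioo_mem_nhdsGT h0] with s hs hs'
  rw [h.1 e _ ⟨by linarith [hs'.2], by linarith [hs'.1]⟩, hs, ← C.edgePt_of_mem h0 h1,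
    h.1 e _ ⟨h0.le, h1.le⟩]
  push_cast
  ring

theorem HasForm.slope_base (h : C.HasForm f D n m) (l : L) :
    C.HasSlope f (.fin (.vert (C.base l))) (.inr l, true) (m l) := by
  have h0 : ∀ s ≤ 0, C.legPart l D s = 0 := fun s hs => C.legPart_apply_of_nonpos l D hs
  simp only [HasSlope, move, coord]
  filter_upwards [ramp_right 0 (C.legPart l D), self_mem_nhdsWithin] with s hs hs'
  rw [zero_add] at hs ⊢
  rw [h.2 l s (le_of_lt hs'), hs, ramp_eq_zero h0, massLE_eq_zero h0]
  simp

theorem HasForm.slope_leg_right (h : C.HasForm f D n m) (l : L) (t : ℝ) (h0) :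
    C.HasSlope f (.fin (.leg l t h0)) (.inr l, true) (m l + massLE t (C.legPart l D)) := by
  simp only [HasSlope, move, coord]
  filter_upwards [ramp_right t (C.legPart l D), self_mem_nhdsWithin] with s hs hs'
  have hs'' : (0 : ℝ) < s := hs'
  rw [h.2 l _ (by linarith), hs, ← C.legPt_of_pos h0, h.2 l _ h0.le]
  push_cast
  ring

theorem HasForm.slope_leg_left (h : C.HasForm f D n m) (l : L) (t : ℝ) (h0) :
    C.HasSlope f (.fin (.leg l t h0)) (.inr l, false) (-(m l + massLT t (C.legPart l D))) := by
  simp only [HasSlope, move, coord]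
  filter_upwards [ramp_left t (C.legPart l D), Ioo_mem_nhdsGT h0] with s hs hs'
  rw [h.2 l _ (by linarith [hs'.2]), hs, ← C.legPt_of_pos h0, h.2 l _ h0.le]
  push_cast
  ring

theorem exists_support_bound (a : ℝ →₀ ℤ) : ∃ T > 0, ∀ s, T ≤ s → a s = 0 := by
  obtain ⟨T, hT⟩ := a.support.finite_toSet.bddAbove
  refine ⟨max T 0 + 1, by positivity, fun s hs => ?_⟩
  by_contra h
  have := hT (Finset.mem_coe.2 (Finsupp.mem_support_iff.2 h))
  linarith [le_max_left T 0]

theorem HasForm.slope_infty (h : C.HasForm f D n m) (l : L) :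
    C.HasSlope f (.infty l) (.inr l, false) (-(m l + mass (C.legPart l D))) := by
  obtain ⟨T, hT0, hT⟩ := exists_support_bound (C.legPart l D)
  refine ⟨f (.vert (C.base l)) - (C.legPart l D).sum fun s k => (k : ℝ) * s, ?_⟩
  filter_upwards [eventually_ge_atTop T] with t ht
  rw [h.2 l t (hT0.le.trans ht), ramp_of_large fun s hs => hT s (ht.trans hs), mass_eq_sum]
  simp only [Finsupp.sum, mul_sub, Finset.sum_sub_distrib]
  push_cast
  rw [← Finset.sum_mul]
  ring

theorem HasSlope.unique {p : C.Point} {d : Dir E L} {k k' : ℤ} (h : C.HasSlope f p d k)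
    (h' : C.HasSlope f p d k') : k = k' := by
  rcases p with p | l
  · exact_mod_cast slope_unique h h'
  · obtain ⟨a, ha⟩ := h
    obtain ⟨b, hb⟩ := h'
    obtain ⟨T, hT⟩ := eventually_atTop.1 (ha.and hb)
    have h1 := hT T le_rfl
    have h2 := hT (T + 1) (by linarith)
    have : (k : ℝ) = k' := by linarith [h1.1, h1.2, h2.1, h2.2]
    exact_mod_cast this

theorem HasForm.isDivisorOf [Fintype E] [Fintype L] (h : C.HasForm f D n m)
    (hF : C.IsFlow D n m) : C.IsDivisorOf f D := by
  classical
  rintro ((v | ⟨e, t, h0, h1⟩ | ⟨l, t, h0⟩) | l)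
  · refine ⟨fun d => match d with
      | (.inl e, true) => n e
      | (.inl e, false) => -(n e + mass (C.edgePart e D))
      | (.inr l, _) => m l, ?_, ?_⟩
    · rintro ⟨e | l, _ | _⟩ hd <;> rw [mem_outDirs] at hd
      · obtain rfl : C.tgt e = v := hd
        exact h.slope_tgt e
      · obtain rfl : C.src e = v := hd
        exact h.slope_src e
      · exact hd.elim
      · obtain rfl : C.base l = v := hd
        exact h.slope_base l
    · rw [sum_outDirs_vert, hF.1, Finset.sum_neg_distrib, ← sub_eq_add_neg]
  · refine ⟨fun d => if d.2 then n e + massLE t (C.edgePart e D)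
      else -(n e + massLT t (C.edgePart e D)), ?_, ?_⟩
    · rintro ⟨a, _ | _⟩ hd <;> rw [mem_outDirs] at hd
      · obtain rfl : a = .inl e := hd
        exact h.slope_edge_left e t h0 h1
      · obtain rfl : a = .inl e := hd
        exact h.slope_edge_right e t h0 h1
    · rw [sum_outDirs_edge, ← C.edgePart_apply_of_mem e D h0 h1, ← massLE_sub_massLT]
      simp
      ring
  · refine ⟨fun d => if d.2 then m l + massLE t (C.legPart l D)
      else -(m l + massLT t (C.legPart l D)), ?_, ?_⟩
    · rintro ⟨a, _ | _⟩ hd <;> rw [mem_outDirs] at hd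
      · obtain rfl : a = .inr l := hd
        exact h.slope_leg_left l t h0
      · obtain rfl : a = .inr l := hd
        exact h.slope_leg_right l t h0
    · rw [sum_outDirs_leg, ← C.legPart_apply_of_pos l D h0, ← massLE_sub_massLT]
      simp
      ring
  · refine ⟨fun _ => -(m l + mass (C.legPart l D)), ?_, ?_⟩
    · intro d hd
      rw [mem_outDirs] at hd
      obtain rfl : d = (.inr l, false) := hd
      exact h.slope_infty l
    · rw [sum_outDirs_infty, hF.2]

theorem IsDivisorOf.exists_form [Fintype E] [Fintype L] (h : C.IsDivisorOf f D) :
    ∃ n m, C.IsFlow D n m ∧ C.HasForm f D n m := by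
  classical
  choose N hN hD using h
  have hs : ∀ p d, C.Emanates p d → C.HasSlope f p d (N p d) := fun p d hd =>
    hN p d ((C.mem_outDirs).2 hd)
  let n : E → ℤ := fun e => N (.fin (.vert (C.src e))) (.inl e, true)
  let m : L → ℤ := fun l => N (.fin (.vert (C.base l))) (.inr l, true)
  have hform : C.HasForm f D n m := by
    constructor
    · intro e
      have := eq_add_ramp (f := fun t => f (C.edgePt e t)) (ℓ := C.len e) (a := C.edgePart e D)
        (n := n e) (C.edgePart_zero D e)
        (by
          have := hs (.fin (.vert (C.src e))) (.inl e, true) rfl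
          simpa only [HasSlope, move, coord, edgePt_zero] using this)
        (by
          intro t ht
          refine ⟨N (.fin (.edge e t ht.1 ht.2)) (.inl e, true),
            N (.fin (.edge e t ht.1 ht.2)) (.inl e, false), ?_, ?_, ?_⟩
          · have := hs (.fin (.edge e t ht.1 ht.2)) (.inl e, true) rfl
            simpa only [HasSlope, move, coord, C.edgePt_of_mem ht.1 ht.2] using this
          · have := hs (.fin (.edge e t ht.1 ht.2)) (.inl e, false) rfl
            simpa only [HasSlope, move, coord, C.edgePt_of_mem ht.1 ht.2] using this
          · rw [C.edgePart_apply_of_mem e D ht.1 ht.2, hD, sum_outDirs_edge])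
        (by
          have := hs (.fin (.vert (C.tgt e))) (.inl e, false) rfl
          exact ⟨_, by simpa only [HasSlope, move, coord, edgePt_len] using this⟩)
      simpa only [edgePt_zero] using this
    · intro l t ht
      -- A leg has no finite end. Any bound beyond `t` will do, and `t + 1` is positive even for `t
      -- = 0`, so the left germ there is that of an interior point of the leg.
      have := eq_add_ramp (f := fun t => f (C.legPt l t)) (ℓ := t + 1) (a := C.legPart l D)
        (n := m l) (fun s hs => C.legPart_apply_of_nonpos l D hs)
        (by
          have := hs (.fin (.vert (C.base l))) (.inr l, true) rfl
          simpa only [HasSlope, move, coord, legPt_zero] using this)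
        (by
          intro t ht
          refine ⟨N (.fin (.leg l t ht.1)) (.inr l, true),
            N (.fin (.leg l t ht.1)) (.inr l, false), ?_, ?_, ?_⟩
          · have := hs (.fin (.leg l t ht.1)) (.inr l, true) rfl
            simpa only [HasSlope, move, coord, C.legPt_of_pos ht.1] using this
          · have := hs (.fin (.leg l t ht.1)) (.inr l, false) rfl
            simpa only [HasSlope, move, coord, C.legPt_of_pos ht.1] using this
          · rw [C.legPart_apply_of_pos l D ht.1, hD, sum_outDirs_leg])
        (by
          have h0 : 0 < t + 1 := by linarith
          have := hs (.fin (.leg l (t + 1) h0)) (.inr l, false) rfl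
          exact ⟨_, by simpa only [HasSlope, move, coord, C.legPt_of_pos h0] using this⟩)
      simpa only [legPt_zero] using this t ⟨ht, by linarith⟩
  refine ⟨n, m, ⟨fun v => ?_, fun l => ?_⟩, hform⟩
  · rw [hD, sum_outDirs_vert, sub_eq_add_neg, ← Finset.sum_neg_distrib]
    congr 1
    · congr 1
      · refine Finset.sum_congr rfl fun e he => ?_
        rw [← (Finset.mem_filter.1 he).2]
      · refine Finset.sum_congr rfl fun e he => ?_
        rw [← (Finset.mem_filter.1 he).2]
        exact (hs (.fin (.vert (C.tgt e))) (.inl e, false) rfl).unique (hform.slope_tgt e)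
    · refine Finset.sum_congr rfl fun e he => ?_
      rw [← (Finset.mem_filter.1 he).2]
  · rw [hD, sum_outDirs_infty]
    exact (hs (.infty l) (.inr l, false) rfl).unique (hform.slope_infty l)

/-- A single-valued function has gradient rises, which integrate to zero over cycles. Conversely, if
the rises of a multivalued function represent a period, subtracting that cycle from the slopes makes
them a gradient, and the potential glues the pieces into a function. -/
theorem mem_principal_iff [Fintype V] [Fintype E] [Fintype L] :
    D ∈ C.principal ↔ C.deg D = 0 ∧ C.refJac D = 0 := by
  constructor
  · rintro ⟨f, hf⟩
    obtain ⟨n, m, hF, hform⟩ := hf.exists_form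
    refine ⟨hF.deg_eq_zero, ?_⟩
    have : C.rise D n = fun e => f (.vert (C.tgt e)) - f (.vert (C.src e)) := by
      ext e
      have := hform.1 e _ ⟨(C.len_pos e).le, le_rfl⟩
      rw [edgePt_len] at this
      rw [this, rise]
      ring
    rw [hF.refJac_eq, this, C.ofEdges_gradient fun v => f (.vert v), toJac_zero, neg_zero]
  · rintro ⟨hdeg, hjac⟩
    obtain ⟨n, m, hF⟩ := C.exists_flow hdeg
    rw [hF.refJac_eq, neg_eq_zero] at hjac
    obtain ⟨c, hc⟩ : C.ofEdges (C.rise D n) ∈ C.lattice :=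
      (QuotientAddGroup.eq_zero_iff (N := C.lattice) _).1 hjac
    have h0 := C.rise_sub_cycle D n c
    rw [hc, sub_self] at h0
    obtain ⟨h, hh⟩ := C.exists_potential h0
    have hF' := hF.sub_cycle c
    generalize n - (c : E → ℤ) = n' at *
    let f : C.FinPoint → ℝ := fun p => match p with
      | .vert v => h v
      | .edge e t _ _ => h (C.src e) + n' e * t + ramp t (C.edgePart e D)
      | .leg l t _ => h (C.base l) + m l * t + ramp t (C.legPart l D)
    refine ⟨f, HasForm.isDivisorOf (n := n') (m := m) ⟨fun e t ht => ?_, fun l t ht => ?_⟩ hF'⟩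
    · rcases eq_or_lt_of_le ht.1 with rfl | ht0
      · rw [edgePt_zero, ramp_eq_zero (C.edgePart_zero D e)]
        simp
      rcases eq_or_lt_of_le ht.2 with rfl | ht1
      · have := hh e
        rw [edgePt_len]
        simp only [rise] at this
        simp only [f]
        linarith
      · rw [C.edgePt_of_mem ht0 ht1]
    · rcases eq_or_lt_of_le ht with rfl | ht0
      · rw [legPt_zero, ramp_eq_zero fun s hs => C.legPart_apply_of_nonpos l D hs]
        simp
      · rw [C.legPt_of_pos ht0]

/-- Abel's theorem. -/
theorem cls_eq_iff [Fintype V] [Fintype E] [Fintype L] {D D' : C.Div} :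
    C.cls D = C.cls D' ↔ C.deg D = C.deg D' ∧ C.refJac D = C.refJac D' := by
  rw [cls, cls, QuotientAddGroup.eq_iff_sub_mem, mem_principal_iff, deg_sub, map_sub, sub_eq_zero,
    sub_eq_zero]

end TropicalCurve

/-! ### The genus formula, simple lifts, and 2-torsion as half-cycles -/

namespace TropicalCurve

variable {V E L : Type*} (C : TropicalCurve V E L)

/-! ### The genus -/

/-- Rank-nullity for the boundary map and for the augmentation; connectedness identifies the image
of the first with the kernel of the second. -/
theorem genus_eq [Fintype V] [Fintype E] :
    (C.genus : ℤ) = Fintype.card E - Fintype.card V + 1 := by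
  classical
  let σ : (V → ℤ) →ₗ[ℤ] ℤ := ∑ v, LinearMap.proj v
  have hσ : ∀ r, σ r = ∑ v, r v := fun r => by simp [σ, LinearMap.sum_apply]
  have hrange : LinearMap.range (C.boundary ℤ) = LinearMap.ker σ := by
    ext r
    rw [LinearMap.mem_ker, hσ]
    constructor
    · rintro ⟨k, rfl⟩
      have := C.sum_boundary_smul k fun _ => (1 : ℤ)
      simpa using this
    · intro h
      exact C.exists_boundary_eq h
  have hsurj : LinearMap.range σ = ⊤ := LinearMap.range_eq_top.2 fun k =>
    ⟨Pi.single C.root k, by rw [hσ]; simp⟩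
  have h1 := Submodule.finrank_quotient_add_finrank (LinearMap.ker (C.boundary ℤ))
  have h2 := Submodule.finrank_quotient_add_finrank (LinearMap.ker σ)
  rw [(C.boundary ℤ).quotKerEquivRange.finrank_eq] at h1
  rw [σ.quotKerEquivRange.finrank_eq] at h2
  rw [hsurj, finrank_top, Module.finrank_self, Module.finrank_fintype_fun_eq_card] at h2
  rw [hrange, Module.finrank_fintype_fun_eq_card] at h1
  rw [genus, H1]
  omega

/-! ### Lifting cycles modulo 2 -/

open Classical in
/-- A finite multigraph all of whose degrees are even has a balanced orientation. -/
theorem exists_balanced {V E : Type*} (N : ℕ) : ∀ (T : Finset E) (_ : T.card = N) (s t : E → V)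
    (_ : ∑ e ∈ T, (Pi.single (t e) 1 + Pi.single (s e) 1 : V → ZMod 2) = 0),
    ∃ c : E → ℤ, (∀ e ∈ T, c e = 1 ∨ c e = -1) ∧
      ∑ e ∈ T, c e • (Pi.single (t e) 1 - Pi.single (s e) 1 : V → ℤ) = 0 := by
  induction N with
  | zero =>
    intro T hT s t _
    obtain rfl := Finset.card_eq_zero.1 hT
    exact ⟨0, by simp, by simp⟩
  | succ N ih =>
    intro T hT s t hpar
    have hc2 : ∀ x : V → ZMod 2, x + x = 0 := fun x => funext fun v =>
      CharTwo.add_self_eq_zero (x v)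
    obtain ⟨e₁, T', he₁, rfl, hT'⟩ := Finset.card_eq_succ.1 hT
    rw [Finset.sum_insert he₁] at hpar
    by_cases hloop : s e₁ = t e₁
    · obtain ⟨c, hc, hb⟩ := ih T' hT' s t (by
        rwa [hloop, hc2, zero_add] at hpar)
      refine ⟨Function.update c e₁ 1, ?_, ?_⟩
      · intro e he
        rcases eq_or_ne e e₁ with rfl | hne
        · simp
        · rw [Function.update_of_ne hne]
          exact hc e ((Finset.mem_insert.1 he).resolve_left hne)
      · rw [Finset.sum_insert he₁, hloop, sub_self, smul_zero, zero_add, ← hb]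
        refine Finset.sum_congr rfl fun e he => ?_
        rw [Function.update_of_ne (ne_of_mem_of_not_mem he he₁)]
    -- By parity, another edge meets the head of the non-loop `e₁`. Splicing `e₁` and `e₂` at that
    -- vertex into one edge, stored in the slot of `e₂`, keeps all parities and lowers the number of
    -- edges.
    · obtain ⟨e₂, he₂, hne⟩ : ∃ e ∈ T', (Pi.single (t e) 1 + Pi.single (s e) 1 : V → ZMod 2) (t e₁)
          ≠ 0 := by
        by_contra! hcon
        have := congrFun hpar (t e₁)
        rw [Pi.add_apply, Finset.sum_apply, Finset.sum_eq_zero hcon] at this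
        simp [Ne.symm hloop] at this
      obtain ⟨T'', he₂', rfl⟩ : ∃ T'', e₂ ∉ T'' ∧ insert e₂ T'' = T' :=
        ⟨T'.erase e₂, by simp, Finset.insert_erase he₂⟩
      have h12 : e₁ ≠ e₂ := fun h => he₁ (h ▸ Finset.mem_insert_self _ _)
      rw [Finset.sum_insert he₂'] at hpar
      have hcon : s e₂ = t e₁ ∨ t e₂ = t e₁ := by
        by_contra! hcon
        exact hne (by simp [Ne.symm hcon.1, Ne.symm hcon.2])
      have key : ∀ s' t' : E → V, (∀ e ∈ T'', s' e = s e ∧ t' e = t e) → ∀ δ : ℤ,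
          (δ = 1 ∨ δ = -1) →
          (Pi.single (t' e₂) 1 + Pi.single (s' e₂) 1 : V → ZMod 2) =
            Pi.single (t e₁) 1 + Pi.single (s e₁) 1 + (Pi.single (t e₂) 1 + Pi.single (s e₂) 1) →
          (Pi.single (t' e₂) 1 - Pi.single (s' e₂) 1 : V → ℤ) =
            δ • (Pi.single (t e₁) 1 - Pi.single (s e₁) 1) +
              (Pi.single (t e₂) 1 - Pi.single (s e₂) 1) →
          ∃ c : E → ℤ, (∀ e ∈ insert e₁ (insert e₂ T''), c e = 1 ∨ c e = -1) ∧
            ∑ e ∈ insert e₁ (insert e₂ T''),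
              c e • (Pi.single (t e) 1 - Pi.single (s e) 1 : V → ℤ) = 0 := by
        intro s' t' hst δ hδ hm hz
        obtain ⟨c, hc, hb⟩ := ih _ hT' s' t' (by
          rw [Finset.sum_insert he₂', hm, add_assoc, ← hpar]
          congr 2
          refine Finset.sum_congr rfl fun e he => ?_
          rw [(hst e he).1, (hst e he).2])
        -- The sign `δ` records whether `e₂` runs along with `e₁` or against it on the spliced edge,
        -- so one sign for the spliced edge orients both.
        refine ⟨Function.update c e₁ (δ * c e₂), ?_, ?_⟩
        · intro e he
          rcases eq_or_ne e e₁ with rfl | hne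
          · rw [Function.update_self]
            have := hc e₂ he₂
            rcases hδ with rfl | rfl <;> rcases this with h | h <;> simp [h]
          · rw [Function.update_of_ne hne]
            exact hc e ((Finset.mem_insert.1 he).resolve_left hne)
        · rw [Finset.sum_insert he₁, Finset.sum_insert he₂', Function.update_self,
            Function.update_of_ne h12.symm, ← hb, Finset.sum_insert he₂', hz, smul_add,
            smul_smul, mul_comm (c e₂), add_assoc]
          congr 2
          refine Finset.sum_congr rfl fun e he => ?_
          rw [(hst e he).1, (hst e he).2, Function.update_of_ne]
          rintro rfl
          exact he₁ (Finset.mem_insert_of_mem he)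
      have hupd : ∀ (f : E → V) (x : V), ∀ e ∈ T'', Function.update f e₂ x e = f e :=
        fun f x e he => Function.update_of_ne (ne_of_mem_of_not_mem he he₂') _ _
      have h2 : (Pi.single (t e₁) 1 + Pi.single (t e₁) 1 : V → ZMod 2) = 0 := hc2 _
      rcases hcon with h | h
      · refine key (Function.update s e₂ (s e₁)) t (fun e he => ⟨hupd s _ e he, rfl⟩) 1
          (Or.inl rfl) ?_ ?_
        · rw [Function.update_self, h]
          calc _ = Pi.single (t e₂) 1 + Pi.single (s e₁) 1 +
                (Pi.single (t e₁) 1 + Pi.single (t e₁) 1 : V → ZMod 2) := by rw [h2, add_zero]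
            _ = _ := by abel
        · rw [Function.update_self, h]
          abel
      · refine key s (Function.update t e₂ (s e₁)) (fun e he => ⟨rfl, hupd t _ e he⟩) (-1)
          (Or.inr rfl) ?_ ?_
        · rw [Function.update_self, h]
          calc _ = Pi.single (s e₁) 1 + Pi.single (s e₂) 1 +
                (Pi.single (t e₁) 1 + Pi.single (t e₁) 1 : V → ZMod 2) := by rw [h2, add_zero]
            _ = _ := by abel
        · rw [Function.update_self, h]
          abel

variable [Fintype E]

open Classical in
theorem boundary_eq_sum (R : Type*) [CommRing R] (k : E → R) :
    C.boundary R k = ∑ e, k e • (Pi.single (C.tgt e) 1 - Pi.single (C.src e) 1) := by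
  have : k = ∑ e, Pi.single e (k e) := (Finset.univ_sum_single k).symm
  conv_lhs => rw [this, map_sum]
  refine Finset.sum_congr rfl fun e _ => ?_
  rw [boundary_single, smul_sub, ← Pi.single_smul, ← Pi.single_smul, smul_eq_mul, mul_one]

/-- The edges in the support of a mod 2 cycle form a graph with even degrees, and a balanced
orientation of it is an integral cycle with coefficients `±1`. -/
theorem exists_simpleLift (γ : C.H1 (ZMod 2)) : ∃ c, C.IsSimpleLift γ c := by
  classical
  have h01 : ∀ x : ZMod 2, x ≠ 0 → x = 1 := by decide
  let T : Finset E := Finset.univ.filter fun e => (γ : E → ZMod 2) e ≠ 0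
  obtain ⟨c, hc, hb⟩ := exists_balanced T.card T rfl C.src C.tgt (by
    have h : C.boundary (ZMod 2) γ = 0 := γ.2
    rw [boundary_eq_sum] at h
    rw [← h, Finset.sum_filter]
    refine Finset.sum_congr rfl fun e _ => ?_
    split_ifs with he
    · rw [h01 _ he, one_smul]
      exact funext fun v => (CharTwo.sub_eq_add _ _).symm
    · rw [not_not.1 he, zero_smul])
  have hmem : ∀ e, e ∈ T ↔ (γ : E → ZMod 2) e ≠ 0 := fun e => by simp [T]
  refine ⟨⟨fun e => if e ∈ T then c e else 0, ?_⟩, ?_, ?_⟩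
  · rw [H1, LinearMap.mem_ker, boundary_eq_sum, ← hb]
    simp only [ite_smul, zero_smul]
    rw [Finset.sum_ite_mem, Finset.univ_inter]
  · intro e
    by_cases he : e ∈ T
    · have h1 := h01 _ ((hmem e).1 he)
      rcases hc e he with h | h <;> simp [he, h, h1]
    · simp only [if_neg he]
      rw [not_not.1 (mt (hmem e).2 he)]
      simp
  · intro e
    by_cases he : e ∈ T
    · rcases hc e he with h | h <;> simp [he, h]
    · simp [he]

theorem boundary_intCast (k : E → ℤ) (R : Type*) [CommRing R] (v : V) :
    C.boundary R (fun e => (k e : R)) v = ((C.boundary ℤ k v : ℤ) : R) := by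
  simp [boundary]

theorem exists_isLift_of_cycle (c : C.H1 ℤ) : ∃ γ : C.H1 (ZMod 2), C.IsLift γ c := by
  refine ⟨⟨fun e => ((c : E → ℤ) e : ZMod 2), ?_⟩, fun e => rfl⟩
  rw [H1, LinearMap.mem_ker]
  ext v
  have hc : C.boundary ℤ c = 0 := c.2
  rw [boundary_intCast, hc]
  simp

variable {C}

theorem IsLift.add {γ δ : C.H1 (ZMod 2)} {c c' : C.H1 ℤ} (h : C.IsLift γ c) (h' : C.IsLift δ c') :
    C.IsLift (γ + δ) (c + c') := fun e => by
  have h1 := h e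
  have h2 := h' e
  simp only [Submodule.coe_add, Pi.add_apply]
  push_cast
  rw [h1, h2]

/-- The difference is even edge by edge, and its half is again closed because the integers have no
2-torsion. -/
theorem IsLift.exists_sub_eq {γ : C.H1 (ZMod 2)} {c c' : C.H1 ℤ} (h : C.IsLift γ c)
    (h' : C.IsLift γ c') : ∃ b : C.H1 ℤ, c - c' = 2 • b := by
  have : ∀ e, ∃ b : ℤ, (c : E → ℤ) e - (c' : E → ℤ) e = 2 * b := fun e => by
    have : (((c : E → ℤ) e - (c' : E → ℤ) e : ℤ) : ZMod 2) = 0 := by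
      push_cast
      rw [h e, h' e, sub_self]
    exact (ZMod.intCast_zmod_eq_zero_iff_dvd _ 2).1 this
  choose b hb using this
  have hb' : (c : E → ℤ) - c' = (2 : ℤ) • b := by
    ext e
    simpa using hb e
  have hbd : (2 : ℤ) • C.boundary ℤ b = 0 := by
    rw [← map_smul, ← hb']
    exact (c - c').2
  refine ⟨⟨b, (smul_eq_zero.1 hbd).resolve_left two_ne_zero⟩, ?_⟩
  ext e
  simpa using hb e

theorem IsSimpleLift.eq_zero_iff {γ : C.H1 (ZMod 2)} {c : C.H1 ℤ} (h : C.IsSimpleLift γ c) (e : E) :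
    (c : E → ℤ) e = 0 ↔ (γ : E → ZMod 2) e = 0 := by
  rw [← h.1 e]
  have := abs_le.1 (h.2 e)
  obtain h1 | h1 | h1 : (c : E → ℤ) e = -1 ∨ (c : E → ℤ) e = 0 ∨ (c : E → ℤ) e = 1 := by omega
  all_goals simp [h1]

theorem isLift_zero_zero : C.IsLift 0 0 := fun e => by simp

/-- The length pairing is positive definite. -/
theorem cycleInt_injective : Function.Injective C.cycleInt := by
  rw [injective_iff_map_eq_zero]
  intro c hc
  have h := C.Q_cycleInt c c
  rw [hc, Q, LinearMap.zero_apply, eq_comm,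
    Finset.sum_eq_zero_iff_of_nonneg fun e _ =>
      mul_nonneg (mul_self_nonneg _) (C.len_pos e).le] at h
  ext e
  have := h e (Finset.mem_univ e)
  have hl := (C.len_pos e).ne'
  simpa [hl] using this

/-- The class of half a cycle in the Jacobian depends only on its reduction modulo 2. -/
theorem IsLift.toJac_half_eq {γ : C.H1 (ZMod 2)} {c c' : C.H1 ℤ} (h : C.IsLift γ c)
    (h' : C.IsLift γ c') :
    C.toJac ((1 / 2 : ℝ) • C.cycleInt c) = C.toJac ((1 / 2 : ℝ) • C.cycleInt c') := by
  obtain ⟨b, hb⟩ := h.exists_sub_eq h'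
  rw [toJac_eq_iff, ← smul_sub, ← map_sub, hb, map_nsmul]
  refine ⟨b, ?_⟩
  ext ω
  simp

theorem IsLift.eq_zero_of_toJac_half {γ : C.H1 (ZMod 2)} {c : C.H1 ℤ} (h : C.IsLift γ c)
    (h0 : C.toJac ((1 / 2 : ℝ) • C.cycleInt c) = 0) : γ = 0 := by
  obtain ⟨b, hb⟩ := (QuotientAddGroup.eq_zero_iff (N := C.lattice) _).1 h0
  have : c = 2 • b := cycleInt_injective (by
    rw [map_nsmul, hb]
    ext ω
    simp)
  ext e
  rw [← h e, this]
  have : (2 : ZMod 2) = 0 := by decide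
  simp [this]

theorem exists_half_of_two_smul_eq_zero {x : C.Jac} (h : 2 • x = 0) :
    ∃ (γ : C.H1 (ZMod 2)) (c : C.H1 ℤ), C.IsLift γ c ∧
      x = C.toJac ((1 / 2 : ℝ) • C.cycleInt c) := by
  obtain ⟨x, rfl⟩ := QuotientAddGroup.mk_surjective x
  obtain ⟨c, hc⟩ := (QuotientAddGroup.eq_zero_iff (N := C.lattice) (2 • x)).1 h
  obtain ⟨γ, hγ⟩ := C.exists_isLift_of_cycle c
  refine ⟨γ, c, hγ, ?_⟩
  rw [hc]
  change C.toJac x = _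
  congr 1
  ext ω
  simp

end TropicalCurve

/-! ### The tropical theta function and the pull-backs of its divisor -/

namespace TropicalCurve

variable {V E L : Type*} (C : TropicalCurve V E L)

/-! ### The theta function -/

section Theta

variable [Fintype E]

/-- The image of the boundary map is projective, so the cycles are a direct summand of the chains,
and a functional extends along the projection `π`. -/
theorem exists_ofEdges_eq [Fintype V] (y : C.FormDual) : ∃ w : E → ℝ, C.ofEdges w = y := by
  classical
  obtain ⟨s, hs⟩ := Module.projective_lifting_property (C.boundary ℤ).rangeRestrict LinearMap.id
    (C.boundary ℤ).surjective_rangeRestrict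
  have hs' : ∀ k, C.boundary ℤ (s ((C.boundary ℤ).rangeRestrict k)) = C.boundary ℤ k := fun k =>
    congrArg Subtype.val (LinearMap.congr_fun hs ((C.boundary ℤ).rangeRestrict k))
  let π : (E → ℤ) →ₗ[ℤ] C.H1 ℤ :=
    (LinearMap.id - s ∘ₗ (C.boundary ℤ).rangeRestrict).codRestrict (C.H1 ℤ) fun k => by
      rw [H1, LinearMap.mem_ker, LinearMap.sub_apply, map_sub, LinearMap.comp_apply, hs',
        LinearMap.id_apply, sub_self]
  have hπ : ∀ c : C.H1 ℤ, π c = c := fun c => by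
    ext1
    have : (C.boundary ℤ).rangeRestrict c = 0 := Subtype.ext c.2
    simp [π, this]
  refine ⟨fun e => y (π (Pi.single e 1)), ?_⟩
  ext c
  rw [ofEdges_apply]
  have hc : (c : E → ℤ) = ∑ e, (c : E → ℤ) e • Pi.single e 1 := by
    conv_lhs => rw [← Finset.univ_sum_single (c : E → ℤ)]
    exact Finset.sum_congr rfl fun e _ => by rw [← Pi.single_smul, smul_eq_mul, mul_one]
  conv_rhs => rw [← hπ c, hc, map_sum, map_sum]
  refine Finset.sum_congr rfl fun e _ => ?_
  rw [map_smul, map_smul, zsmul_eq_mul, mul_comm]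

theorem Q_self (c : C.H1 ℤ) :
    C.Q c (C.cycleInt c) = ∑ e, ((c : E → ℤ) e : ℝ) ^ 2 * C.len e := by
  rw [Q_cycleInt]
  exact Finset.sum_congr rfl fun e _ => by ring

theorem exists_norm_bound [Fintype V] (y : C.FormDual) :
    ∃ M : ℝ, 0 ≤ M ∧ ∀ c : C.H1 ℤ, |y c| ≤ ∑ e, M * |((c : E → ℤ) e : ℝ)| := by
  obtain ⟨w, rfl⟩ := C.exists_ofEdges_eq y
  refine ⟨∑ e, |w e|, Finset.sum_nonneg fun e _ => abs_nonneg _, fun c => ?_⟩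
  rw [ofEdges_apply]
  refine (Finset.abs_sum_le_sum_abs _ _).trans (Finset.sum_le_sum fun e he => ?_)
  rw [abs_mul]
  exact mul_le_mul_of_nonneg_right
    (Finset.single_le_sum (f := fun e => |w e|) (fun e _ => abs_nonneg _) he) (abs_nonneg _)

/-- The quadratic term dominates. Both absolute values enter so that one finite set contains every
term that can compete with the zero cycle at `y + s • v`, for all `s` in `[0, 1]` at once. -/
theorem finite_terms [Fintype V] (y v : C.FormDual) :
    {c : C.H1 ℤ | 0 ≤ |y c| + |v c| - C.Q c (C.cycleInt c) / 2}.Finite := by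
  classical
  obtain ⟨M₁, hM₁, hy⟩ := C.exists_norm_bound y
  obtain ⟨M₂, hM₂, hv⟩ := C.exists_norm_bound v
  set M := M₁ + M₂ with hM
  have hM0 : 0 ≤ M := add_nonneg hM₁ hM₂
  set B : ℝ := ∑ e, M ^ 2 / (2 * C.len e) with hB
  have hB0 : ∀ e ∈ Finset.univ, 0 ≤ M ^ 2 / (2 * C.len e) := fun e _ => by
    have := C.len_pos e
    positivity
  have hterm : ∀ e (k : ℝ), M * |k| - k ^ 2 * C.len e / 2 ≤ M ^ 2 / (2 * C.len e) := by
    intro e k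
    have hl := C.len_pos e
    rw [le_div_iff₀ (by positivity), ← sq_abs k]
    nlinarith [sq_nonneg (M - |k| * C.len e)]
  -- Beyond this bound a single coefficient contributes less than `-B`, while completing squares
  -- bounds all the other edges together by `B`.
  obtain ⟨N, hN⟩ : ∃ N : ℤ, ∀ e, 2 * (M + B) / C.len e + 1 ≤ N := by
    have : ∃ R : ℝ, ∀ e, 2 * (M + B) / C.len e + 1 ≤ R := by
      obtain ⟨R, hR⟩ := (Set.finite_range fun e => 2 * (M + B) / C.len e + 1).bddAbove
      exact ⟨R, fun e => hR ⟨e, rfl⟩⟩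
    obtain ⟨R, hR⟩ := this
    exact ⟨⌈R⌉, fun e => (hR e).trans (Int.le_ceil R)⟩
  refine Set.Finite.subset (Set.Finite.preimage Subtype.val_injective.injOn
    (Set.finite_Icc (fun _ : E => -N) (fun _ => N))) fun c hc => ?_
  have hc' : 0 ≤ ∑ e, (M * |((c : E → ℤ) e : ℝ)| - ((c : E → ℤ) e : ℝ) ^ 2 * C.len e / 2) := by
    have h1 := hy c
    have h2 := hv c
    have h3 : 0 ≤ |y c| + |v c| - C.Q c (C.cycleInt c) / 2 := hc
    rw [Q_self] at h3
    simp only [Finset.sum_sub_distrib, ← Finset.sum_div, hM, add_mul, Finset.sum_add_distrib]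
    linarith
  have hbound : ∀ e, |(c : E → ℤ) e| ≤ N := by
    intro e
    have hl := C.len_pos e
    by_contra hcon
    push Not at hcon
    have hk : (N : ℝ) < |((c : E → ℤ) e : ℝ)| := by exact_mod_cast hcon
    set k : ℝ := |((c : E → ℤ) e : ℝ)| with hkdef
    have h1 := hN e
    have hBe : 0 ≤ B := Finset.sum_nonneg hB0
    have hk1 : 2 * (M + B) / C.len e < k := by linarith
    rw [div_lt_iff₀ hl] at hk1
    have h2 : 1 ≤ k := by
      have : 0 ≤ 2 * (M + B) / C.len e := by positivity
      linarith
    rw [← Finset.add_sum_erase _ _ (Finset.mem_univ e)] at hc'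
    have hrest : ∑ e' ∈ Finset.univ.erase e,
        (M * |((c : E → ℤ) e' : ℝ)| - ((c : E → ℤ) e' : ℝ) ^ 2 * C.len e' / 2) ≤ B :=
      (Finset.sum_le_sum fun e' _ => hterm e' _).trans
        (Finset.sum_le_sum_of_subset_of_nonneg (Finset.erase_subset _ _) fun e' he' _ => hB0 e' he')
    rw [← sq_abs ((c : E → ℤ) e : ℝ), ← hkdef] at hc'
    nlinarith
  exact ⟨fun e => (abs_le.1 (hbound e)).1, fun e => (abs_le.1 (hbound e)).2⟩

theorem bddAbove_terms [Fintype V] (y : C.FormDual) :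
    BddAbove (Set.range fun c : C.H1 ℤ => C.Q c y - C.Q c (C.cycleInt c) / 2) := by
  obtain ⟨B, hB⟩ := ((C.finite_terms y 0).image
    fun c : C.H1 ℤ => C.Q c y - C.Q c (C.cycleInt c) / 2).bddAbove
  refine ⟨max B 0, ?_⟩
  rintro _ ⟨c, rfl⟩
  dsimp only
  by_cases hc : 0 ≤ |y c| + |(0 : C.FormDual) c| - C.Q c (C.cycleInt c) / 2
  · exact (hB ⟨c, hc, rfl⟩).trans (le_max_left _ _)
  · refine le_trans ?_ (le_max_right _ _)
    rw [LinearMap.zero_apply, abs_zero, add_zero] at hc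
    have := le_abs_self (y c)
    simp only [Q] at *
    linarith

theorem le_theta [Fintype V] (y : C.FormDual) (c : C.H1 ℤ) :
    y c - C.Q c (C.cycleInt c) / 2 ≤ C.theta y :=
  le_ciSup (C.bddAbove_terms y) c

theorem theta_le {y : C.FormDual} {B : ℝ}
    (h : ∀ c : C.H1 ℤ, y c - C.Q c (C.cycleInt c) / 2 ≤ B) : C.theta y ≤ B :=
  ciSup_le h

/-- Quasi-periodicity of the theta function. -/
theorem theta_add_cycleInt [Fintype V] (y : C.FormDual) (c : C.H1 ℤ) :
    C.theta (y + C.cycleInt c) = C.theta y + y c + C.Q c (C.cycleInt c) / 2 := by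
  rw [add_assoc, theta, theta, ciSup_add (C.bddAbove_terms y),
    ← (Equiv.addRight c).iSup_comp]
  refine iSup_congr fun c' => ?_
  have hsymm : C.cycleInt c' c = C.cycleInt c c' := by
    have h1 := C.Q_cycleInt c c'
    have h2 := C.Q_cycleInt c' c
    simp only [Q] at h1 h2
    rw [h1, h2]
    exact Finset.sum_congr rfl fun e _ => by ring
  simp only [Q, Equiv.coe_addRight, map_add, LinearMap.add_apply, hsymm]
  ring

/-- The theta function is affine near `y` in each direction. -/
theorem exists_theta_germ [Fintype V] (y v : C.FormDual) :
    ∃ c : C.H1 ℤ, ∀ᶠ s in 𝓝[>] (0 : ℝ), C.theta (y + s • v) = C.theta y + v c * s := by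
  set q : C.H1 ℤ → ℝ := fun c => C.Q c (C.cycleInt c) / 2 with hq
  have h0 : (0 : C.H1 ℤ) ∈ {c : C.H1 ℤ | 0 ≤ |y c| + |v c| - C.Q c (C.cycleInt c) / 2} := by
    simp [Q]
  -- Maximize first the value at `y`, then the slope along `v`: the lexicographic winner stays
  -- maximal for all small `s > 0`.
  obtain ⟨c₀, -, hmax⟩ := Set.exists_max_image _
    (fun c => toLex (y c - q c, v c)) (C.finite_terms y v) ⟨0, h0⟩
  have hmem : ∀ᶠ s in 𝓝[≥] (0 : ℝ), ∀ c ∈ {c : C.H1 ℤ | 0 ≤ |y c| + |v c| - q c},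
      y c - q c + s * v c ≤ y c₀ - q c₀ + s * v c₀ := by
    refine (Filter.eventually_all_finite (C.finite_terms y v)).2 fun c hc => ?_
    rcases Prod.Lex.toLex_le_toLex.1 (hmax c hc) with h | ⟨h, h'⟩
    · have : ContinuousWithinAt (fun s : ℝ => y c₀ - q c₀ + s * v c₀ - (y c - q c + s * v c))
          (Set.Ici 0) 0 := by fun_prop
      have h' : 0 < y c₀ - q c₀ + 0 * v c₀ - (y c - q c + 0 * v c) := by
        simp only at h
        linarith
      filter_upwards [this.eventually_const_lt h'] with s hs
      linarith
    · filter_upwards [self_mem_nhdsWithin] with s hs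
      simp only at h h'
      rw [h]
      gcongr
  have hev : ∀ᶠ s in 𝓝[≥] (0 : ℝ), C.theta (y + s • v) = y c₀ - q c₀ + s * v c₀ := by
    filter_upwards [hmem, Icc_mem_nhdsGE (zero_lt_one (α := ℝ))] with s hs hs1
    refine le_antisymm (C.theta_le fun c => ?_) ?_
    · rw [LinearMap.add_apply, LinearMap.smul_apply, smul_eq_mul]
      by_cases hc : 0 ≤ |y c| + |v c| - q c
      · have := hs c hc
        simp only [hq] at *
        linarith
      · have h1 := hs 0 h0
        simp only [map_zero, hq, Q] at h1 hc ⊢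
        have h2 : s * v c ≤ |v c| := by
          calc s * v c ≤ s * |v c| := by gcongr; exacts [hs1.1, le_abs_self _]
            _ ≤ 1 * |v c| := by gcongr; exact hs1.2
            _ = |v c| := one_mul _
        have h3 := le_abs_self (y c)
        linarith
    · have := C.le_theta (y + s • v) c₀
      rw [LinearMap.add_apply, LinearMap.smul_apply, smul_eq_mul] at this
      simp only [hq]
      linarith
  have hy : C.theta y = y c₀ - q c₀ := by
    have := hev.self_of_nhdsWithin (by simp)
    simpa using this
  refine ⟨c₀, ?_⟩
  filter_upwards [hev.filter_mono (nhdsWithin_mono _ Set.Ioi_subset_Ici_self)] with s hs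
  rw [hs, hy]
  ring

/-! ### Pulling back the theta divisor -/

/-- The coefficient of a direction in a cycle. -/
def dirCoeff (c : C.H1 ℤ) : Dir E L → ℤ
  | (.inl e, true) => (c : E → ℤ) e
  | (.inl e, false) => -(c : E → ℤ) e
  | (.inr _, _) => 0

theorem tangent_apply (c : C.H1 ℤ) (d : Dir E L) : C.tangent d c = C.dirCoeff c d := by
  rcases d with ⟨e | l, _ | _⟩ <;> simp [tangent, dirCoeff, unitVec]

/-- This is balancing. It is what makes the sum of slopes of theta independent of the lift, although
translation by a period changes the individual slopes. -/
theorem sum_dirCoeff [Fintype L] (c : C.H1 ℤ) (p : C.Point) :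
    ∑ d ∈ C.outDirs p, C.dirCoeff c d = 0 := by
  classical
  rcases p with (v | ⟨e, t, h0, h1⟩ | ⟨l, t, h0⟩) | l
  · rw [sum_outDirs_vert]
    have hc : C.boundary ℤ c = 0 := c.2
    have := congrFun hc v
    simp only [boundary, LinearMap.coe_mk, AddHom.coe_mk, Pi.zero_apply] at this
    simp only [dirCoeff, Finset.sum_neg_distrib, Finset.sum_const_zero]
    linarith
  · simp [sum_outDirs_edge, dirCoeff]
  · simp [sum_outDirs_leg, dirCoeff]
  · simp [sum_outDirs_infty, dirCoeff]

/-- The outward slopes at `p` of the theta function, lifted so that `p` goes to `y`, add up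
to `k`. -/
def ThetaSlopeSum [Fintype L] (y : C.FormDual) (p : C.Point) (k : ℤ) : Prop :=
  ∃ n : Dir E L → ℤ, (∀ d ∈ C.outDirs p, ∀ᶠ s in 𝓝[>] (0 : ℝ),
    C.theta (y + s • C.tangent d) = C.theta y + n d * s) ∧ k = ∑ d ∈ C.outDirs p, n d

/-- The slope is a coefficient of the maximizing cycle, hence an integer. -/
theorem exists_thetaSlope [Fintype V] (y : C.FormDual) (d : Dir E L) :
    ∃ n : ℤ, ∀ᶠ s in 𝓝[>] (0 : ℝ), C.theta (y + s • C.tangent d) = C.theta y + n * s := by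
  obtain ⟨c, hc⟩ := C.exists_theta_germ y (C.tangent d)
  exact ⟨C.dirCoeff c d, by simpa only [tangent_apply] using hc⟩

variable {C}

theorem ThetaSlopeSum.unique [Fintype L] {y : C.FormDual} {p : C.Point} {k k' : ℤ}
    (h : C.ThetaSlopeSum y p k) (h' : C.ThetaSlopeSum y p k') : k = k' := by
  obtain ⟨n, hn, rfl⟩ := h
  obtain ⟨n', hn', rfl⟩ := h'
  exact Finset.sum_congr rfl fun d hd => by exact_mod_cast slope_unique (hn d hd) (hn' d hd)

theorem theta_germ_add_cycleInt [Fintype V] {y v : C.FormDual} {k : ℝ}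
    (h : ∀ᶠ s in 𝓝[>] (0 : ℝ), C.theta (y + s • v) = C.theta y + k * s) (c : C.H1 ℤ) :
    ∀ᶠ s in 𝓝[>] (0 : ℝ), C.theta (y + C.cycleInt c + s • v) =
      C.theta (y + C.cycleInt c) + (k + v c) * s := by
  filter_upwards [h] with s hs
  rw [add_right_comm, theta_add_cycleInt, theta_add_cycleInt, hs, LinearMap.add_apply,
    LinearMap.smul_apply, smul_eq_mul]
  ring

theorem ThetaSlopeSum.add_cycleInt [Fintype V] [Fintype L] {y : C.FormDual} {p : C.Point} {k : ℤ}
    (h : C.ThetaSlopeSum y p k) (c : C.H1 ℤ) : C.ThetaSlopeSum (y + C.cycleInt c) p k := by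
  obtain ⟨n, hn, rfl⟩ := h
  refine ⟨fun d => n d + C.dirCoeff c d, fun d hd => ?_, ?_⟩
  · have := theta_germ_add_cycleInt (hn d hd) c
    rw [tangent_apply] at this
    simpa only [Int.cast_add] using this
  · rw [Finset.sum_add_distrib, sum_dirCoeff, add_zero]

theorem ThetaSlopeSum.congr [Fintype V] [Fintype L] {y y' : C.FormDual} {p : C.Point} {k : ℤ}
    (h : C.ThetaSlopeSum y p k) (hy : C.toJac y = C.toJac y') : C.ThetaSlopeSum y' p k := by
  obtain ⟨c, hc⟩ := (C.toJac_eq_iff).1 hy.symm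
  have := h.add_cycleInt c
  rwa [hc, add_sub_cancel] at this

end Theta

/-- The divisor with multiplicities `r` at the vertices. -/
noncomputable def vertDiv [Fintype V] (r : V → ℤ) : C.Div :=
  ∑ v, Finsupp.single (.fin (.vert v)) (r v)

theorem vertDiv_vert [Fintype V] (r : V → ℤ) (v : V) : C.vertDiv r (.fin (.vert v)) = r v := by
  classical
  simp [vertDiv, Finsupp.finsetSum_apply, Finsupp.single_apply]

theorem vertDiv_infty [Fintype V] (r : V → ℤ) (l : L) : C.vertDiv r (.infty l) = 0 := by
  simp [vertDiv, Finsupp.finsetSum_apply]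

theorem edgePart_vertDiv [Fintype V] (r : V → ℤ) (e : E) : C.edgePart e (C.vertDiv r) = 0 := by
  rw [vertDiv, map_sum]
  exact Finset.sum_eq_zero fun v _ => by simp [edgePart]

theorem legPart_vertDiv [Fintype V] (r : V → ℤ) (l : L) : C.legPart l (C.vertDiv r) = 0 := by
  rw [vertDiv, map_sum]
  exact Finset.sum_eq_zero fun v _ => by simp [legPart]

/-- A function on the line with integral affine germs bends on a discrete set. -/
theorem finite_bending {g : ℝ → ℝ} {p q : ℝ → ℤ}
    (hp : ∀ t, ∀ᶠ s in 𝓝[>] (0 : ℝ), g (t + s) = g t + p t * s)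
    (hq : ∀ t, ∀ᶠ s in 𝓝[>] (0 : ℝ), g (t - s) = g t + q t * s) (a b : ℝ) :
    {t ∈ Set.Icc a b | p t + q t ≠ 0}.Finite := by
  -- On a punctured neighbourhood of `t₀` the function is affine on each side, so it can bend only
  -- at `t₀`; compactness of the interval finishes.
  have key : ∀ t₀, ∃ ε > 0, ∀ t, |t - t₀| < ε → t ≠ t₀ → p t + q t = 0 := by
    intro t₀
    obtain ⟨ε₁, h₁, hs₁⟩ := mem_nhdsGT_iff_exists_Ioo_subset.1 (hp t₀)
    obtain ⟨ε₂, h₂, hs₂⟩ := mem_nhdsGT_iff_exists_Ioo_subset.1 (hq t₀)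
    refine ⟨min ε₁ ε₂, lt_min h₁ h₂, fun t ht hne => ?_⟩
    have ht1 := ht.trans_le (min_le_left _ _)
    have ht2 := ht.trans_le (min_le_right _ _)
    rw [abs_lt] at ht1 ht2
    have aux : ∀ k : ℝ, (∀ᶠ s in 𝓝[>] (0 : ℝ), g (t + s) = g t + k * s) →
        (∀ᶠ s in 𝓝[>] (0 : ℝ), g (t - s) = g t + (-k) * s) → p t + q t = 0 := by
      intro k hk hk'
      have e1 := slope_unique (f := fun s => g (t + s)) (hp t) hk
      have e2 := slope_unique (f := fun s => g (t - s)) (hq t) hk'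
      have : (p t : ℝ) + q t = 0 := by linarith
      exact_mod_cast this
    rcases lt_or_gt_of_ne hne with h | h
    · have hg : ∀ s ∈ Set.Ioo 0 ε₂, g (t₀ - s) = g t₀ + q t₀ * s := fun s hs => hs₂ hs
      have e0 := hg (t₀ - t) ⟨by linarith, by linarith⟩
      rw [sub_sub_cancel] at e0
      refine aux (-q t₀) ?_ ?_
      · filter_upwards [Ioo_mem_nhdsGT (sub_pos.2 h)] with s hs
        have := hg (t₀ - t - s) ⟨by linarith [hs.2], by linarith [hs.1]⟩
        rw [show t₀ - (t₀ - t - s) = t + s by ring] at this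
        rw [this, e0]
        ring
      · filter_upwards [Ioo_mem_nhdsGT (show 0 < ε₂ - (t₀ - t) by linarith)] with s hs
        have := hg (t₀ - t + s) ⟨by linarith [hs.1], by linarith [hs.2]⟩
        rw [show t₀ - (t₀ - t + s) = t - s by ring] at this
        rw [this, e0]
        ring
    · have hg : ∀ s ∈ Set.Ioo 0 ε₁, g (t₀ + s) = g t₀ + p t₀ * s := fun s hs => hs₁ hs
      have e0 := hg (t - t₀) ⟨by linarith, by linarith⟩
      rw [add_sub_cancel] at e0
      refine aux (p t₀) ?_ ?_
      · filter_upwards [Ioo_mem_nhdsGT (show 0 < ε₁ - (t - t₀) by linarith)] with s hs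
        have := hg (t - t₀ + s) ⟨by linarith [hs.1], by linarith [hs.2]⟩
        rw [show t₀ + (t - t₀ + s) = t + s by ring] at this
        rw [this, e0]
        ring
      · filter_upwards [Ioo_mem_nhdsGT (sub_pos.2 h)] with s hs
        have := hg (t - t₀ - s) ⟨by linarith [hs.2], by linarith [hs.1]⟩
        rw [show t₀ + (t - t₀ - s) = t - s by ring] at this
        rw [this, e0]
        ring
  choose ε hε hfin using key
  obtain ⟨T, -, hT⟩ := isCompact_Icc.elim_nhds_subcover (fun t => Metric.ball t (ε t))
    (fun t _ => Metric.ball_mem_nhds t (hε t)) (s := Set.Icc a b)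
  refine T.finite_toSet.subset fun t ht => ?_
  obtain ⟨t₀, h₀, hmem⟩ := Set.mem_iUnion₂.1 (hT ht.1)
  rw [Metric.mem_ball, Real.dist_eq] at hmem
  by_contra hcon
  exact ht.2 (hfin t₀ t hmem fun h => hcon (h ▸ h₀))

section ThetaPullback

variable [Fintype E]

/-- The detours through the reference vertex cancel because `c` is closed. So a functional is
recovered from its values on the edge cycles. -/
theorem sum_smul_edgeCycle [Fintype V] (c : C.H1 ℤ) : ∑ e, (c : E → ℤ) e • C.edgeCycle e = c := by
  classical
  ext1
  have hc : C.boundary ℤ c = 0 := c.2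
  have h := C.sum_boundary_smul (c : E → ℤ) C.chain
  rw [hc] at h
  simp only [Pi.zero_apply, zero_smul, Finset.sum_const_zero, smul_sub,
    Finset.sum_sub_distrib] at h
  rw [AddSubmonoidClass.coe_finsetSum]
  simp only [Submodule.coe_smul, edgeCycle_coe, smul_sub, smul_add, Finset.sum_sub_distrib,
    Finset.sum_add_distrib]
  have h2 : ∑ e, (c : E → ℤ) e • (Pi.single e 1 : E → ℤ) = c := by
    conv_rhs => rw [← Finset.univ_sum_single (c : E → ℤ)]
    exact Finset.sum_congr rfl fun e _ => by rw [← Pi.single_smul, smul_eq_mul, mul_one]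
  rw [h2, ← sub_eq_zero.1 h.symm]
  abel

/-- The pull-backs of the translates of the theta divisor exist and have constant degree, and their
Abel-Jacobi images depend on the translation by a translation. -/
theorem exists_theta_pullback [Fintype V] [Fintype L] : ∃ (k : C.Jac) (g : ℤ), ∀ x : C.FormDual,
    ∃ D : C.Div, (∀ p, C.ThetaSlopeSum (C.refPt (C.finPart p) - x) p (D p)) ∧
      C.deg D = g ∧ C.refJac D = k + C.toJac x := by
  classical
  -- `T` and `K` collect the corrections due to the jump of the lift at the target of each edge. By
  -- quasi-periodicity the jump changes the slope of theta by the coefficient of `e` in its edge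
  -- cycle, and the value by an affine function of `x`; `T` and `K` do not involve `x`.
  let T : C.Div := C.vertDiv fun v => ∑ e with C.tgt e = v, (C.edgeCycle e : E → ℤ) e
  let K : C.FormDual := C.ofEdges fun e => C.refVert (C.tgt e) (C.edgeCycle e) +
    C.Q (C.edgeCycle e) (C.cycleInt (C.edgeCycle e)) / 2
  refine ⟨C.refJac T - C.toJac K, C.deg T, fun x => ?_⟩
  choose N hN using fun (p : C.Point) d => C.exists_thetaSlope (C.refPt (C.finPart p) - x) d
  have hleg : ∀ p l b, N p (.inr l, b) = 0 := by
    intro p l b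
    have h := hN p (.inr l, b)
    simp only [tangent, smul_zero, add_zero] at h
    have := slope_unique (q := 0) h (by simp)
    exact_mod_cast this
  let g : E → ℝ → ℝ := fun e t => C.theta (C.refVert (C.src e) - x + t • C.unitVec e)
  have hge : ∀ e t s, g e (t + s) =
      C.theta (C.refVert (C.src e) + t • C.unitVec e - x + s • C.unitVec e) := by
    intro e t s
    simp only [g, add_smul]
    congr 1
    abel
  have hge0 : ∀ e t, g e t = C.theta (C.refVert (C.src e) + t • C.unitVec e - x) := by
    intro e t
    simpa using hge e t 0
  have hge' : ∀ e t s, g e (t - s) =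
      C.theta (C.refVert (C.src e) + t • C.unitVec e - x + s • -C.unitVec e) := by
    intro e t s
    rw [sub_eq_add_neg, hge, smul_neg, neg_smul]
  have hgr : ∀ e t, ∃ n : ℤ, ∀ᶠ s in 𝓝[>] (0 : ℝ), g e (t + s) = g e t + n * s := fun e t => by
    simpa only [tangent, hge, ← hge0] using
      C.exists_thetaSlope (C.refVert (C.src e) + t • C.unitVec e - x) (.inl e, true)
  have hgl : ∀ e t, ∃ n : ℤ, ∀ᶠ s in 𝓝[>] (0 : ℝ), g e (t - s) = g e t + n * s := fun e t => by
    simpa only [tangent, hge', ← hge0] using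
      C.exists_thetaSlope (C.refVert (C.src e) + t • C.unitVec e - x) (.inl e, false)
  have hNr : ∀ e t h0 h1, ∀ᶠ s in 𝓝[>] (0 : ℝ),
      g e (t + s) = g e t + N (.fin (.edge e t h0 h1)) (.inl e, true) * s := fun e t h0 h1 => by
    simpa only [tangent, hge, ← hge0, finPart, refPt] using
      hN (.fin (.edge e t h0 h1)) (.inl e, true)
  have hNl : ∀ e t h0 h1, ∀ᶠ s in 𝓝[>] (0 : ℝ),
      g e (t - s) = g e t + N (.fin (.edge e t h0 h1)) (.inl e, false) * s := fun e t h0 h1 => by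
    simpa only [tangent, hge', ← hge0, finPart, refPt] using
      hN (.fin (.edge e t h0 h1)) (.inl e, false)
  have hfin : (Function.support fun p => ∑ d ∈ C.outDirs p, N p d).Finite := by
    choose P hP using hgr
    choose P' hP' using hgl
    have h1 : (⋃ e, (fun t => (Point.fin (C.edgePt e t) : C.Point)) ''
        {t ∈ Set.Icc 0 (C.len e) | P e t + P' e t ≠ 0}).Finite :=
      Set.finite_iUnion fun e => (finite_bending (hP e) (hP' e) _ _).image _
    refine ((Set.finite_range fun v : V => (Point.fin (.vert v) : C.Point)).union h1).subset ?_
    rintro ((v | ⟨e, t, h0, h1⟩ | ⟨l, t, h0⟩) | l) hp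
    · exact Or.inl ⟨v, rfl⟩
    · refine Or.inr (Set.mem_iUnion.2 ⟨e, t, ⟨⟨h0.le, h1.le⟩, ?_⟩, ?_⟩)
      · rw [Function.mem_support, sum_outDirs_edge] at hp
        have e1 := slope_unique (f := fun s => g e (t + s)) (hP e t) (hNr e t h0 h1)
        have e2 := slope_unique (f := fun s => g e (t - s)) (hP' e t) (hNl e t h0 h1)
        rw [Int.cast_inj] at e1 e2
        rwa [e1, e2]
      · exact congrArg Point.fin (C.edgePt_of_mem h0 h1)
    · simp [Function.mem_support, sum_outDirs_leg, hleg] at hp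
    · simp [Function.mem_support, sum_outDirs_infty, hleg] at hp
  let D : C.Div := Finsupp.ofSupportFinite _ hfin
  have hD : ∀ p, D p = ∑ d ∈ C.outDirs p, N p d := fun p => rfl
  let n : E → ℤ := fun e => N (.fin (.vert (C.src e))) (.inl e, true)
  have hz : ∀ e, C.refVert (C.src e) + C.len e • C.unitVec e - x =
      C.refVert (C.tgt e) - x + C.cycleInt (C.edgeCycle e) := fun e => by
    rw [refVert_tgt]
    abel
  have hg0 : ∀ e, g e 0 = C.theta (C.refVert (C.src e) - x) := fun e => by simp [g]
  have hglen : ∀ e, g e (C.len e) = C.theta (C.refVert (C.tgt e) - x) +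
      (C.refVert (C.tgt e) - x) (C.edgeCycle e) +
        C.Q (C.edgeCycle e) (C.cycleInt (C.edgeCycle e)) / 2 := fun e => by
    rw [hge0, hz, theta_add_cycleInt]
  have hgend : ∀ e, ∀ᶠ s in 𝓝[>] (0 : ℝ), g e (C.len e - s) = g e (C.len e) +
      (N (.fin (.vert (C.tgt e))) (.inl e, false) - (C.edgeCycle e : E → ℤ) e : ℤ) * s := by
    intro e
    have := theta_germ_add_cycleInt (hN (.fin (.vert (C.tgt e))) (.inl e, false)) (C.edgeCycle e)
    rw [tangent_apply] at this
    filter_upwards [this] with s hs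
    rw [hge', hge0, hz]
    simp only [finPart, refPt, tangent, dirCoeff] at hs
    rw [hs]
    push_cast
    ring
  have hform : ∀ e, ∀ t ∈ Set.Icc 0 (C.len e), g e t = g e 0 + n e * t + ramp t (C.edgePart e D) :=
    fun e => eq_add_ramp (C.edgePart_zero D e)
      (by
        have := hN (.fin (.vert (C.src e))) (.inl e, true)
        simpa only [hge, zero_smul, add_zero, hg0, finPart, refPt, tangent] using this)
      (fun t ht => ⟨_, _, hNr e t ht.1 ht.2, hNl e t ht.1 ht.2, by
        rw [C.edgePart_apply_of_mem e D ht.1 ht.2, hD, sum_outDirs_edge]⟩)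
      ⟨_, hgend e⟩
  have hlegD : ∀ l, C.legPart l D = 0 := by
    intro l
    ext t
    by_cases ht : 0 < t
    · rw [C.legPart_apply_of_pos l D ht, hD, sum_outDirs_leg]
      simp [hleg]
    · rw [C.legPart_apply_of_nonpos l D (not_lt.1 ht)]
      rfl
  -- Theta pulled back to the edges is a multivalued function on the curve whose divisor, after the
  -- correction at the targets, is `D - T`.
  have hflow : C.IsFlow (D - T) n 0 := by
    refine ⟨fun v => ?_, fun l => ?_⟩
    · rw [Finsupp.sub_apply, vertDiv_vert, hD, sum_outDirs_vert]
      simp only [hleg, Finset.sum_const_zero, add_zero, Pi.zero_apply]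
      rw [add_sub_assoc, ← Finset.sum_sub_distrib, sub_eq_add_neg, ← Finset.sum_neg_distrib]
      congr 1
      · refine Finset.sum_congr rfl fun e he => ?_
        rw [← (Finset.mem_filter.1 he).2]
      · refine Finset.sum_congr rfl fun e he => ?_
        rw [← (Finset.mem_filter.1 he).2, map_sub, edgePart_vertDiv, sub_zero]
        have h1 := hgend e
        have h2 : ∀ᶠ s in 𝓝[>] (0 : ℝ), g e (C.len e - s) = g e (C.len e) +
            (-(n e + mass (C.edgePart e D)) : ℤ) * s := by
          filter_upwards [ramp_left (C.len e) (C.edgePart e D), Ioo_mem_nhdsGT (C.len_pos e)]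
            with s hs hs'
          rw [hform e _ ⟨by linarith [hs'.2], by linarith [hs'.1]⟩, hs,
            hform e _ ⟨(C.len_pos e).le, le_rfl⟩, massLT_eq_mass (C.edgePart_len D e)]
          push_cast
          ring
        exact_mod_cast slope_unique h1 h2
    · rw [Finsupp.sub_apply, vertDiv_infty, hD, sum_outDirs_infty, hleg, map_sub, hlegD,
        legPart_vertDiv]
      simp
  refine ⟨D, fun p => ⟨N p, fun d _ => hN p d, hD p⟩, ?_, ?_⟩
  · have := hflow.deg_eq_zero
    rw [deg_sub] at this
    linarith
  · have h1 := hflow.refJac_eq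
    -- The rises are the gradient of the vertex values of theta, which drops out, plus the value
    -- corrections. These depend on `x` only through its values on edge cycles, and those values
    -- represent `x`.
    have h2 : C.ofEdges (C.rise (D - T) n) = K - x := by
      have e1 : C.rise (D - T) n = (fun e => C.theta (C.refVert (C.tgt e) - x) -
            C.theta (C.refVert (C.src e) - x)) +
          ((fun e => C.refVert (C.tgt e) (C.edgeCycle e) +
            C.Q (C.edgeCycle e) (C.cycleInt (C.edgeCycle e)) / 2) -
          fun e => x (C.edgeCycle e)) := by
        ext e
        have e2 := hform e _ ⟨(C.len_pos e).le, le_rfl⟩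
        rw [hglen, hg0, LinearMap.sub_apply] at e2
        simp only [rise, Pi.add_apply, Pi.sub_apply, map_sub, T, edgePart_vertDiv,
          sub_zero]
        linarith
      rw [e1, map_add, map_sub, C.ofEdges_gradient fun v => C.theta (C.refVert v - x), zero_add]
      congr 1
      ext c
      conv_rhs => rw [← C.sum_smul_edgeCycle c, map_sum]
      rw [ofEdges_apply]
      refine Finset.sum_congr rfl fun e _ => ?_
      rw [map_smul, zsmul_eq_mul, mul_comm]
    rw [map_sub, h2, toJac_sub, sub_eq_iff_eq_add] at h1
    rw [h1]
    abel

end ThetaPullback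

end TropicalCurve

/-! ### Orientations by distance, their divisors, and effectivity off zero -/

namespace TropicalCurve

variable {V E L : Type*} (C : TropicalCurve V E L)

/-! ### Distance functions on the vertices -/

/-- The function `d` on the vertices is the distance to the set of vertices `S`. -/
structure IsDist (S : Set V) (d : V → ℝ) : Prop where
  zero : ∀ v ∈ S, d v = 0
  nonneg : ∀ v, 0 ≤ d v
  lip : ∀ e, |d (C.tgt e) - d (C.src e)| ≤ C.len e
  pred : ∀ v ∉ S, (∃ e, C.src e = v ∧ d (C.src e) = d (C.tgt e) + C.len e) ∨
    ∃ e, C.tgt e = v ∧ d (C.tgt e) = d (C.src e) + C.len e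

theorem exists_lipschitz_bound (v w : V) : ∃ R : ℝ, ∀ f : V → ℝ,
    (∀ e, |f (C.tgt e) - f (C.src e)| ≤ C.len e) → |f v - f w| ≤ R := by
  induction C.connected v w with
  | rel a b h =>
    obtain ⟨e, rfl, rfl⟩ := h
    exact ⟨C.len e, fun f hf => by rw [abs_sub_comm]; exact hf e⟩
  | refl a => exact ⟨0, fun f _ => by simp⟩
  | symm a b _ ih =>
    obtain ⟨R, hR⟩ := ih
    exact ⟨R, fun f hf => by rw [abs_sub_comm]; exact hR f hf⟩
  | trans a b c _ _ ih ih' =>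
    obtain ⟨R, hR⟩ := ih
    obtain ⟨R', hR'⟩ := ih'
    exact ⟨R + R', fun f hf => (abs_sub_le _ (f b) _).trans (add_le_add (hR f hf) (hR' f hf))⟩

theorem exists_pos_forall_le {ι : Type*} [Finite ι] {σ : ι → ℝ} (h : ∀ i, 0 < σ i) :
    ∃ ε > 0, ∀ i, ε ≤ σ i := by
  have : ∀ᶠ ε in 𝓝[>] (0 : ℝ), ∀ i, ε ≤ σ i := Filter.eventually_all.2 fun i => by
    filter_upwards [Ioo_mem_nhdsGT (h i)] with s hs using hs.2.le
  obtain ⟨ε, h1, h2⟩ := (this.and self_mem_nhdsWithin).exists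
  exact ⟨ε, h2, h1⟩

/-- Take the largest 1-Lipschitz function that is at most zero on `S`. Connectedness bounds it. At a
vertex outside `S` with no tight edge leading closer to `S`, its value could still be raised,
against maximality. -/
theorem exists_isDist [Finite E] {S : Set V} (hS : S.Nonempty) : ∃ d, C.IsDist S d := by
  classical
  obtain ⟨w, hw⟩ := hS
  let F : Set (V → ℝ) :=
    {f | (∀ v ∈ S, f v ≤ 0) ∧ ∀ e, |f (C.tgt e) - f (C.src e)| ≤ C.len e}
  have h0 : (0 : V → ℝ) ∈ F := ⟨fun v _ => le_rfl, fun e => by simpa using (C.len_pos e).le⟩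
  let d : V → ℝ := fun v => sSup ((fun f : V → ℝ => f v) '' F)
  have hbdd : ∀ v, BddAbove ((fun f : V → ℝ => f v) '' F) := by
    intro v
    obtain ⟨R, hR⟩ := C.exists_lipschitz_bound v w
    refine ⟨R, ?_⟩
    rintro _ ⟨f, hf, rfl⟩
    have := (abs_le.1 (hR f hf.2)).2
    have := hf.1 w hw
    dsimp only
    linarith
  have hle : ∀ f ∈ F, ∀ v, f v ≤ d v := fun f hf v => le_csSup (hbdd v) ⟨f, hf, rfl⟩
  have hge : ∀ v B, (∀ f ∈ F, f v ≤ B) → d v ≤ B := by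
    intro v B h
    refine csSup_le ⟨_, 0, h0, rfl⟩ ?_
    rintro _ ⟨f, hf, rfl⟩
    exact h f hf
  have hlip : ∀ e, |d (C.tgt e) - d (C.src e)| ≤ C.len e := by
    intro e
    rw [abs_sub_le_iff]
    constructor
    · rw [sub_le_iff_le_add']
      refine hge _ _ fun f hf => ?_
      linarith [hle f hf (C.src e), (abs_sub_le_iff.1 (hf.2 e)).1]
    · rw [sub_le_iff_le_add']
      refine hge _ _ fun f hf => ?_
      linarith [hle f hf (C.tgt e), (abs_sub_le_iff.1 (hf.2 e)).2]
  have hzero : ∀ v ∈ S, d v = 0 := fun v hv =>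
    le_antisymm (hge v 0 fun f hf => hf.1 v hv) (hle 0 h0 v)
  refine ⟨d, hzero, fun v => hle 0 h0 v, hlip, fun v hv => ?_⟩
  by_contra! hcon
  -- The slack of each edge at `v`. Loops and edges away from `v` impose no constraint and get the
  -- dummy value 1.
  obtain ⟨ε, hε, hslack⟩ := exists_pos_forall_le (σ := fun e =>
      if C.src e = v then (if C.tgt e = v then 1 else d (C.tgt e) + C.len e - d v)
      else if C.tgt e = v then d (C.src e) + C.len e - d v else 1) (by
    intro e
    have h1 := abs_sub_le_iff.1 (hlip e)
    split_ifs with h2 h3 h3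
    · exact one_pos
    · have := hcon.1 e h2
      rw [h2] at this h1
      rcases lt_or_eq_of_le (show d v ≤ d (C.tgt e) + C.len e by linarith) with h | h
      · linarith
      · exact absurd h this
    · have := hcon.2 e h3
      rw [h3] at this h1
      rcases lt_or_eq_of_le (show d v ≤ d (C.src e) + C.len e by linarith) with h | h
      · linarith
      · exact absurd h this
    · exact one_pos)
  have hf : Function.update d v (d v + ε) ∈ F := by
    refine ⟨fun u hu => ?_, fun e => ?_⟩
    · rw [Function.update_of_ne (fun h => hv (by rwa [h] at hu)), hzero u hu]
    · have h1 := hslack e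
      have h2 := abs_sub_le_iff.1 (hlip e)
      by_cases hs : C.src e = v <;> by_cases ht : C.tgt e = v
      · rw [hs, ht, sub_self, abs_zero]
        exact (C.len_pos e).le
      · simp only [if_pos hs, if_neg ht] at h1
        rw [hs, Function.update_self, Function.update_of_ne ht, abs_sub_le_iff]
        rw [hs] at h2
        constructor <;> linarith
      · simp only [if_neg hs, if_pos ht] at h1
        rw [ht, Function.update_self, Function.update_of_ne hs, abs_sub_le_iff]
        rw [ht] at h2
        constructor <;> linarith
      · rw [Function.update_of_ne hs, Function.update_of_ne ht]
        exact hlip e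
  have := hle _ hf v
  rw [Function.update_self] at this
  linarith

variable {C}

theorem IsDist.induction [Finite V] {S : Set V} {d : V → ℝ} (h : C.IsDist S d) {P : V → Prop}
    (h0 : ∀ v ∈ S, P v)
    (hsrc : ∀ e, C.src e ∉ S → d (C.src e) = d (C.tgt e) + C.len e → P (C.tgt e) → P (C.src e))
    (htgt : ∀ e, C.tgt e ∉ S → d (C.tgt e) = d (C.src e) + C.len e → P (C.src e) → P (C.tgt e)) :
    ∀ v, P v := by
  have : IsTrans V fun w v => d w < d v := ⟨fun _ _ _ => lt_trans⟩
  have : Std.Irrefl fun w v : V => d w < d v := ⟨fun _ => lt_irrefl _⟩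
  intro v
  induction v using (Finite.wellFounded_of_trans_of_irrefl fun w v => d w < d v).induction with
  | _ v ih =>
    by_cases hv : v ∈ S
    · exact h0 v hv
    · rcases h.pred v hv with ⟨e, rfl, he⟩ | ⟨e, rfl, he⟩
      · exact hsrc e hv he (ih _ (by rw [he]; linarith [C.len_pos e]))
      · exact htgt e hv he (ih _ (by rw [he]; linarith [C.len_pos e]))

variable (C)

/-- The point of the edge `e` at which the distance function is maximal. -/
noncomputable def peak (d : V → ℝ) (e : E) : ℝ := (d (C.tgt e) - d (C.src e) + C.len e) / 2

variable {C}

theorem IsDist.peak_nonneg {S : Set V} {d : V → ℝ} (h : C.IsDist S d) (e : E) :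
    0 ≤ C.peak d e := by
  have := (abs_le.1 (h.lip e)).1
  rw [peak]
  linarith

theorem IsDist.peak_le {S : Set V} {d : V → ℝ} (h : C.IsDist S d) (e : E) :
    C.peak d e ≤ C.len e := by
  have := (abs_le.1 (h.lip e)).2
  rw [peak]
  linarith

theorem peak_eq_zero_iff {d : V → ℝ} {e : E} :
    C.peak d e = 0 ↔ d (C.src e) = d (C.tgt e) + C.len e := by
  rw [peak]
  constructor <;> intro h <;> linarith

theorem peak_eq_len_iff {d : V → ℝ} {e : E} :
    C.peak d e = C.len e ↔ d (C.tgt e) = d (C.src e) + C.len e := by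
  rw [peak]
  constructor <;> intro h <;> linarith

/-! ### The divisor of incoming directions -/

variable (C) [Fintype E]

/-- The cycle `c` is simple and supported between vertices of `S`, and `d` is the distance
to `S`. -/
structure IsOrientation (c : C.H1 ℤ) (S : Set V) (d : V → ℝ) : Prop extends C.IsDist S d where
  simple : ∀ e, |(c : E → ℤ) e| ≤ 1
  supp : ∀ e, (c : E → ℤ) e ≠ 0 → C.src e ∈ S ∧ C.tgt e ∈ S

open Classical in
/-- Whether the edge `e` comes into its source. -/
noncomputable def srcIn (c : C.H1 ℤ) (d : V → ℝ) (e : E) : ℤ :=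
  if (c : E → ℤ) e = 0 ∧ C.peak d e = 0 ∨ (c : E → ℤ) e = -1 then 1 else 0

open Classical in
/-- Whether the edge `e` comes into its target. -/
noncomputable def tgtIn (c : C.H1 ℤ) (d : V → ℝ) (e : E) : ℤ :=
  if (c : E → ℤ) e = 0 ∧ C.peak d e = C.len e ∨ (c : E → ℤ) e = 1 then 1 else 0

open Classical in
/-- The interior points of the edge `e` with two incoming directions. -/
noncomputable def midIn (c : C.H1 ℤ) (d : V → ℝ) (e : E) : ℝ →₀ ℤ :=
  if (c : E → ℤ) e = 0 ∧ 0 < C.peak d e ∧ C.peak d e < C.len e then Finsupp.single (C.peak d e) 1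
  else 0

open Classical in
/-- The divisor `∑ (val₋ p - 1) p` of the orientation given by `c` and `d`. -/
noncomputable def inDiv [Fintype V] (c : C.H1 ℤ) (d : V → ℝ) : C.Div :=
  C.vertDiv (fun v => ∑ e with C.src e = v, C.srcIn c d e + ∑ e with C.tgt e = v, C.tgtIn c d e - 1)
  + ∑ e, if (c : E → ℤ) e = 0 ∧ 0 < C.peak d e ∧ C.peak d e < C.len e then
      Finsupp.single (.fin (C.edgePt e (C.peak d e))) 1 else 0

section inDiv

variable [Fintype V] (c : C.H1 ℤ) (d : V → ℝ)

open Classical in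
theorem inDiv_vert (v : V) : C.inDiv c d (.fin (.vert v)) =
    ∑ e with C.src e = v, C.srcIn c d e + ∑ e with C.tgt e = v, C.tgtIn c d e - 1 := by
  rw [inDiv, Finsupp.add_apply, vertDiv_vert, Finsupp.finsetSum_apply, add_eq_left]
  refine Finset.sum_eq_zero fun e _ => ?_
  split_ifs with h
  · rw [C.edgePt_of_mem h.2.1 h.2.2]
    simp
  · rfl

theorem inDiv_infty (l : L) : C.inDiv c d (.infty l) = 0 := by
  classical
  rw [inDiv, Finsupp.add_apply, vertDiv_infty, Finsupp.finsetSum_apply, Finset.sum_eq_zero,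
    add_zero]
  intro e _
  split_ifs <;> simp

theorem edgePart_inDiv (e : E) : C.edgePart e (C.inDiv c d) = C.midIn c d e := by
  classical
  rw [inDiv, map_add, edgePart_vertDiv, zero_add, map_sum, Finset.sum_eq_single e]
  · rw [midIn]
    split_ifs with h
    · rw [C.edgePt_of_mem h.2.1 h.2.2, edgePart, Finsupp.liftAddHom_apply_single]
      simp
    · simp
  · intro e' _ hne
    split_ifs with h
    · rw [C.edgePt_of_mem h.2.1 h.2.2, edgePart, Finsupp.liftAddHom_apply_single]
      simp [hne]
    · simp
  · simp

theorem legPart_inDiv (l : L) : C.legPart l (C.inDiv c d) = 0 := by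
  classical
  rw [inDiv, map_add, legPart_vertDiv, zero_add, map_sum]
  refine Finset.sum_eq_zero fun e _ => ?_
  split_ifs with h
  · rw [C.edgePt_of_mem h.2.1 h.2.2, legPart, Finsupp.liftAddHom_apply_single]
    simp
  · simp

end inDiv

open Classical in
/-- The divisor with multiplicity at each vertex one less than the number of edges ending there. -/
noncomputable def baseDiv [Fintype V] : C.Div :=
  C.vertDiv fun v => ∑ e with C.tgt e = v, 1 - 1

theorem deg_baseDiv [Fintype V] [Fintype L] : C.deg C.baseDiv = (C.genus : ℤ) - 1 := by
  classical
  rw [deg_eq_sum_parts, genus_eq, baseDiv]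
  simp only [vertDiv_vert, edgePart_vertDiv, legPart_vertDiv, vertDiv_infty, map_zero,
    Finset.sum_const_zero, add_zero, Finset.sum_sub_distrib]
  rw [sum_fiber C.tgt fun _ => (1 : ℤ)]
  simp

variable {C} {c : C.H1 ℤ} {S : Set V} {d : V → ℝ}

theorem IsOrientation.cases (h : C.IsOrientation c S d) (e : E) :
    (c : E → ℤ) e = -1 ∨ (c : E → ℤ) e = 0 ∨ (c : E → ℤ) e = 1 := by
  have := abs_le.1 (h.simple e)
  omega

/-- Each edge carries exactly one head: at its source, at its target, or at an interior peak. -/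
theorem IsOrientation.srcIn_add (h : C.IsOrientation c S d) (e : E) :
    C.srcIn c d e + C.tgtIn c d e + mass (C.midIn c d e) = 1 := by
  classical
  have hl := C.len_pos e
  rw [srcIn, tgtIn, midIn]
  rcases h.cases e with hc | hc | hc
  · simp [hc]
  · rcases eq_or_lt_of_le (h.peak_nonneg e) with h0 | h0
    · simp [hc, ← h0, hl.ne]
    · rcases eq_or_lt_of_le (h.peak_le e) with h1 | h1
      · simp [hc, h1, hl.ne']
      · simp [hc, h0, h1, h0.ne', h1.ne]
  · simp [hc]

/-- `baseDiv` has all heads at the targets. Moving a head back along its edge is done by a function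
of slope 0 before the head and slope 1 after it. -/
theorem IsOrientation.isFlow [Fintype V] [Fintype L] (h : C.IsOrientation c S d) :
    C.IsFlow (C.inDiv c d - C.baseDiv) (C.srcIn c d) 0 := by
  classical
  refine ⟨fun v => ?_, fun l => ?_⟩
  · rw [Finsupp.sub_apply, inDiv_vert, baseDiv, vertDiv_vert]
    have : ∀ e, C.tgtIn c d e = 1 - (C.srcIn c d e + mass (C.midIn c d e)) := fun e => by
      linarith [h.srcIn_add e]
    simp only [map_sub, edgePart_inDiv, edgePart_vertDiv, sub_zero, this, Finset.sum_sub_distrib,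
      Pi.zero_apply, Finset.sum_const_zero]
    ring
  · rw [Finsupp.sub_apply, inDiv_infty, baseDiv, vertDiv_infty, map_sub, legPart_inDiv,
      legPart_vertDiv]
    simp

/-- The rise is the distance from the head to the target. On the support of `c` the head is at an
end selected by the sign of `c e`, and `d` vanishes at both ends; elsewhere the head is at the peak.
-/
theorem IsOrientation.rise_eq [Fintype V] (h : C.IsOrientation c S d) (e : E) :
    C.rise (C.inDiv c d - C.baseDiv) (C.srcIn c d) e =
      (1 / 2) * C.len e - (1 / 2) * (((c : E → ℤ) e : ℝ) * C.len e) -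
        (1 / 2) * (d (C.tgt e) - d (C.src e)) := by
  classical
  have hl := C.len_pos e
  have hd : (c : E → ℤ) e ≠ 0 → d (C.tgt e) - d (C.src e) = 0 := fun hne => by
    rw [h.zero _ (h.supp e hne).1, h.zero _ (h.supp e hne).2, sub_zero]
  have hp : d (C.tgt e) - d (C.src e) = 2 * C.peak d e - C.len e := by
    rw [peak]
    ring
  rw [rise, baseDiv, map_sub, edgePart_inDiv, edgePart_vertDiv, sub_zero, srcIn, midIn]
  rcases h.cases e with hc | hc | hc
  · rw [hd (by rw [hc]; simp)]
    simp [hc]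
    ring
  · rw [hp]
    rcases eq_or_lt_of_le (h.peak_nonneg e) with h0 | h0
    · simp [hc, ← h0]
      ring
    · rcases eq_or_lt_of_le (h.peak_le e) with h1 | h1
      · simp [hc, h1, hl.ne']
        ring
      · simp [hc, h0, h1, h0.ne', max_eq_left (sub_pos.2 h1).le]
        ring
  · rw [hd (by rw [hc]; simp)]
    simp [hc]

theorem IsOrientation.deg_eq [Fintype V] [Fintype L] (h : C.IsOrientation c S d) :
    C.deg (C.inDiv c d) = (C.genus : ℤ) - 1 := by
  have := h.isFlow.deg_eq_zero
  rw [deg_sub, sub_eq_zero] at this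
  rw [this, deg_baseDiv]

/-- The gradient of `d` drops out, so the distance function does not influence the class and only
the half-cycle remains. -/
theorem IsOrientation.refJac_eq [Fintype V] [Fintype L] (h : C.IsOrientation c S d) :
    C.refJac (C.inDiv c d) = C.refJac C.baseDiv - C.toJac ((1 / 2 : ℝ) • C.ofEdges C.len) +
      C.toJac ((1 / 2 : ℝ) • C.cycleInt c) := by
  have h1 := h.isFlow.refJac_eq
  have h2 : C.ofEdges (C.rise (C.inDiv c d - C.baseDiv) (C.srcIn c d)) =
      (1 / 2 : ℝ) • C.ofEdges C.len - (1 / 2 : ℝ) • C.cycleInt c := by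
    have : C.rise (C.inDiv c d - C.baseDiv) (C.srcIn c d) = (1 / 2 : ℝ) • C.len -
        (1 / 2 : ℝ) • (fun e => ((c : E → ℤ) e : ℝ) * C.len e) -
          (1 / 2 : ℝ) • fun e => d (C.tgt e) - d (C.src e) := by
      ext e
      rw [h.rise_eq]
      rfl
    rw [this, map_sub, map_sub, map_smul, map_smul, map_smul, ofEdges_gradient, smul_zero, sub_zero,
      cycleInt_eq_ofEdges]
  rw [map_sub, h2, toJac_sub, sub_eq_iff_eq_add] at h1
  rw [h1]
  abel

open Classical in
theorem canonical_vert [Fintype V] [Fintype L] (v : V) : C.canonical (.fin (.vert v)) =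
    ∑ e with C.src e = v, 1 + ∑ e with C.tgt e = v, 1 + ∑ l with C.base l = v, 1 - 2 := by
  have : (C.val (.fin (.vert v)) : ℤ) = ∑ d ∈ C.outDirs (.fin (.vert v)), 1 := by simp [val]
  rw [sum_outDirs_vert] at this
  rw [← this]
  rfl

theorem canonical_infty [Fintype V] [Fintype L] (l : L) : C.canonical (.infty l) = -1 := by
  have : (C.val (.infty l) : ℤ) = ∑ d ∈ C.outDirs (.infty l), 1 := by simp [val]
  rw [sum_outDirs_infty] at this
  change (C.val (.infty l) : ℤ) - 2 = -1
  rw [this]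
  rfl

theorem canonical_edge [Fintype V] [Fintype L] (e : E) (t h0 h1) :
    C.canonical (.fin (.edge e t h0 h1)) = 0 := by
  have : C.val (.fin (.edge e t h0 h1)) = 2 :=
    C.val_eq_two_of_interior _ (by simp) (by simp)
  change (C.val (.fin (.edge e t h0 h1)) : ℤ) - 2 = 0
  rw [this]
  rfl

theorem canonical_leg [Fintype V] [Fintype L] (l : L) (t h0) :
    C.canonical (.fin (.leg l t h0)) = 0 := by
  have : C.val (.fin (.leg l t h0)) = 2 :=
    C.val_eq_two_of_interior _ (by simp) (by simp)
  change (C.val (.fin (.leg l t h0)) : ℤ) - 2 = 0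
  rw [this]
  rfl

theorem edgePart_canonical [Fintype V] [Fintype L] (e : E) : C.edgePart e C.canonical = 0 := by
  ext t
  by_cases h : 0 < t ∧ t < C.len e
  · rw [C.edgePart_apply_of_mem e _ h.1 h.2, canonical_edge]
    rfl
  · rw [C.edgePart_apply_of_notMem e _ h]
    rfl

theorem legPart_canonical [Fintype V] [Fintype L] (l : L) : C.legPart l C.canonical = 0 := by
  ext t
  by_cases h : 0 < t
  · rw [C.legPart_apply_of_pos l _ h, canonical_leg]
    rfl
  · rw [C.legPart_apply_of_nonpos l _ (not_lt.1 h)]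
    rfl

variable (C) in
-- Slope 1 everywhere carries `2 • baseDiv` to `K`. Its rises are the full lengths, twice the
-- constant half-lengths that occur for orientations.
theorem isFlow_canonical [Fintype V] [Fintype L] :
    C.IsFlow (C.canonical - (C.baseDiv + C.baseDiv)) 1 1 := by
  classical
  refine ⟨fun v => ?_, fun l => ?_⟩
  · simp only [map_sub, map_add, edgePart_canonical, baseDiv, edgePart_vertDiv, Finsupp.sub_apply,
      Finsupp.add_apply, vertDiv_vert, canonical_vert, Pi.one_apply, map_zero, sub_zero, add_zero]
    ring
  · simp [map_sub, map_add, legPart_canonical, baseDiv, legPart_vertDiv, Finsupp.sub_apply,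
      vertDiv_infty, canonical_infty]

theorem deg_canonical [Fintype V] [Fintype L] :
    C.deg C.canonical = 2 * ((C.genus : ℤ) - 1) := by
  have := C.isFlow_canonical.deg_eq_zero
  rw [deg_sub, deg_add, deg_baseDiv] at this
  linarith

/-- The double of the class of `inDiv` is the canonical class. -/
theorem IsOrientation.two_smul_cls [Fintype V] [Fintype L] (h : C.IsOrientation c S d) :
    2 • C.cls (C.inDiv c d) = C.cls C.canonical := by
  have e1 : 2 • C.cls (C.inDiv c d) = C.cls (C.inDiv c d + C.inDiv c d) := two_nsmul _
  rw [e1, cls_eq_iff, deg_add, h.deg_eq, deg_canonical]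
  refine ⟨by ring, ?_⟩
  have h1 := C.isFlow_canonical.refJac_eq
  have h2 : C.ofEdges (C.rise (C.canonical - (C.baseDiv + C.baseDiv)) 1) = C.ofEdges C.len := by
    congr 1
    ext e
    simp [rise, edgePart_canonical, baseDiv, edgePart_vertDiv]
  rw [h2, map_sub, map_add, sub_eq_iff_eq_add] at h1
  have h3 : ∀ x : C.FormDual, C.toJac ((1 / 2 : ℝ) • x) + C.toJac ((1 / 2 : ℝ) • x) = C.toJac x :=
    fun x => by
      rw [← toJac_add, ← add_smul]
      norm_num
  rw [map_add, h.refJac_eq, h1, ← h3 (C.ofEdges C.len)]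
  have h4 := h3 (C.cycleInt c)
  rw [toJac_cycleInt] at h4
  rw [show ∀ a b c : C.Jac, (a - b + c) + (a - b + c) = -(b + b) + (a + a) + (c + c) by
    intros; abel, h4, add_zero]

/-! ### Effectivity -/

/-- Only vertices could be negative, so each needs an incoming edge. Off `S` it is the last edge of
a shortest path from `S`; on `S` a balanced cycle through a vertex must enter it. -/
theorem IsOrientation.inDiv_nonneg [Fintype V] (h : C.IsOrientation c S d)
    (hS : ∀ v ∈ S, ∃ e, (c : E → ℤ) e ≠ 0 ∧ (C.src e = v ∨ C.tgt e = v)) : 0 ≤ C.inDiv c d := by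
  classical
  have hs0 : ∀ e, 0 ≤ C.srcIn c d e := fun e => by rw [srcIn]; split_ifs <;> simp
  have ht0 : ∀ e, 0 ≤ C.tgtIn c d e := fun e => by rw [tgtIn]; split_ifs <;> simp
  rintro ((v | ⟨e, t, h0, h1⟩ | ⟨l, t, h0⟩) | l)
  · rw [inDiv_vert, Finsupp.zero_apply]
    suffices (∃ e, C.src e = v ∧ C.srcIn c d e = 1) ∨ ∃ e, C.tgt e = v ∧ C.tgtIn c d e = 1 by
      have hs := Finset.sum_nonneg (s := Finset.univ.filter fun e => C.src e = v) fun e _ => hs0 e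
      have ht := Finset.sum_nonneg (s := Finset.univ.filter fun e => C.tgt e = v) fun e _ => ht0 e
      rcases this with ⟨e, he, h1⟩ | ⟨e, he, h1⟩
      · have := Finset.single_le_sum (s := Finset.univ.filter fun e => C.src e = v)
          (f := C.srcIn c d) (fun e _ => hs0 e) (by simpa using he)
        linarith
      · have := Finset.single_le_sum (s := Finset.univ.filter fun e => C.tgt e = v)
          (f := C.tgtIn c d) (fun e _ => ht0 e) (by simpa using he)
        linarith
    by_cases hv : v ∈ S
    · by_contra! hcon
      have hc : C.boundary ℤ c = 0 := c.2
      have hb := congrFun hc v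
      simp only [boundary, LinearMap.coe_mk, AddHom.coe_mk, Pi.zero_apply] at hb
      have h1 : ∀ e ∈ Finset.univ.filter (fun e => C.src e = v), 0 ≤ (c : E → ℤ) e := by
        intro e he
        have := hcon.1 e (Finset.mem_filter.1 he).2
        rcases h.cases e with hc | hc | hc
        · simp [srcIn, hc] at this
        · exact hc.ge
        · rw [hc]; exact zero_le_one
      have h2 : ∀ e ∈ Finset.univ.filter (fun e => C.tgt e = v), (c : E → ℤ) e ≤ 0 := by
        intro e he
        have := hcon.2 e (Finset.mem_filter.1 he).2
        rcases h.cases e with hc | hc | hc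
        · rw [hc]; simp
        · exact hc.le
        · simp [tgtIn, hc] at this
      have h1' := Finset.sum_nonneg h1
      have h2' := Finset.sum_nonpos h2
      obtain ⟨e, hne, he | he⟩ := hS v hv
      · have h3 := (Finset.sum_eq_zero_iff_of_nonneg h1).1 (by linarith) e (by simpa using he)
        exact hne h3
      · have h3 := (Finset.sum_eq_zero_iff_of_nonpos h2).1 (by linarith) e (by simpa using he)
        exact hne h3
    · rcases h.pred v hv with ⟨e, he, hd⟩ | ⟨e, he, hd⟩
      · refine Or.inl ⟨e, he, ?_⟩
        have hc : (c : E → ℤ) e = 0 := by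
          by_contra hne
          exact hv (he ▸ (h.supp e hne).1)
        simp [srcIn, hc, peak_eq_zero_iff.2 hd]
      · refine Or.inr ⟨e, he, ?_⟩
        have hc : (c : E → ℤ) e = 0 := by
          by_contra hne
          exact hv (he ▸ (h.supp e hne).2)
        simp [tgtIn, hc, peak_eq_len_iff.2 hd]
  · rw [Finsupp.zero_apply, ← C.edgePart_apply_of_mem e _ h0 h1, edgePart_inDiv, midIn]
    split_ifs
    · rw [Finsupp.single_apply]
      split_ifs <;> simp
    · rfl
  · rw [Finsupp.zero_apply, ← C.legPart_apply_of_pos l _ h0, legPart_inDiv]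
    rfl
  · rw [inDiv_infty]
    rfl

end TropicalCurve

/-! ### Non-effectivity by a maximum principle -/

namespace TropicalCurve

/-! ### Convexity -/

open Classical in
theorem massLE_eq_sum (t : ℝ) (a : ℝ →₀ ℤ) :
    massLE t a = ∑ s ∈ a.support, if s ≤ t then a s else 0 := by
  rw [massLE, Finsupp.liftAddHom_apply]
  refine Finset.sum_congr rfl fun s _ => ?_
  dsimp only
  split_ifs <;> rfl

open Classical in
theorem massLT_eq_sum (t : ℝ) (a : ℝ →₀ ℤ) :
    massLT t a = ∑ s ∈ a.support, if s < t then a s else 0 := by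
  rw [massLT, Finsupp.liftAddHom_apply]
  refine Finset.sum_congr rfl fun s _ => ?_
  dsimp only
  split_ifs <;> rfl

theorem ramp_eq_support_sum (t : ℝ) (a : ℝ →₀ ℤ) :
    ramp t a = ∑ s ∈ a.support, (a s : ℝ) * max (t - s) 0 := ramp_eq_sum t a

variable {a : ℝ →₀ ℤ} {s t : ℝ}

theorem ramp_nonneg (h : ∀ u < t, 0 ≤ a u) : 0 ≤ ramp t a := by
  rw [ramp_eq_support_sum]
  refine Finset.sum_nonneg fun u _ => ?_
  rcases lt_or_ge u t with hu | hu
  · have : (0 : ℝ) ≤ a u := by exact_mod_cast h u hu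
    positivity
  · rw [max_eq_right (by linarith), mul_zero]

/-- For a convex function the slope of a chord lies between the slopes at its ends. This estimate
and the next two turn inequalities between values into inequalities between integral slopes. -/
theorem ramp_le_massLT (ha : ∀ u ≤ 0, a u = 0) (h : ∀ u < t, 0 ≤ a u) :
    ramp t a ≤ massLT t a * t := by
  classical
  rw [ramp_eq_support_sum, massLT_eq_sum, Int.cast_sum, Finset.sum_mul]
  refine Finset.sum_le_sum fun u hu => ?_
  have hu0 : 0 < u := by
    by_contra hcon
    exact Finsupp.mem_support_iff.1 hu (ha u (not_lt.1 hcon))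
  split_ifs with hut
  · have : (0 : ℝ) ≤ a u := by exact_mod_cast h u hut
    rw [max_eq_left (by linarith)]
    exact mul_le_mul_of_nonneg_left (by linarith) this
  · rw [max_eq_right (by linarith)]
    simp

theorem massLE_le_ramp_sub (hst : s ≤ t) (h : ∀ u, s < u → 0 ≤ a u) :
    massLE s a * (t - s) ≤ ramp t a - ramp s a := by
  classical
  rw [ramp_eq_support_sum, ramp_eq_support_sum, massLE_eq_sum, Int.cast_sum, Finset.sum_mul,
    ← Finset.sum_sub_distrib]
  refine Finset.sum_le_sum fun u _ => ?_
  split_ifs with hu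
  · rw [max_eq_left (by linarith), max_eq_left (by linarith)]
    exact le_of_eq (by ring)
  · have : (0 : ℝ) ≤ a u := by exact_mod_cast h u (not_le.1 hu)
    rw [max_eq_right (show s - u ≤ 0 by linarith), Int.cast_zero, zero_mul, mul_zero, sub_zero]
    positivity

theorem ramp_sub_le_mass (hst : s ≤ t) (h : ∀ u, s < u → 0 ≤ a u) :
    ramp t a - ramp s a ≤ mass a * (t - s) := by
  rw [ramp_eq_support_sum, ramp_eq_support_sum, mass_eq_sum, Finsupp.sum, Int.cast_sum,
    Finset.sum_mul, ← Finset.sum_sub_distrib]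
  refine Finset.sum_le_sum fun u _ => ?_
  rcases le_or_gt u s with hu | hu
  · rw [max_eq_left (by linarith), max_eq_left (by linarith)]
    exact le_of_eq (by ring)
  · have : (0 : ℝ) ≤ a u := by exact_mod_cast h u hu
    rw [max_eq_right (show s - u ≤ 0 by linarith), mul_zero, sub_zero]
    exact mul_le_mul_of_nonneg_left (max_le (by linarith) (by linarith)) this

variable {V E L : Type*} {C : TropicalCurve V E L} [Fintype V] [Fintype E] [Fintype L]
  {S : Set V} {d : V → ℝ}

/-- The divisor of incoming directions of an orientation away from a set of vertices is not
equivalent to an effective divisor. -/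
theorem IsOrientation.not_isEffective (h : C.IsOrientation 0 S d) :
    ¬ C.IsEffective (C.cls (C.inDiv 0 d)) := by
  classical
  rintro ⟨D, hD, hcls⟩
  set G : C.Div := D - C.inDiv 0 d with hG
  obtain ⟨f, hf⟩ : G ∈ C.principal := QuotientAddGroup.eq_iff_sub_mem.1 hcls
  obtain ⟨n, m, hflow, hform⟩ := hf.exists_form
  have hD0 : ∀ p, 0 ≤ D p := fun p => hD p
  have hmid : ∀ e t, (0 < t ∧ t < C.len e) →
      -C.midIn 0 d e t ≤ C.edgePart e G t := by
    intro e t ht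
    rw [hG, map_sub, Finsupp.sub_apply, edgePart_inDiv, C.edgePart_apply_of_mem e D ht.1 ht.2]
    linarith [hD0 (.fin (.edge e t ht.1 ht.2))]
  -- Away from the peak `D` alone contributes inside the edge, so `f` is convex on both sides of the
  -- peak.
  have hpos : ∀ e t, t ≠ C.peak d e → 0 ≤ C.edgePart e G t := by
    intro e t ht
    by_cases hcon : 0 < t ∧ t < C.len e
    · refine le_trans (le_of_eq ?_) (hmid e t hcon)
      rw [midIn]
      split_ifs
      · simp [ht]
      · simp
    · rw [C.edgePart_apply_of_notMem e G hcon]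
  have hpos' : ∀ e, (C.peak d e = 0 ∨ C.peak d e = C.len e) → ∀ t, 0 ≤ C.edgePart e G t := by
    intro e he t
    by_cases ht : t = C.peak d e
    · rw [C.edgePart_apply_of_notMem]
      rintro ⟨h1, h2⟩
      rcases he with he | he <;> rw [ht, he] at h1 h2
      · exact lt_irrefl _ h1
      · exact lt_irrefl _ h2
    · exact hpos e t ht
  have hm : ∀ l, m l ≤ 0 := by
    intro l
    have h1 := hflow.2 l
    rw [hG, Finsupp.sub_apply, inDiv_infty, map_sub, legPart_inDiv] at h1
    have h2 : 0 ≤ mass (C.legPart l D) := by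
      rw [mass_eq_sum]
      refine Finset.sum_nonneg fun t _ => ?_
      by_cases ht : 0 < t
      · rw [C.legPart_apply_of_pos l D ht]
        exact hD0 _
      · rw [C.legPart_apply_of_nonpos l D (not_lt.1 ht)]
    have := hD0 (.infty l)
    simp only [sub_zero] at h1
    linarith
  have hpk : ∀ e, f (C.edgePt e (C.peak d e)) =
      f (.vert (C.src e)) + n e * C.peak d e + ramp (C.peak d e) (C.edgePart e G) := fun e =>
    hform.1 e _ ⟨h.peak_nonneg e, h.peak_le e⟩
  have hend : ∀ e, f (.vert (C.tgt e)) =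
      f (.vert (C.src e)) + n e * C.len e + ramp (C.len e) (C.edgePart e G) := fun e => by
    rw [← hform.1 e _ ⟨(C.len_pos e).le, le_rfl⟩, edgePt_len]
  -- Among vertices and peaks choose a point with maximal `f`, and among these one closest to `S`.
  -- Peaks at an end of an edge are counted as vertices.
  obtain ⟨M, H, hvM, hvH, heM, hmax⟩ : ∃ M H : ℝ, (∀ v, f (.vert v) ≤ M) ∧
      (∀ v, f (.vert v) = M → H ≤ d v) ∧ (∀ e, f (C.edgePt e (C.peak d e)) ≤ M) ∧
      ((∃ v, f (.vert v) = M ∧ d v = H) ∨ ∃ e, 0 < C.peak d e ∧ C.peak d e < C.len e ∧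
        f (C.edgePt e (C.peak d e)) = M ∧ H = d (C.src e) + C.peak d e) := by
    let F : V ⊕ E → ℝ ×ₗ ℝ := fun x => match x with
      | .inl v => toLex (f (.vert v), -d v)
      | .inr e => toLex (f (C.edgePt e (C.peak d e)), -(d (C.src e) + C.peak d e))
    have : Nonempty (V ⊕ E) := ⟨.inl C.root⟩
    obtain ⟨x, hx⟩ := Finite.exists_max F
    obtain ⟨⟨M, H'⟩, hMH⟩ : ∃ y, F x = toLex y := ⟨ofLex (F x), rfl⟩
    rw [hMH] at hx
    have hle : ∀ y, F y ≤ toLex (M, H') := hx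
    have hv := fun v => Prod.Lex.toLex_le_toLex.1 (hle (.inl v))
    have he := fun e => Prod.Lex.toLex_le_toLex.1 (hle (.inr e))
    refine ⟨M, -H', fun v => ?_, fun v hvM => ?_, fun e => ?_, ?_⟩
    · rcases hv v with h | h
      · exact le_of_lt h
      · exact h.1.le
    · rcases hv v with h | h
      · exact absurd hvM (ne_of_lt h)
      · have := h.2
        simp only at this
        linarith
    · rcases he e with h | h
      · exact le_of_lt h
      · exact h.1.le
    · rcases x with v | e
      · have := toLex.injective hMH
        simp only [Prod.mk.injEq] at this
        exact Or.inl ⟨v, this.1, by linarith [this.2]⟩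
      · have := toLex.injective hMH
        simp only [Prod.mk.injEq] at this
        rcases eq_or_lt_of_le (h.peak_nonneg e) with h0 | h0
        · rw [← h0, edgePt_zero] at this
          exact Or.inl ⟨_, this.1, by linarith [this.2]⟩
        · rcases eq_or_lt_of_le (h.peak_le e) with h1 | h1
          · rw [h1, edgePt_len] at this
            refine Or.inl ⟨_, this.1, ?_⟩
            rw [peak_eq_len_iff.1 h1]
            linarith [this.2]
          · exact Or.inr ⟨e, h0, h1, this.1, by linarith [this.2]⟩
  rcases hmax with ⟨v, hv, hvd⟩ | ⟨e, h0, h1, he, hH⟩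
  · have hlow : ∀ w, d w < d v → f (.vert w) < M := fun w hw =>
      lt_of_le_of_ne (hvM w) fun heq => by linarith [hvH w heq]
    -- At a maximal vertex all outward slopes are nonpositive. Along an incoming edge the other end
    -- is closer to `S`, hence strictly lower, so by integrality the slope is at most `-1`. Summing,
    -- `G` at `v` is at most minus the number of incoming edges, which makes `D` negative at `v`.
    have hsrc : ∀ e, C.src e = v → n e ≤ -C.srcIn 0 d e := by
      intro e he
      have hl := C.len_pos e
      by_cases h0 : C.peak d e = 0
      · have hfw : f (.vert (C.tgt e)) < M := hlow _ (by
          rw [← he, peak_eq_zero_iff.1 h0]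
          linarith)
        have hr := ramp_nonneg (t := C.len e) fun u _ => hpos' e (Or.inl h0) u
        have := hend e
        rw [he, hv] at this
        have hn : (n e : ℝ) < 0 := by
          by_contra hcon
          have := mul_nonneg (not_lt.1 hcon) hl.le
          linarith
        have hn' : n e < 0 := by exact_mod_cast hn
        have : C.srcIn 0 d e = 1 := by simp [srcIn, h0]
        omega
      · have hp := lt_of_le_of_ne (h.peak_nonneg e) (Ne.symm h0)
        have hr := ramp_nonneg (t := C.peak d e) fun u hu => hpos e u (ne_of_lt hu)
        have := hpk e
        rw [he, hv] at this
        have hn : (n e : ℝ) ≤ 0 := by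
          by_contra hcon
          have := mul_pos (not_le.1 hcon) hp
          linarith [heM e]
        have hn' : n e ≤ 0 := by exact_mod_cast hn
        have : C.srcIn 0 d e = 0 := by simp [srcIn, h0]
        omega
    have htgt : ∀ e, C.tgt e = v → -(n e + mass (C.edgePart e G)) ≤ -C.tgtIn 0 d e := by
      intro e he
      have hl := C.len_pos e
      have hfv := hend e
      rw [he, hv] at hfv
      by_cases h0 : C.peak d e = C.len e
      · have hfw : f (.vert (C.src e)) < M := hlow _ (by
          rw [← he, peak_eq_len_iff.1 h0]
          linarith)
        have hr := ramp_sub_le_mass (s := 0) hl.le fun u _ => hpos' e (Or.inr h0) u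
        rw [ramp_eq_zero (C.edgePart_zero G e), sub_zero, sub_zero] at hr
        have hn : (0 : ℝ) < n e + mass (C.edgePart e G) := by
          by_contra hcon
          have := mul_nonneg (sub_nonneg.2 (not_lt.1 hcon)) hl.le
          linarith
        have hn' : 0 < n e + mass (C.edgePart e G) := by exact_mod_cast hn
        have : C.tgtIn 0 d e = 1 := by simp [tgtIn, h0]
        omega
      · have hp := sub_pos.2 (lt_of_le_of_ne (h.peak_le e) h0)
        have hr := ramp_sub_le_mass (h.peak_le e) fun u hu => hpos e u (ne_of_gt hu)
        have := hpk e
        have hn : (0 : ℝ) ≤ n e + mass (C.edgePart e G) := by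
          by_contra hcon
          have := mul_pos_of_neg_of_neg (not_le.1 hcon) (neg_neg_of_pos hp)
          linarith [heM e]
        have hn' : 0 ≤ n e + mass (C.edgePart e G) := by exact_mod_cast hn
        have : C.tgtIn 0 d e = 0 := by simp [tgtIn, h0]
        omega
    have h1 : G (.fin (.vert v)) = _ := hflow.1 v
    have h2 : G (.fin (.vert v)) = _ := Finsupp.sub_apply _ _ _
    rw [inDiv_vert] at h2
    have e1 := Finset.sum_le_sum (s := Finset.univ.filter fun e => C.src e = v)
      fun e he => hsrc e (Finset.mem_filter.1 he).2
    have e2 := Finset.sum_le_sum (s := Finset.univ.filter fun e => C.tgt e = v)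
      fun e he => htgt e (Finset.mem_filter.1 he).2
    have e3 := Finset.sum_nonpos (s := Finset.univ.filter fun l => C.base l = v) fun l _ => hm l
    rw [Finset.sum_neg_distrib] at e1
    rw [Finset.sum_neg_distrib, Finset.sum_neg_distrib] at e2
    linarith [hD0 (.fin (.vert v))]
  -- At an interior peak both ends of the edge are closer to `S`, hence strictly lower. Convexity
  -- forces a positive slope before the peak and a negative one after it, so `G` is at most `-2`
  -- there, although `inDiv` subtracts only 1.
  · have hsrc : f (.vert (C.src e)) < M :=
      lt_of_le_of_ne (hvM _) fun heq => by linarith [hvH _ heq]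
    have htgt : f (.vert (C.tgt e)) < M := by
      refine lt_of_le_of_ne (hvM _) fun heq => ?_
      have := hvH _ heq
      have hp : C.peak d e = (d (C.tgt e) - d (C.src e) + C.len e) / 2 := rfl
      linarith
    have hl := ramp_le_massLT (t := C.peak d e) (C.edgePart_zero G e)
      fun u hu => hpos e u (ne_of_lt hu)
    have hr := massLE_le_ramp_sub (h.peak_le e) fun u hu => hpos e u (ne_of_gt hu)
    have hfp := hpk e
    have hft := hend e
    rw [he] at hfp
    have n1 : (0 : ℝ) < n e + massLT (C.peak d e) (C.edgePart e G) := by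
      by_contra hcon
      have := mul_nonneg (sub_nonneg.2 (not_lt.1 hcon)) h0.le
      linarith
    have n2 : (n e : ℝ) + massLE (C.peak d e) (C.edgePart e G) < 0 := by
      by_contra hcon
      have := mul_nonneg (not_lt.1 hcon) (sub_pos.2 h1).le
      linarith
    have n1' : 0 < n e + massLT (C.peak d e) (C.edgePart e G) := by exact_mod_cast n1
    have n2' : n e + massLE (C.peak d e) (C.edgePart e G) < 0 := by exact_mod_cast n2
    have h3 := massLE_sub_massLT (C.peak d e) (C.edgePart e G)
    have h4 := hmid e _ ⟨h0, h1⟩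
    have h5 : C.midIn 0 d e (C.peak d e) = 1 := by simp [midIn, h0, h1]
    omega

end TropicalCurve

/-! ### Comparison with the gradient flow of the distance -/

namespace TropicalCurve

variable {V E L : Type*} {C : TropicalCurve V E L}

theorem HasSlope.iff_eq {f : C.FinPoint → ℝ} {p : C.Point} {b : Dir E L} {k j : ℤ}
    (h : C.HasSlope f p b k) : C.HasSlope f p b j ↔ k = j :=
  ⟨fun h' => h.unique h', fun h' => h' ▸ h⟩

variable [Fintype E]

/-! ### The distance to the support of a cycle -/

variable (C) in
open Classical in
/-- The extension of a distance function on the vertices to the curve. -/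
noncomputable def distPt (c : C.H1 ℤ) (d : V → ℝ) : C.FinPoint → ℝ
  | .vert v => d v
  | .edge e t _ _ => if (c : E → ℤ) e = 0 then min (d (C.src e) + t) (d (C.tgt e) + C.len e - t)
      else 0
  | .leg l t _ => d (C.base l) + t

variable {c : C.H1 ℤ} {S : Set V} {d : V → ℝ}

theorem distPt_legPt (l : L) {t : ℝ} (ht : 0 ≤ t) :
    C.distPt c d (C.legPt l t) = d (C.base l) + t := by
  rcases eq_or_lt_of_le ht with rfl | h0
  · rw [legPt_zero, distPt, add_zero]
  · rw [C.legPt_of_pos h0, distPt]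

theorem IsOrientation.distPt_edgePt_of_eq_zero (h : C.IsOrientation c S d) {e : E}
    (he : (c : E → ℤ) e = 0) {t : ℝ} (ht : t ∈ Set.Icc 0 (C.len e)) :
    C.distPt c d (C.edgePt e t) = min (d (C.src e) + t) (d (C.tgt e) + C.len e - t) := by
  have hl := abs_sub_le_iff.1 (h.lip e)
  rcases eq_or_lt_of_le ht.1 with rfl | h0
  · rw [edgePt_zero, distPt, add_zero, sub_zero, min_eq_left (by linarith)]
  rcases eq_or_lt_of_le ht.2 with rfl | h1
  · rw [edgePt_len, distPt, add_sub_cancel_right, min_eq_right (by linarith)]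
  · rw [C.edgePt_of_mem h0 h1, distPt, if_pos he]

theorem IsOrientation.distPt_edgePt_of_ne_zero (h : C.IsOrientation c S d) {e : E}
    (he : (c : E → ℤ) e ≠ 0) {t : ℝ} (ht : t ∈ Set.Icc 0 (C.len e)) :
    C.distPt c d (C.edgePt e t) = 0 := by
  rcases eq_or_lt_of_le ht.1 with rfl | h0
  · rw [edgePt_zero, distPt, h.zero _ (h.supp e he).1]
  rcases eq_or_lt_of_le ht.2 with rfl | h1
  · rw [edgePt_len, distPt, h.zero _ (h.supp e he).2]
  · rw [C.edgePt_of_mem h0 h1, distPt, if_neg he]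

/-- The extended function grows by at most the length on each segment: it is a minimum of two
functions of slope `±1` off the support, and zero on the support. -/
theorem IsOrientation.distPt_le_of_isPath (h : C.IsOrientation c S d) {p q : C.FinPoint} {r : ℝ}
    {x : C.FormDual} (hp : C.IsPath p q r x) : C.distPt c d q ≤ C.distPt c d p + r := by
  induction hp with
  | nil => simp
  | edge e s t hs ht _ ih =>
    refine le_trans (b := C.distPt c d (C.edgePt e s) + |t - s|) ?_ (by linarith)
    by_cases he : (c : E → ℤ) e = 0
    · rw [h.distPt_edgePt_of_eq_zero he hs, h.distPt_edgePt_of_eq_zero he ht]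
      have h1 := le_abs_self (t - s)
      have h2 := neg_abs_le (t - s)
      rw [← min_add_add_right]
      exact min_le_min (by linarith) (by linarith)
    · rw [h.distPt_edgePt_of_ne_zero he hs, h.distPt_edgePt_of_ne_zero he ht, zero_add]
      exact abs_nonneg _
  | leg l s t hs ht _ ih =>
    refine le_trans (b := C.distPt c d (C.legPt l s) + |t - s|) ?_ (by linarith)
    rw [distPt_legPt l hs, distPt_legPt l ht]
    linarith [le_abs_self (t - s)]

/-- Following tight edges back to `S` attains the lower bound; the hypothesis `hS` places the
vertices of `S` on the support. -/
theorem IsOrientation.exists_isPath [Finite V] (h : C.IsOrientation c S d)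
    (hS : ∀ v ∈ S, ∃ e, (c : E → ℤ) e ≠ 0 ∧ (C.src e = v ∨ C.tgt e = v)) (p : C.FinPoint) :
    ∃ q ∈ C.cycleSupport c, ∃ x, C.IsPath q p (C.distPt c d p) x := by
  have hvert : ∀ v, ∃ q ∈ C.cycleSupport c, ∃ x, C.IsPath q (.vert v) (d v) x := by
    refine h.toIsDist.induction (fun v hv => ?_) (fun e _ hd ih => ?_) (fun e _ hd ih => ?_)
    · rw [h.zero v hv]
      refine ⟨_, ?_, _, .nil⟩
      obtain ⟨e, hne, rfl | rfl⟩ := hS v hv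
      · exact ⟨e, hne, 0, ⟨le_rfl, (C.len_pos e).le⟩, (C.edgePt_zero e).symm⟩
      · exact ⟨e, hne, C.len e, ⟨(C.len_pos e).le, le_rfl⟩, (C.edgePt_len e).symm⟩
    · obtain ⟨q, hq, x, hx⟩ := ih
      rw [← edgePt_len] at hx
      have := IsPath.edge e _ 0 ⟨(C.len_pos e).le, le_rfl⟩ ⟨le_rfl, (C.len_pos e).le⟩ hx
      rw [edgePt_zero, zero_sub, abs_neg, abs_of_pos (C.len_pos e), ← hd] at this
      exact ⟨q, hq, _, this⟩
    · obtain ⟨q, hq, x, hx⟩ := ih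
      rw [← edgePt_zero] at hx
      have := IsPath.edge e _ (C.len e) ⟨le_rfl, (C.len_pos e).le⟩ ⟨(C.len_pos e).le, le_rfl⟩ hx
      rw [edgePt_len, sub_zero, abs_of_pos (C.len_pos e), ← hd] at this
      exact ⟨q, hq, _, this⟩
  rcases p with v | ⟨e, t, h0, h1⟩ | ⟨l, t, h0⟩
  · exact hvert v
  · have ht : t ∈ Set.Icc 0 (C.len e) := ⟨h0.le, h1.le⟩
    by_cases he : (c : E → ℤ) e = 0
    · rw [distPt, if_pos he, ← C.edgePt_of_mem h0 h1]
      rcases le_total (d (C.src e) + t) (d (C.tgt e) + C.len e - t) with hle | hle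
      · obtain ⟨q, hq, x, hx⟩ := hvert (C.src e)
        rw [← edgePt_zero] at hx
        have := IsPath.edge e _ t ⟨le_rfl, (C.len_pos e).le⟩ ht hx
        rw [sub_zero, abs_of_pos h0] at this
        rw [min_eq_left hle]
        exact ⟨q, hq, _, this⟩
      · obtain ⟨q, hq, x, hx⟩ := hvert (C.tgt e)
        rw [← edgePt_len] at hx
        have := IsPath.edge e _ t ⟨(C.len_pos e).le, le_rfl⟩ ht hx
        rw [abs_sub_comm, abs_of_pos (sub_pos.2 h1), ← add_sub_assoc] at this
        rw [min_eq_right hle]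
        exact ⟨q, hq, _, this⟩
    · rw [distPt, if_neg he]
      exact ⟨_, ⟨e, he, t, ht, (C.edgePt_of_mem h0 h1).symm⟩, _, .nil⟩
  · obtain ⟨q, hq, x, hx⟩ := hvert (C.base l)
    rw [← legPt_zero] at hx
    have := IsPath.leg l _ t le_rfl h0.le hx
    rw [sub_zero, abs_of_pos h0, C.legPt_of_pos h0] at this
    exact ⟨q, hq, _, this⟩

theorem IsOrientation.distTo_eq [Finite V] (h : C.IsOrientation c S d)
    (hS : ∀ v ∈ S, ∃ e, (c : E → ℤ) e ≠ 0 ∧ (C.src e = v ∨ C.tgt e = v)) :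
    C.distTo (C.cycleSupport c) = C.distPt c d := by
  ext p
  refine IsLeast.csInf_eq ⟨h.exists_isPath hS p, ?_⟩
  rintro r ⟨q, ⟨e, he, t, ht, rfl⟩, x, hx⟩
  have := h.distPt_le_of_isPath hx
  rwa [h.distPt_edgePt_of_ne_zero he ht, zero_add] at this

/-! ### Incoming and outgoing directions -/

variable (C) in
/-- The direction is opposite to the orientation given by `c` and `d`. -/
def ComesIn (c : C.H1 ℤ) (d : V → ℝ) : C.Point → Dir E L → Prop
  | .fin p, (.inl e, true) =>
    (c : E → ℤ) e = 0 ∧ C.peak d e ≤ C.coord p (.inl e, true) ∨ (c : E → ℤ) e = -1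
  | .fin p, (.inl e, false) =>
    (c : E → ℤ) e = 0 ∧ C.coord p (.inl e, false) ≤ C.peak d e ∨ (c : E → ℤ) e = 1
  | _, (.inr _, b) => b = false
  | _, _ => False

open Classical in
theorem IsOrientation.hasSlope_true (h : C.IsOrientation c S d) {e : E}
    (he : (c : E → ℤ) e = 0) {p : C.FinPoint} (hp : p = C.edgePt e (C.coord p (.inl e, true)))
    (h0 : 0 ≤ C.coord p (.inl e, true)) (h1 : C.coord p (.inl e, true) < C.len e) :
    C.HasSlope (C.distPt c d) (.fin p) (.inl e, true)
      (if C.peak d e ≤ C.coord p (.inl e, true) then -1 else 1) := by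
  simp only [HasSlope, move]
  generalize C.coord p (.inl e, true) = t at *
  subst hp
  have hpk : C.peak d e = (d (C.tgt e) - d (C.src e) + C.len e) / 2 := rfl
  split_ifs with hle
  · filter_upwards [Ioo_mem_nhdsGT (sub_pos.2 h1)] with s hs
    rw [h.distPt_edgePt_of_eq_zero he ⟨by linarith [hs.1], by linarith [hs.2]⟩,
      h.distPt_edgePt_of_eq_zero he ⟨h0, h1.le⟩, min_eq_right (by linarith [hs.1]),
      min_eq_right (by linarith)]
    push_cast
    ring
  · filter_upwards [Ioo_mem_nhdsGT (sub_pos.2 h1), Ioo_mem_nhdsGT (sub_pos.2 (not_le.1 hle))]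
      with s hs hs'
    rw [h.distPt_edgePt_of_eq_zero he ⟨by linarith [hs.1], by linarith [hs.2]⟩,
      h.distPt_edgePt_of_eq_zero he ⟨h0, h1.le⟩, min_eq_left (by linarith [hs'.2]),
      min_eq_left (by linarith [not_le.1 hle])]
    push_cast
    ring

open Classical in
theorem IsOrientation.hasSlope_false (h : C.IsOrientation c S d) {e : E}
    (he : (c : E → ℤ) e = 0) {p : C.FinPoint} (hp : p = C.edgePt e (C.coord p (.inl e, false)))
    (h0 : 0 < C.coord p (.inl e, false)) (h1 : C.coord p (.inl e, false) ≤ C.len e) :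
    C.HasSlope (C.distPt c d) (.fin p) (.inl e, false)
      (if C.coord p (.inl e, false) ≤ C.peak d e then -1 else 1) := by
  simp only [HasSlope, move]
  generalize C.coord p (.inl e, false) = t at *
  subst hp
  have hpk : C.peak d e = (d (C.tgt e) - d (C.src e) + C.len e) / 2 := rfl
  split_ifs with hle
  · filter_upwards [Ioo_mem_nhdsGT h0] with s hs
    rw [h.distPt_edgePt_of_eq_zero he ⟨by linarith [hs.2], by linarith [hs.1]⟩,
      h.distPt_edgePt_of_eq_zero he ⟨h0.le, h1⟩, min_eq_left (by linarith [hs.1]),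
      min_eq_left (by linarith)]
    push_cast
    ring
  · filter_upwards [Ioo_mem_nhdsGT h0, Ioo_mem_nhdsGT (sub_pos.2 (not_le.1 hle))]
      with s hs hs'
    rw [h.distPt_edgePt_of_eq_zero he ⟨by linarith [hs.2], by linarith [hs.1]⟩,
      h.distPt_edgePt_of_eq_zero he ⟨h0.le, h1⟩, min_eq_right (by linarith [hs'.2]),
      min_eq_right (by linarith [not_le.1 hle])]
    push_cast
    ring

theorem hasSlope_leg_true {p : C.FinPoint} {l : L} (hp : p = C.legPt l (C.coord p (.inr l, true)))
    (h0 : 0 ≤ C.coord p (.inr l, true)) :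
    C.HasSlope (C.distPt c d) (.fin p) (.inr l, true) 1 := by
  simp only [HasSlope, move]
  generalize C.coord p (.inr l, true) = t at *
  subst hp
  filter_upwards [self_mem_nhdsWithin] with s hs
  have hs' : (0 : ℝ) < s := hs
  rw [distPt_legPt l h0, distPt_legPt l (by linarith)]
  push_cast
  ring

theorem hasSlope_leg_false {p : C.FinPoint} {l : L} (hp : p = C.legPt l (C.coord p (.inr l, false)))
    (h0 : 0 < C.coord p (.inr l, false)) :
    C.HasSlope (C.distPt c d) (.fin p) (.inr l, false) (-1) := by
  simp only [HasSlope, move]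
  generalize C.coord p (.inr l, false) = t at *
  subst hp
  filter_upwards [Ioo_mem_nhdsGT h0] with s hs
  rw [distPt_legPt l h0.le, distPt_legPt l (by linarith [hs.2])]
  push_cast
  ring

theorem hasSlope_infty (l : L) : C.HasSlope (C.distPt c d) (.infty l) (.inr l, false) (-1) := by
  refine ⟨d (C.base l), ?_⟩
  filter_upwards [eventually_ge_atTop (0 : ℝ)] with t ht
  rw [distPt_legPt l ht]
  push_cast
  ring

/-- Off the cycle the distance has outward slope `1` or `-1` in every direction, and slopes are
unique, so each direction is exactly one of incoming and outgoing. At a peak both directions are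
incoming, whence the weak inequalities in `ComesIn`. -/
theorem IsOrientation.isIn_iff [Finite V] (h : C.IsOrientation c S d)
    (hS : ∀ v ∈ S, ∃ e, (c : E → ℤ) e ≠ 0 ∧ (C.src e = v ∨ C.tgt e = v)) {p : C.Point}
    {b : Dir E L} (hb : C.Emanates p b) :
    (C.IsIn c p b ↔ C.ComesIn c d p b) ∧ (C.IsOut c p b ↔ ¬ C.ComesIn c d p b) := by
  classical
  have htrue : ∀ (p : C.FinPoint) e, p = C.edgePt e (C.coord p (.inl e, true)) →
      0 ≤ C.coord p (.inl e, true) → C.coord p (.inl e, true) < C.len e →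
      (C.IsIn c (.fin p) (.inl e, true) ↔ C.ComesIn c d (.fin p) (.inl e, true)) ∧
      (C.IsOut c (.fin p) (.inl e, true) ↔ ¬ C.ComesIn c d (.fin p) (.inl e, true)) := by
    intro p e hp h0 h1
    simp only [IsIn, IsOut, ComesIn, h.distTo_eq hS]
    rcases h.cases e with he | he | he
    · simp [he]
    · rw [(h.hasSlope_true he hp h0 h1).iff_eq, (h.hasSlope_true he hp h0 h1).iff_eq]
      by_cases hle : C.peak d e ≤ C.coord p (.inl e, true) <;> simp [he, hle]
    · simp [he]
  have hfalse : ∀ (p : C.FinPoint) e, p = C.edgePt e (C.coord p (.inl e, false)) →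
      0 < C.coord p (.inl e, false) → C.coord p (.inl e, false) ≤ C.len e →
      (C.IsIn c (.fin p) (.inl e, false) ↔ C.ComesIn c d (.fin p) (.inl e, false)) ∧
      (C.IsOut c (.fin p) (.inl e, false) ↔ ¬ C.ComesIn c d (.fin p) (.inl e, false)) := by
    intro p e hp h0 h1
    simp only [IsIn, IsOut, ComesIn, h.distTo_eq hS]
    rcases h.cases e with he | he | he
    · simp [he]
    · rw [(h.hasSlope_false he hp h0 h1).iff_eq, (h.hasSlope_false he hp h0 h1).iff_eq]
      by_cases hle : C.coord p (.inl e, false) ≤ C.peak d e <;> simp [he, hle]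
    · simp [he]
  have hlt : ∀ (p : C.FinPoint) l, p = C.legPt l (C.coord p (.inr l, true)) →
      0 ≤ C.coord p (.inr l, true) →
      (C.IsIn c (.fin p) (.inr l, true) ↔ C.ComesIn c d (.fin p) (.inr l, true)) ∧
      (C.IsOut c (.fin p) (.inr l, true) ↔ ¬ C.ComesIn c d (.fin p) (.inr l, true)) := by
    intro p l hp h0
    simp only [IsIn, IsOut, ComesIn, h.distTo_eq hS]
    rw [(hasSlope_leg_true hp h0).iff_eq, (hasSlope_leg_true hp h0).iff_eq]
    simp
  have hlf : ∀ (p : C.FinPoint) l, p = C.legPt l (C.coord p (.inr l, false)) →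
      0 < C.coord p (.inr l, false) →
      (C.IsIn c (.fin p) (.inr l, false) ↔ C.ComesIn c d (.fin p) (.inr l, false)) ∧
      (C.IsOut c (.fin p) (.inr l, false) ↔ ¬ C.ComesIn c d (.fin p) (.inr l, false)) := by
    intro p l hp h0
    simp only [IsIn, IsOut, ComesIn, h.distTo_eq hS]
    rw [(hasSlope_leg_false hp h0).iff_eq, (hasSlope_leg_false hp h0).iff_eq]
    simp
  rcases p with (v | ⟨e, t, h0, h1⟩ | ⟨l, t, h0⟩) | l
  · rcases b with ⟨e | l, _ | _⟩
    · obtain rfl : C.tgt e = v := hb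
      exact hfalse _ e (C.edgePt_len e).symm (C.len_pos e) le_rfl
    · obtain rfl : C.src e = v := hb
      exact htrue _ e (C.edgePt_zero e).symm le_rfl (C.len_pos e)
    · exact hb.elim
    · obtain rfl : C.base l = v := hb
      exact hlt _ l (C.legPt_zero l).symm le_rfl
  · rcases b with ⟨b, _ | _⟩
    · obtain rfl : b = .inl e := hb
      exact hfalse _ e (C.edgePt_of_mem h0 h1).symm h0 h1.le
    · obtain rfl : b = .inl e := hb
      exact htrue _ e (C.edgePt_of_mem h0 h1).symm h0.le h1
  · rcases b with ⟨b, _ | _⟩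
    · obtain rfl : b = .inr l := hb
      exact hlf _ l (C.legPt_of_pos h0).symm h0
    · obtain rfl : b = .inr l := hb
      exact hlt _ l (C.legPt_of_pos h0).symm h0.le
  · obtain rfl : b = (.inr l, false) := hb
    simp only [IsIn, IsOut, ComesIn, h.distTo_eq hS]
    rw [(hasSlope_infty l).iff_eq, (hasSlope_infty l).iff_eq]
    simp

/-- The divisor `inDiv` depends only on the support of the cycle. -/
theorem IsOrientation.inDiv_eq [Fintype V] {c' : C.H1 ℤ} (h : C.IsOrientation c S d)
    (h' : C.IsOrientation c' S d) (hcc : ∀ e, (c : E → ℤ) e = 0 ↔ (c' : E → ℤ) e = 0) :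
    C.inDiv c d = C.inDiv c' d := by
  classical
  have hmid : ∀ e, C.midIn c d e = C.midIn c' d e := fun e => by simp only [midIn, hcc e]
  ext p
  rcases p with (v | ⟨e, t, h0, h1⟩ | ⟨l, t, h0⟩) | l
  -- By balance, half of the support edges at `v` come in. So twice the incoming count has an
  -- expression that involves only the support.
  · have key : ∀ {c : C.H1 ℤ}, C.IsOrientation c S d →
        2 * C.inDiv c d (.fin (.vert v)) + 2 =
          ∑ e with C.src e = v, (if (c : E → ℤ) e = 0 then (if C.peak d e = 0 then 2 else 0) else 1)
          + ∑ e with C.tgt e = v,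
            (if (c : E → ℤ) e = 0 then (if C.peak d e = C.len e then 2 else 0) else 1) := by
      intro c h
      have h1 : ∀ e, (if (c : E → ℤ) e = 0 then (if C.peak d e = 0 then 2 else 0) else 1) =
          2 * C.srcIn c d e + (c : E → ℤ) e := by
        intro e
        rw [srcIn]
        rcases h.cases e with he | he | he <;> simp [he]
      have h2 : ∀ e, (if (c : E → ℤ) e = 0 then (if C.peak d e = C.len e then 2 else 0) else 1) =
          2 * C.tgtIn c d e - (c : E → ℤ) e := by
        intro e
        rw [tgtIn]
        rcases h.cases e with he | he | he <;> simp [he]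
      have hc : C.boundary ℤ c = 0 := c.2
      have hb := congrFun hc v
      simp only [boundary, LinearMap.coe_mk, AddHom.coe_mk, Pi.zero_apply] at hb
      simp only [h1, h2, Finset.sum_add_distrib, Finset.sum_sub_distrib, ← Finset.mul_sum]
      rw [inDiv_vert]
      linarith
    have e1 := key h
    have e2 := key h'
    simp only [hcc] at e1
    linarith
  · rw [← C.edgePart_apply_of_mem e _ h0 h1, ← C.edgePart_apply_of_mem e _ h0 h1, edgePart_inDiv,
      edgePart_inDiv, hmid]
  · rw [← C.legPart_apply_of_pos l _ h0, ← C.legPart_apply_of_pos l _ h0, legPart_inDiv,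
      legPart_inDiv]
  · rw [inDiv_infty, inDiv_infty]

variable [Fintype V] [Fintype L]

theorem IsOrientation.valIn_eq (h : C.IsOrientation c S d)
    (hS : ∀ v ∈ S, ∃ e, (c : E → ℤ) e ≠ 0 ∧ (C.src e = v ∨ C.tgt e = v)) (p : C.Point) :
    (C.valIn c p : ℤ) - 1 = C.inDiv c d p := by
  classical
  have hsum : (C.valIn c p : ℤ) = ∑ b ∈ C.outDirs p, if C.ComesIn c d p b then 1 else 0 := by
    rw [valIn, Finset.card_filter]
    push_cast
    refine Finset.sum_congr rfl fun b hb => ?_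
    simp only [(h.isIn_iff hS (C.mem_outDirs.1 hb)).1]
  rw [hsum]
  rcases p with (v | ⟨e, t, h0, h1⟩ | ⟨l, t, h0⟩) | l
  · rw [sum_outDirs_vert, inDiv_vert]
    simp only [ComesIn, coord, srcIn, tgtIn, (h.peak_nonneg _).ge_iff_eq,
      (h.peak_le _).ge_iff_eq', reduceCtorEq, if_false, Finset.sum_const_zero, add_zero]
    congr! 5 <;> exact and_congr_right fun _ => eq_comm
  · rw [sum_outDirs_edge, ← C.edgePart_apply_of_mem e _ h0 h1, edgePart_inDiv, midIn]
    simp only [ComesIn, coord]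
    rcases h.cases e with he | he | he
    · simp [he]
    · simp only [he]
      rcases lt_trichotomy t (C.peak d e) with ht | ht | ht
      · simp only [ht.not_ge, ht.le]
        split_ifs <;> simp_all [ht.ne']
      · subst ht
        simp [h0, h1]
      · simp only [ht.not_ge, ht.le]
        split_ifs <;> simp_all [ht.ne]
    · simp [he]
  · rw [sum_outDirs_leg, ← C.legPart_apply_of_pos l _ h0, legPart_inDiv]
    simp [ComesIn]
  · rw [sum_outDirs_infty, inDiv_infty]
    simp [ComesIn]

theorem IsOrientation.valOut_add_valIn (h : C.IsOrientation c S d)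
    (hS : ∀ v ∈ S, ∃ e, (c : E → ℤ) e ≠ 0 ∧ (C.src e = v ∨ C.tgt e = v)) (p : C.Point) :
    C.valIn c p + C.valOut c p = C.val p := by
  classical
  rw [valIn, valOut, val, Finset.filter_congr fun b hb => (h.isIn_iff hS (C.mem_outDirs.1 hb)).1,
    Finset.filter_congr fun b hb => (h.isIn_iff hS (C.mem_outDirs.1 hb)).2,
    Finset.card_filter_add_card_filter_not]

/-- Incoming and outgoing valences add up to the valence, so the two divisors add up to the
canonical one. -/
theorem IsOrientation.valOut_eq (h : C.IsOrientation c S d)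
    (hS : ∀ v ∈ S, ∃ e, (c : E → ℤ) e ≠ 0 ∧ (C.src e = v ∨ C.tgt e = v)) (p : C.Point) :
    (C.valOut c p : ℤ) - 1 = (C.canonical - C.inDiv c d) p := by
  have h1 : C.canonical p = (C.val p : ℤ) - 2 := rfl
  rw [Finsupp.sub_apply, h1, ← h.valIn_eq hS, ← h.valOut_add_valIn hS p]
  push_cast
  ring

end TropicalCurve

/-! ### Theta along shortest paths from a vertex -/

namespace TropicalCurve

variable {V E L : Type*} {C : TropicalCurve V E L} [Fintype E]

/-! ### The theta divisor pulled back without translation -/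

variable (C) in
open Classical in
/-- The chain `k` is the chain of a shortest path from `q` to `v`, where `d` is the distance
to `q`. -/
structure IsGeodesic (d : V → ℝ) (q v : V) (k : E → ℤ) : Prop where
  boundary : C.boundary ℤ k = Pi.single v 1 - Pi.single q 1
  cases : ∀ e, k e = 0 ∨ (k e = 1 ∧ C.peak d e = C.len e ∧ d (C.tgt e) ≤ d v) ∨
    (k e = -1 ∧ C.peak d e = 0 ∧ d (C.src e) ≤ d v)

variable {d : V → ℝ} {q v : V} {k : E → ℤ}

/-- Append the tight edge that ends at `v` to a shortest path to its other end. That edge is unused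
so far, because the path stays at distances at most that of the other end; so the coefficients stay
in `{0, 1, -1}`. -/
theorem IsDist.exists_isGeodesic [Finite V] (h : C.IsDist {q} d) (v : V) :
    ∃ k, C.IsGeodesic d q v k := by
  classical
  revert v
  refine h.induction (fun v hv => ?_) (fun e _ hd ih => ?_) (fun e _ hd ih => ?_)
  · obtain rfl : v = q := hv
    exact ⟨0, by simp, fun e => Or.inl rfl⟩
  · have hl := C.len_pos e
    have hp := peak_eq_zero_iff.2 hd
    obtain ⟨k, hb, hk⟩ := ih
    refine ⟨k - Pi.single e 1, ?_, fun e' => ?_⟩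
    · rw [map_sub, hb, boundary_single]
      abel
    · rcases eq_or_ne e' e with rfl | hne
      · have : k e' = 0 := by
          rcases hk e' with h | h | h
          · exact h
          · linarith [h.2.1]
          · linarith [h.2.2]
        exact Or.inr (Or.inr ⟨by simp [this], hp, le_rfl⟩)
      · rw [Pi.sub_apply, Pi.single_eq_of_ne hne, sub_zero]
        rcases hk e' with h | h | h
        · exact Or.inl h
        · exact Or.inr (Or.inl ⟨h.1, h.2.1, by linarith [h.2.2]⟩)
        · exact Or.inr (Or.inr ⟨h.1, h.2.1, by linarith [h.2.2]⟩)
  · have hl := C.len_pos e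
    have hp := peak_eq_len_iff.2 hd
    obtain ⟨k, hb, hk⟩ := ih
    refine ⟨k + Pi.single e 1, ?_, fun e' => ?_⟩
    · rw [map_add, hb, boundary_single]
      abel
    · rcases eq_or_ne e' e with rfl | hne
      · have : k e' = 0 := by
          rcases hk e' with h | h | h
          · exact h
          · linarith [h.2.2]
          · linarith [h.2.1]
        exact Or.inr (Or.inl ⟨by simp [this], hp, le_rfl⟩)
      · rw [Pi.add_apply, Pi.single_eq_of_ne hne, add_zero]
        rcases hk e' with h | h | h
        · exact Or.inl h
        · exact Or.inr (Or.inl ⟨h.1, h.2.1, by linarith [h.2.2]⟩)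
        · exact Or.inr (Or.inr ⟨h.1, h.2.1, by linarith [h.2.2]⟩)

theorem IsGeodesic.src_cases {e : E} (h : C.IsGeodesic d q (C.src e) k) :
    k e = 0 ∨ (k e = -1 ∧ C.peak d e = 0) := by
  have hl := C.len_pos e
  rcases h.cases e with h | h | h
  · exact Or.inl h
  · have := peak_eq_len_iff.1 h.2.1
    linarith [h.2.2]
  · exact Or.inr ⟨h.1, h.2.1⟩

theorem IsGeodesic.tgt_cases {e : E} (h : C.IsGeodesic d q (C.tgt e) k) :
    k e = 0 ∨ (k e = 1 ∧ C.peak d e = C.len e) := by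
  have hl := C.len_pos e
  rcases h.cases e with h | h | h
  · exact Or.inl h
  · exact Or.inr ⟨h.1, h.2.1⟩
  · have := peak_eq_zero_iff.1 h.2.1
    linarith [h.2.2]

variable (C) in
/-- The functional of integration along an integral chain. -/
noncomputable def chainInt (k : E → ℤ) : C.FormDual := C.ofEdges fun e => (k e : ℝ) * C.len e

/-- Shortest paths give another lift of the Abel-Jacobi map, at which theta can be evaluated edge by
edge. -/
theorem IsGeodesic.toJac_chainInt (h : C.IsGeodesic d q v k) :
    C.toJac (C.chainInt k) = C.toJac (C.refVert v - C.refVert q) := by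
  classical
  rw [toJac_eq_iff]
  refine ⟨⟨k - (C.chain v - C.chain q), ?_⟩, ?_⟩
  · rw [H1, LinearMap.mem_ker, map_sub, map_sub, h.boundary, boundary_chain, boundary_chain]
    abel
  · rw [cycleInt_eq_ofEdges, chainInt, refVert, refVert, ← map_sub C.ofEdges,
      ← map_sub C.ofEdges]
    congr 1
    ext e
    simp only [Pi.sub_apply]
    push_cast
    ring

theorem sum_mul_gradient [Fintype V] (c : C.H1 ℤ) (d : V → ℝ) :
    ∑ e, ((c : E → ℤ) e : ℝ) * (d (C.tgt e) - d (C.src e)) = 0 := by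
  have := LinearMap.congr_fun (C.ofEdges_gradient d) c
  rw [ofEdges_apply, LinearMap.zero_apply] at this
  rw [← this]
  exact Finset.sum_congr rfl fun e _ => mul_comm _ _

/-- A gradient pairs to zero with every cycle, so half the gradient of `d` may be added for free.
With this correction the maximum over cycles is bounded by independent estimates over integers on
the edges. -/
theorem theta_ofEdges_le [Fintype V] {w B : E → ℝ}
    (h : ∀ e, ∀ j : ℤ, j * w e - j ^ 2 * C.len e / 2 ≤
      B e + j * (d (C.tgt e) - d (C.src e)) / 2) : C.theta (C.ofEdges w) ≤ ∑ e, B e := by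
  refine C.theta_le fun c => ?_
  have h1 := Finset.sum_le_sum (s := Finset.univ) fun e _ => h e ((c : E → ℤ) e)
  rw [Finset.sum_add_distrib, ← Finset.sum_div, sum_mul_gradient, zero_div, add_zero] at h1
  refine le_trans (le_of_eq ?_) h1
  rw [Q_self, ofEdges_apply, Finset.sum_sub_distrib, Finset.sum_div]
  exact congrArg₂ _ (Finset.sum_congr rfl fun e _ => mul_comm _ _) rfl

theorem le_theta_ofEdges [Fintype V] {w B : E → ℝ} (c : C.H1 ℤ)
    (h : ∀ e, ((c : E → ℤ) e : ℝ) * w e - ((c : E → ℤ) e : ℝ) ^ 2 * C.len e / 2 =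
      B e + ((c : E → ℤ) e : ℝ) * (d (C.tgt e) - d (C.src e)) / 2) :
    ∑ e, B e ≤ C.theta (C.ofEdges w) := by
  have h1 := Finset.sum_congr (s₁ := Finset.univ) rfl fun e _ => h e
  rw [Finset.sum_add_distrib, ← Finset.sum_div, sum_mul_gradient, zero_div, add_zero] at h1
  refine le_trans (le_of_eq ?_) (C.le_theta _ c)
  rw [← h1, Q_self, ofEdges_apply, Finset.sum_sub_distrib, Finset.sum_div]
  exact congrArg₂ _ (Finset.sum_congr rfl fun e _ => mul_comm _ _) rfl

theorem theta_nonneg [Fintype V] (y : C.FormDual) : 0 ≤ C.theta y := by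
  have := C.le_theta y 0
  simpa [Q] using this

/-- Integrality is essential: the estimate rests on `j * (j + 1)` and `(j - 1) * (j - 2)` being
nonnegative for integers. -/
theorem int_mul_le (j : ℤ) {r s ℓ : ℝ} (hr : |r| ≤ ℓ) (hs : 0 ≤ s) (hrs : r ≤ s) :
    j * r ≤ s + ℓ * ((j : ℝ) ^ 2 - j) / 2 := by
  have hl : 0 ≤ ℓ := (abs_nonneg r).trans hr
  have hr' := abs_le.1 hr
  rcases le_or_gt j 0 with hj | hj
  · have h1 : (j : ℝ) ≤ 0 := by exact_mod_cast hj
    have h2 : (0 : ℝ) ≤ j * (j + 1) := by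
      rcases eq_or_lt_of_le hj with h | h
      · simp [h]
      · have : (j : ℝ) + 1 ≤ 0 := by exact_mod_cast h
        nlinarith
    nlinarith
  · have h1 : (0 : ℝ) ≤ j - 1 := by
      have : (1 : ℝ) ≤ j := by exact_mod_cast hj
      linarith
    have h2 : (0 : ℝ) ≤ (j - 1) * (j - 2) := by
      rcases eq_or_lt_of_le (show 1 ≤ j from hj) with h | h
      · simp [← h]
      · have : (2 : ℝ) ≤ j := by exact_mod_cast h
        nlinarith
    nlinarith

theorem IsGeodesic.edge_le (h : C.IsGeodesic d q v k) (hd : C.IsDist {q} d) (e : E) (j : ℤ) :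
    (j : ℝ) * ((k e : ℝ) * C.len e) - (j : ℝ) ^ 2 * C.len e / 2 ≤
      j * (d (C.tgt e) - d (C.src e)) / 2 := by
  have hl := C.len_pos e
  have hlip := hd.lip e
  rcases h.cases e with h | h | h
  · have h1 := int_mul_le (-j) (r := -C.peak d e) (s := 0) (ℓ := C.len e)
      (by rw [abs_neg, abs_of_nonneg (hd.peak_nonneg e)]; exact hd.peak_le e) le_rfl
      (by linarith [hd.peak_nonneg e])
    have h2 := int_mul_le j (r := -C.peak d e) (s := 0) (ℓ := C.len e)
      (by rw [abs_neg, abs_of_nonneg (hd.peak_nonneg e)]; exact hd.peak_le e) le_rfl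
      (by linarith [hd.peak_nonneg e])
    rw [h, peak] at *
    push_cast at *
    linarith
  · have h1 := int_mul_le j (r := 0) (s := 0) (ℓ := C.len e) (by simpa using hl.le) le_rfl le_rfl
    rw [h.1, peak_eq_len_iff.1 h.2.1]
    push_cast
    linarith
  · have h1 := int_mul_le (-j) (r := 0) (s := 0) (ℓ := C.len e) (by simpa using hl.le) le_rfl le_rfl
    rw [h.1, peak_eq_zero_iff.1 h.2.1]
    push_cast at *
    linarith

/-- Two shortest paths from `q` never cross an edge in opposite directions, since its peak would be
at both ends. So the difference of their chains attains equality in `edge_le` on every edge. -/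
theorem IsGeodesic.edge_eq {v' : V} {k' : E → ℤ} (h : C.IsGeodesic d q v k)
    (h' : C.IsGeodesic d q v' k') (e : E) :
    ((k e - k' e : ℤ) : ℝ) * ((k e : ℝ) * C.len e) - ((k e - k' e : ℤ) : ℝ) ^ 2 * C.len e / 2 =
      ((k e - k' e : ℤ) : ℝ) * (d (C.tgt e) - d (C.src e)) / 2 := by
  have hl := C.len_pos e
  rcases h.cases e with h | h | h <;> rcases h'.cases e with h' | h' | h'
  · simp [h, h']
  · rw [h, h'.1, peak_eq_len_iff.1 h'.2.1]
    push_cast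
    ring
  · rw [h, h'.1, peak_eq_zero_iff.1 h'.2.1]
    push_cast
    ring
  · rw [h.1, h', peak_eq_len_iff.1 h.2.1]
    push_cast
    ring
  · simp [h.1, h'.1]
  · linarith [h.2.1, h'.2.1]
  · rw [h.1, h', peak_eq_zero_iff.1 h.2.1]
    push_cast
    ring
  · linarith [h.2.1, h'.2.1]
  · simp [h.1, h'.1]

open Classical in
theorem chainInt_add_smul (e : E) (t : ℝ) : C.chainInt k + t • C.unitVec e =
    C.ofEdges ((fun e => (k e : ℝ) * C.len e) + Pi.single e t) := by
  rw [map_add, ofEdges_single, chainInt]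

open Classical in
theorem sum_single_eq (e : E) (s : ℝ) : ∑ e', (Pi.single e s : E → ℝ) e' = s := by
  simp

theorem IsGeodesic.theta_le [Fintype V] (h : C.IsGeodesic d q v k) (hd : C.IsDist {q} d) (e : E)
    {t s : ℝ} (hj : ∀ j : ℤ, (j : ℝ) * (k e * C.len e + t) - (j : ℝ) ^ 2 * C.len e / 2 ≤
      s + j * (d (C.tgt e) - d (C.src e)) / 2) :
    C.theta (C.chainInt k + t • C.unitVec e) ≤ s := by
  classical
  rw [chainInt_add_smul]
  refine (theta_ofEdges_le (d := d) (B := Pi.single e s) fun e' j => ?_).trans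
    (sum_single_eq e s).le
  rcases eq_or_ne e' e with rfl | hne
  · simpa using hj j
  · simpa [hne] using h.edge_le hd e' j

theorem IsGeodesic.le_theta [Fintype V] {v' : V} {k' : E → ℤ} (h : C.IsGeodesic d q v k)
    (h' : C.IsGeodesic d q v' k') (e : E) {t s : ℝ} (c : C.H1 ℤ)
    (hc : ∀ e' ≠ e, (c : E → ℤ) e' = k e' - k' e')
    (hj : ((c : E → ℤ) e : ℝ) * (k e * C.len e + t) - ((c : E → ℤ) e : ℝ) ^ 2 * C.len e / 2 =
      s + (c : E → ℤ) e * (d (C.tgt e) - d (C.src e)) / 2) :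
    s ≤ C.theta (C.chainInt k + t • C.unitVec e) := by
  classical
  rw [chainInt_add_smul]
  refine (sum_single_eq e s).ge.trans (le_theta_ofEdges (d := d) (B := Pi.single e s) c
    fun e' => ?_)
  rcases eq_or_ne e' e with rfl | hne
  · simpa using hj
  · rw [hc e' hne]
    simpa [hne] using h.edge_eq h' e'

/-- The theta function along an edge, seen from its source. -/
theorem IsGeodesic.theta_src [Fintype V] {e : E} (h : C.IsGeodesic d q (C.src e) k)
    (hd : C.IsDist {q} d) {t : ℝ} (ht : t ∈ Set.Icc 0 (C.len e)) :
    C.theta (C.chainInt k + t • C.unitVec e) = (1 + k e) * max (t - C.peak d e) 0 := by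
  classical
  have hp0 := hd.peak_nonneg e
  have hp1 := hd.peak_le e
  have hp : d (C.tgt e) - d (C.src e) = 2 * C.peak d e - C.len e := by
    rw [peak]
    ring
  rcases h.src_cases with hk | ⟨hk, hpk⟩
  · rw [hk, Int.cast_zero, add_zero, one_mul]
    refine le_antisymm (h.theta_le hd e fun j => ?_) (max_le ?_ (theta_nonneg _))
    · have := int_mul_le j (r := t - C.peak d e) (s := max (t - C.peak d e) 0) (ℓ := C.len e)
        (abs_le.2 ⟨by linarith [ht.1], by linarith [ht.2]⟩) (le_max_right _ _) (le_max_left _ _)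
      rw [hk, hp]
      push_cast
      linarith
    · rcases le_or_gt t (C.peak d e) with hle | hlt
      · exact le_trans (by linarith) (theta_nonneg _)
      -- The maximizing cycle: out along the shortest path to the source, across `e`, and back along
      -- the shortest path to the target. It beats the zero cycle exactly beyond the peak.
      · obtain ⟨k', h'⟩ := hd.exists_isGeodesic (C.tgt e)
        have hk' : k' e = 0 := by
          rcases h'.tgt_cases with h | h
          · exact h
          · linarith [ht.2, h.2]
        refine h.le_theta h' e ⟨k - k' + Pi.single e 1, ?_⟩ (fun e' hne => ?_) ?_
        · rw [H1, LinearMap.mem_ker, map_add, map_sub, h.boundary, h'.boundary, boundary_single]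
          abel
        · simp [hne]
        · rw [hp]
          simp [hk, hk']
          ring
  -- Here the shortest path to the source arrives through `e`. Moving along `e` retraces that path,
  -- and theta stays zero.
  · rw [hk, Int.cast_neg, Int.cast_one, add_neg_cancel, zero_mul]
    refine le_antisymm (h.theta_le hd e fun j => ?_) (theta_nonneg _)
    have := int_mul_le j (r := t - C.len e) (s := 0) (ℓ := C.len e)
      (abs_le.2 ⟨by linarith [ht.1], by linarith [ht.2, C.len_pos e]⟩) le_rfl (by linarith [ht.2])
    rw [hk, hp, hpk]
    push_cast
    linarith

/-- The theta function along an edge, seen from its target. -/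
theorem IsGeodesic.theta_tgt [Fintype V] {e : E} (h : C.IsGeodesic d q (C.tgt e) k)
    (hd : C.IsDist {q} d) {t : ℝ} (ht : t ∈ Set.Icc 0 (C.len e)) :
    C.theta (C.chainInt k + (-t) • C.unitVec e) =
      (1 - k e) * max (t - (C.len e - C.peak d e)) 0 := by
  classical
  have hp0 := hd.peak_nonneg e
  have hp1 := hd.peak_le e
  have hp : d (C.tgt e) - d (C.src e) = 2 * C.peak d e - C.len e := by
    rw [peak]
    ring
  rcases h.tgt_cases with hk | ⟨hk, hpk⟩
  · rw [hk, Int.cast_zero, sub_zero, one_mul]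
    refine le_antisymm (h.theta_le hd e fun j => ?_) (max_le ?_ (theta_nonneg _))
    · have := int_mul_le (-j) (r := t - (C.len e - C.peak d e))
        (s := max (t - (C.len e - C.peak d e)) 0) (ℓ := C.len e)
        (abs_le.2 ⟨by linarith [ht.1], by linarith [ht.2]⟩) (le_max_right _ _) (le_max_left _ _)
      rw [hk, hp]
      push_cast at *
      linarith
    · rcases le_or_gt t (C.len e - C.peak d e) with hle | hlt
      · exact le_trans (by linarith) (theta_nonneg _)
      · obtain ⟨k', h'⟩ := hd.exists_isGeodesic (C.src e)
        have hk' : k' e = 0 := by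
          rcases h'.src_cases with h | h
          · exact h
          · linarith [ht.2, h.2]
        refine h.le_theta h' e ⟨k - k' - Pi.single e 1, ?_⟩ (fun e' hne => ?_) ?_
        · rw [H1, LinearMap.mem_ker, map_sub, map_sub, h.boundary, h'.boundary, boundary_single]
          abel
        · simp [hne]
        · rw [hp]
          simp [hk, hk']
          ring
  · rw [hk, Int.cast_one, sub_self, zero_mul]
    refine le_antisymm (h.theta_le hd e fun j => ?_) (theta_nonneg _)
    have := int_mul_le (-j) (r := t - C.len e) (s := 0) (ℓ := C.len e)
      (abs_le.2 ⟨by linarith [ht.1], by linarith [ht.2, C.len_pos e]⟩) le_rfl (by linarith [ht.2])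
    rw [hk, hp, hpk]
    push_cast at *
    linarith

theorem max_germ_right (t τ : ℝ) : ∃ n : ℤ, (t < τ → n = 0) ∧ (τ ≤ t → n = 1) ∧
    ∀ᶠ s in 𝓝[>] (0 : ℝ), max (t + s - τ) 0 = max (t - τ) 0 + n * s := by
  rcases lt_or_ge t τ with h | h
  · refine ⟨0, fun _ => rfl, fun h' => absurd h h'.not_gt, ?_⟩
    filter_upwards [Ioo_mem_nhdsGT (sub_pos.2 h)] with s hs
    rw [max_eq_right (by linarith [hs.2]), max_eq_right (by linarith)]
    simp
  · refine ⟨1, fun h' => absurd h h'.not_ge, fun _ => rfl, ?_⟩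
    filter_upwards [self_mem_nhdsWithin] with s hs
    have hs' : (0 : ℝ) < s := hs
    rw [max_eq_left (by linarith), max_eq_left (by linarith)]
    push_cast
    ring

theorem max_germ_left (t τ : ℝ) : ∃ n : ℤ, (t ≤ τ → n = 0) ∧ (τ < t → n = -1) ∧
    ∀ᶠ s in 𝓝[>] (0 : ℝ), max (t - s - τ) 0 = max (t - τ) 0 + n * s := by
  rcases lt_or_ge τ t with h | h
  · refine ⟨-1, fun h' => absurd h h'.not_gt, fun _ => rfl, ?_⟩
    filter_upwards [Ioo_mem_nhdsGT (sub_pos.2 h)] with s hs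
    rw [max_eq_left (by linarith [hs.2]), max_eq_left (by linarith)]
    push_cast
    ring
  · refine ⟨0, fun _ => rfl, fun h' => absurd h h'.not_ge, ?_⟩
    filter_upwards [self_mem_nhdsWithin] with s hs
    have hs' : (0 : ℝ) < s := hs
    rw [max_eq_right (by linarith), max_eq_right (by linarith)]
    simp

variable [Fintype V] [Fintype L]

/-- Theta has slope 1 along each incoming edge, except the one by which the shortest path arrives.
The boundary of the path accounts for this exception, and for the absence of an exception at `q`:
hence the extra point. -/
theorem IsGeodesic.thetaSlopeSum_vert (h : C.IsGeodesic d q v k) (hd : C.IsDist {q} d) :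
    C.ThetaSlopeSum (C.chainInt k) (.fin (.vert v))
      ((C.inDiv 0 d + Finsupp.single (Point.fin (FinPoint.vert q)) 1 : C.Div)
        (.fin (.vert v))) := by
  classical
  refine ⟨fun b => match b with
    | (.inl e, true) => C.srcIn 0 d e + k e
    | (.inl e, false) => C.tgtIn 0 d e - k e
    | (.inr _, _) => 0, ?_, ?_⟩
  · rintro ⟨e | l, _ | _⟩ hb <;> rw [mem_outDirs] at hb
    · obtain rfl : C.tgt e = v := hb
      have h0 := h.theta_tgt hd (t := 0) ⟨le_rfl, (C.len_pos e).le⟩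
      obtain ⟨n, hn0, hn1, hn⟩ := max_germ_right 0 (C.len e - C.peak d e)
      rw [neg_zero, zero_smul, add_zero] at h0
      filter_upwards [hn, Ioo_mem_nhdsGT (C.len_pos e)] with s hs hs'
      rw [tangent, smul_neg, ← neg_smul, h.theta_tgt hd ⟨hs'.1.le, hs'.2.le⟩, h0]
      rw [zero_add] at hs
      rw [hs, tgtIn]
      have hp1 := hd.peak_le e
      rcases h.tgt_cases with hk | ⟨hk, hpk⟩
      · by_cases hpk : C.peak d e = C.len e
        · simp [hk, hpk, hn1 (by linarith)]
        · have := lt_of_le_of_ne hp1 hpk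
          simp [hk, hpk, hn0 (by linarith)]
      · simp [hk, hpk]
    · obtain rfl : C.src e = v := hb
      have h0 := h.theta_src hd (t := 0) ⟨le_rfl, (C.len_pos e).le⟩
      obtain ⟨n, hn0, hn1, hn⟩ := max_germ_right 0 (C.peak d e)
      rw [zero_smul, add_zero] at h0
      filter_upwards [hn, Ioo_mem_nhdsGT (C.len_pos e)] with s hs hs'
      rw [tangent, h.theta_src hd ⟨hs'.1.le, hs'.2.le⟩, h0]
      rw [zero_add] at hs
      rw [hs, srcIn]
      have hp0 := hd.peak_nonneg e
      rcases h.src_cases with hk | ⟨hk, hpk⟩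
      · by_cases hpk : C.peak d e = 0
        · simp [hk, hpk, hn1 (by linarith)]
        · have := lt_of_le_of_ne hp0 (Ne.symm hpk)
          simp [hk, hpk, hn0 (by linarith)]
      · simp [hk, hpk]
    · exact hb.elim
    · simp [tangent]
  · have hb := congrFun h.boundary v
    simp only [TropicalCurve.boundary, LinearMap.coe_mk, AddHom.coe_mk, Pi.sub_apply] at hb
    rw [Finsupp.add_apply, inDiv_vert, sum_outDirs_vert, Finset.sum_add_distrib,
      Finset.sum_sub_distrib, Finset.sum_const_zero, add_zero]
    have hq : (Finsupp.single (Point.fin (FinPoint.vert q)) 1 : C.Div) (.fin (.vert v)) =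
        (Pi.single q 1 : V → ℤ) v := by
      simp [Finsupp.single_apply, Pi.single_apply, eq_comm]
    rw [hq]
    rw [Pi.single_eq_same] at hb
    linarith

/-- Inside an edge theta bends only at an interior peak, by 1. -/
theorem IsGeodesic.thetaSlopeSum_edge {e : E} (h : C.IsGeodesic d q (C.src e) k)
    (hd : C.IsDist {q} d) {t : ℝ} (h0 : 0 < t) (h1 : t < C.len e) :
    C.ThetaSlopeSum (C.chainInt k + t • C.unitVec e) (.fin (.edge e t h0 h1))
      ((C.inDiv 0 d + Finsupp.single (Point.fin (FinPoint.vert q)) 1 : C.Div)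
        (.fin (.edge e t h0 h1))) := by
  classical
  obtain ⟨n, hn0, hn1, hn⟩ := max_germ_right t (C.peak d e)
  obtain ⟨m, hm0, hm1, hm⟩ := max_germ_left t (C.peak d e)
  have hval := h.theta_src hd (t := t) ⟨h0.le, h1.le⟩
  refine ⟨fun b => if b.2 then (1 + k e) * n else (1 + k e) * m, ?_, ?_⟩
  · rintro ⟨b, _ | _⟩ hb <;> rw [mem_outDirs] at hb <;> obtain rfl : b = .inl e := hb
    · filter_upwards [hm, Ioo_mem_nhdsGT h0] with s hs hs'
      rw [tangent, smul_neg, ← neg_smul, add_assoc, ← add_smul, ← sub_eq_add_neg,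
        h.theta_src hd ⟨by linarith [hs'.2], by linarith [hs'.1]⟩, hs, hval]
      push_cast
      ring
    · filter_upwards [hn, Ioo_mem_nhdsGT (sub_pos.2 h1)] with s hs hs'
      rw [tangent, add_assoc, ← add_smul,
        h.theta_src hd ⟨by linarith [hs'.1], by linarith [hs'.2]⟩, hs, hval]
      push_cast
      simp
      ring
  · rw [sum_outDirs_edge, Finsupp.add_apply, ← C.edgePart_apply_of_mem e _ h0 h1, edgePart_inDiv,
      midIn]
    simp only [Finsupp.single_apply, reduceCtorEq, Point.fin.injEq, if_false, add_zero, if_true]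
    rcases lt_trichotomy t (C.peak d e) with ht | ht | ht
    · rw [hn0 ht, hm0 ht.le]
      split_ifs <;> simp [ht.ne']
    · have hk : k e = 0 := by
        rcases h.src_cases with hk | hk
        · exact hk
        · linarith [hk.2]
      rw [hn1 ht.ge, hm0 ht.le, hk]
      simp [← ht, h0, h1]
    · rw [hn1 ht.le, hm1 ht]
      split_ifs <;> simp [ht.ne]

/-- The pull-back of the theta divisor, translated to the vertex `q`. -/
theorem IsDist.thetaSlopeSum (hd : C.IsDist {q} d) (p : C.Point) :
    C.ThetaSlopeSum (C.refPt (C.finPart p) - C.refVert q) p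
      ((C.inDiv 0 d + Finsupp.single (Point.fin (FinPoint.vert q)) 1 : C.Div) p) := by
  classical
  rcases p with (v | ⟨e, t, h0, h1⟩ | ⟨l, t, h0⟩) | l
  · obtain ⟨k, hk⟩ := hd.exists_isGeodesic v
    exact (hk.thetaSlopeSum_vert hd).congr hk.toJac_chainInt
  · obtain ⟨k, hk⟩ := hd.exists_isGeodesic (C.src e)
    refine (hk.thetaSlopeSum_edge hd h0 h1).congr ?_
    rw [toJac_add, hk.toJac_chainInt, ← toJac_add, finPart, refPt, sub_add_eq_add_sub]
  · refine ⟨0, fun b hb => ?_, ?_⟩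
    · obtain ⟨b, b'⟩ := b
      obtain rfl : b = .inr l := C.mem_outDirs.1 hb
      simp [tangent]
    · rw [Finsupp.add_apply, ← C.legPart_apply_of_pos l _ h0, legPart_inDiv]
      simp
  · refine ⟨0, fun b hb => ?_, ?_⟩
    · obtain rfl : b = (.inr l, false) := C.mem_outDirs.1 hb
      simp [tangent]
    · rw [Finsupp.add_apply, inDiv_infty]
      simp

end TropicalCurve

/-! ### The Riemann constant and the family of theta characteristics -/

namespace TropicalCurve

variable {V E L : Type*} {C : TropicalCurve V E L} [Fintype E]

/-! ### The orientation of a mod 2 cycle -/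

/-- `S` and `d` are chosen from `γ` alone, before the lift, so that different simple lifts can be
compared. -/
theorem exists_isOrientation {γ : C.H1 (ZMod 2)} (hγ : γ ≠ 0) :
    ∃ (S : Set V) (d : V → ℝ), ∀ c, C.IsSimpleLift γ c → C.IsOrientation c S d ∧
      ∀ v ∈ S, ∃ e, (c : E → ℤ) e ≠ 0 ∧ (C.src e = v ∨ C.tgt e = v) := by
  set S : Set V := {v | ∃ e, (γ : E → ZMod 2) e ≠ 0 ∧ (C.src e = v ∨ C.tgt e = v)} with hS
  have hne : S.Nonempty := by
    by_contra hne
    refine hγ (Subtype.ext (funext fun e => ?_))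
    by_contra he
    exact hne ⟨C.src e, e, he, Or.inl rfl⟩
  obtain ⟨d, hd⟩ := C.exists_isDist hne
  refine ⟨S, d, fun c hc => ⟨⟨hd, hc.2, fun e he => ?_⟩, ?_⟩⟩
  · rw [Ne, hc.eq_zero_iff] at he
    exact ⟨⟨e, he, Or.inl rfl⟩, ⟨e, he, Or.inr rfl⟩⟩
  · rintro v ⟨e, he, hv⟩
    exact ⟨e, (hc.eq_zero_iff e).not.2 he, hv⟩

theorem IsDist.isOrientation_zero {S : Set V} {d : V → ℝ} (h : C.IsDist S d) :
    C.IsOrientation 0 S d := ⟨h, fun e => by simp, fun e he => (he rfl).elim⟩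

variable [Fintype L]

theorem cls_surjective (x : C.Pic) : ∃ D, C.cls D = x := QuotientAddGroup.mk_surjective x

theorem cls_sub (D D' : C.Div) : C.cls (D - D') = C.cls D - C.cls D' := rfl

theorem cls_add (D D' : C.Div) : C.cls (D + D') = C.cls D + C.cls D' := rfl

theorem IsRiemannConstant.unique {p₀ : C.Point} {κ κ' : C.Jac} (h : C.IsRiemannConstant p₀ κ)
    (h' : C.IsRiemannConstant p₀ κ') : κ = κ' := by
  obtain ⟨D, hD, hκ⟩ := h 0
  obtain ⟨D', hD', hκ'⟩ := h' 0
  obtain rfl : D = D' := Finsupp.ext fun p => ThetaSlopeSum.unique (hD p) (hD' p)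
  exact add_left_cancel (hκ.trans hκ'.symm)

variable [Fintype V]

/-! ### The Riemann constant -/

/-- The translate by `q` determines both constants of `exists_theta_pullback`. The pull-back has
degree one more than `inDiv`, and this surplus cancels the shift of the translation by the base
point. -/
theorem IsDist.isRiemannConstant {q : V} {d : V → ℝ} (hd : C.IsDist {q} d) (p₀ : C.Point) :
    C.IsRiemannConstant p₀ (-C.abelJacobi p₀ (C.inDiv 0 d)) := by
  obtain ⟨k, g, h⟩ := C.exists_theta_pullback
  obtain ⟨hdeg, hk⟩ : C.deg (C.inDiv 0 d) + 1 = g ∧ C.refJac (C.inDiv 0 d) = k := by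
    obtain ⟨D, hD, hg, hr⟩ := h (C.refVert q)
    obtain rfl : D = C.inDiv 0 d + Finsupp.single (Point.fin (FinPoint.vert q)) 1 :=
      Finsupp.ext fun p => (hD p).unique (hd.thetaSlopeSum p)
    rw [deg_add, deg_single] at hg
    rw [map_add, refJac_single, finPart, refPt_vert, one_smul] at hr
    exact ⟨hg, add_right_cancel hr⟩
  intro x
  obtain ⟨D, hD, hg, hr⟩ := h (C.refPt (C.finPart p₀) + x)
  refine ⟨D, fun p => (hD p).congr ?_, ?_⟩
  · rw [toJac_sub, toJac_sub, toJac_add, toJac_pathInt]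
    abel
  · rw [abelJacobi_eq, abelJacobi_eq, hr, hg, ← hdeg, hk, toJac_add, add_smul, one_smul]
    abel

/-! ### The theta characteristic of a mod 2 cycle -/

/-- Chooses one incoming divisor per `γ`, with the distance to `q` when `γ = 0` and to the support
of `γ` otherwise; the Jacobian images are all expressed relative to the former. -/
theorem exists_inDiv {q : V} {d : V → ℝ} (hd : C.IsDist {q} d) (γ : C.H1 (ZMod 2)) :
    ∃ D : C.Div, C.deg D = (C.genus : ℤ) - 1 ∧ 2 • C.cls D = C.cls C.canonical ∧
      (∀ c, C.IsLift γ c → C.refJac D =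
        C.refJac (C.inDiv 0 d) + C.toJac ((1 / 2 : ℝ) • C.cycleInt c)) ∧
      (γ = 0 → D = C.inDiv 0 d) ∧
      (γ ≠ 0 → 0 ≤ D ∧ ∀ c, C.IsSimpleLift γ c → ∀ p,
        (C.canonical - D) p = (C.valOut c p : ℤ) - 1 ∧ D p = (C.valIn c p : ℤ) - 1) := by
  have h0 := hd.isOrientation_zero
  have hr0 := h0.refJac_eq
  rw [map_zero, smul_zero, toJac_zero, add_zero] at hr0
  by_cases hγ : γ = 0
  · subst hγ
    refine ⟨_, h0.deg_eq, h0.two_smul_cls, fun c hc => ?_, fun _ => rfl, fun h => (h rfl).elim⟩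
    rw [hc.toJac_half_eq isLift_zero_zero, map_zero, smul_zero, toJac_zero, add_zero]
  · obtain ⟨S, d', h⟩ := exists_isOrientation hγ
    obtain ⟨b, hb⟩ := C.exists_simpleLift γ
    obtain ⟨hbo, hbS⟩ := h b hb
    refine ⟨_, hbo.deg_eq, hbo.two_smul_cls, fun c hc => ?_, fun h => (hγ h).elim,
      fun _ => ⟨hbo.inDiv_nonneg hbS, fun c hc p => ?_⟩⟩
    · rw [hbo.refJac_eq, hr0, hc.toJac_half_eq hb.1]
    · obtain ⟨hco, hcS⟩ := h c hc
      rw [hbo.inDiv_eq hco fun e => (hb.eq_zero_iff e).trans (hc.eq_zero_iff e).symm,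
        hco.valOut_eq hcS, hco.valIn_eq hcS]
      exact ⟨rfl, rfl⟩

theorem exists_lift_eq_half {D : C.Div} (h : 2 • C.cls D = 0) :
    C.deg D = 0 ∧ ∃ γ c, C.IsLift γ c ∧ C.refJac D = C.toJac ((1 / 2 : ℝ) • C.cycleInt c) := by
  rw [two_smul, ← cls_add] at h
  obtain ⟨h1, h2⟩ := cls_eq_iff.1 (h.trans (rfl : (0 : C.Pic) = C.cls 0))
  rw [deg_add] at h1
  rw [map_add, map_zero, ← two_smul ℕ] at h2
  exact ⟨by simp [deg] at h1 ⊢; omega, exists_half_of_two_smul_eq_zero h2⟩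

end TropicalCurve

open TropicalCurve in
/-- On a tropical curve `C` with base point `p₀`, there are a Riemann constant `κ` and a map
`γ ↦ 𝒦 γ` such that:
* `κ` is characterized by its defining property;
* `𝒦 0` is the class of degree `g - 1` with Abel-Jacobi image `-κ`;
* for `γ ≠ 0`, `𝒦 γ` is the common class of the divisors `∑ (val± p - 1) p` attached to the
  orientation given by any simple lift of `γ`;
* `𝒦` is a bijection onto the set of theta characteristics;
* `𝒦` is affine, with linear part the isomorphism of the mod 2 homology with the 2-torsion of the
  Picard group, which sends `γ` to the class of degree `0` with Abel-Jacobi image `γ / 2`;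
* `𝒦 γ` is effective exactly for `γ ≠ 0`. -/
theorem mainTheorem1 {V E L : Type*} [Fintype V] [Fintype E] [Fintype L]
    (C : TropicalCurve V E L) (p₀ : C.Point) :
    ∃ (κ : C.Jac) (𝒦 : C.H1 (ZMod 2) → C.Pic),
      (C.IsRiemannConstant p₀ κ ∧ ∀ κ', C.IsRiemannConstant p₀ κ' → κ' = κ) ∧
      (∀ D : C.Div, C.cls D = 𝒦 0 ↔
        C.deg D = (C.genus : ℤ) - 1 ∧ C.abelJacobi p₀ D = -κ) ∧
      (∀ γ : C.H1 (ZMod 2), ∃ c, C.IsSimpleLift γ c) ∧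
      (∀ γ : C.H1 (ZMod 2), γ ≠ 0 → ∃ Dout Din : C.Div,
        (∀ c, C.IsSimpleLift γ c → ∀ p,
          Dout p = (C.valOut c p : ℤ) - 1 ∧ Din p = (C.valIn c p : ℤ) - 1) ∧
        C.cls Dout = 𝒦 γ ∧ C.cls Din = 𝒦 γ) ∧
      Set.BijOn 𝒦 Set.univ C.thetaChars ∧
      (∃ φ : C.H1 (ZMod 2) ≃+ Submodule.torsionBy ℤ C.Pic 2,
        (∀ γ δ, 𝒦 (γ + δ) = (φ γ : C.Pic) + 𝒦 δ) ∧
        ∀ γ c, C.IsLift γ c → ∀ D : C.Div, C.cls D = (φ γ : C.Pic) ↔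
          C.deg D = 0 ∧ C.abelJacobi p₀ D = C.toJac ((1 / 2 : ℝ) • C.cycleInt c)) ∧
      ∀ γ, ¬ C.IsEffective (𝒦 γ) ↔ γ = 0 := by
  obtain ⟨d, hd⟩ := C.exists_isDist (Set.singleton_nonempty C.root)
  choose D hdeg htwo hjac hzero hnz using exists_inDiv hd
  have hD0 := hzero 0 rfl
  have hlift : ∀ γ, ∃ c, C.IsLift γ c := fun γ => (C.exists_simpleLift γ).imp fun c hc => hc.1
  have hadd : ∀ γ δ, C.cls (D (γ + δ)) = C.cls (D γ) - C.cls (D 0) + C.cls (D δ) := by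
    intro γ δ
    obtain ⟨c, hc⟩ := hlift γ
    obtain ⟨c', hc'⟩ := hlift δ
    rw [← cls_sub, ← cls_add, cls_eq_iff, deg_add, deg_sub, map_add, map_sub]
    refine ⟨by simp only [hdeg]; ring, ?_⟩
    rw [hjac _ _ (hc.add hc'), hjac _ _ hc, hjac _ _ hc', hD0, map_add, smul_add, toJac_add]
    abel
  -- The linear part of the affine map. Its values have degree 0 and Jacobian image a half-cycle, so
  -- Abel's theorem and the description of 2-torsion by half-cycles give injectivity and
  -- surjectivity onto the 2-torsion.
  let f : C.H1 (ZMod 2) →+ C.Pic :=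
    AddMonoidHom.mk' (fun γ => C.cls (D γ) - C.cls (D 0)) fun γ δ => by rw [hadd]; abel
  have hf : ∀ γ, f γ = C.cls (D γ) - C.cls (D 0) := fun γ => rfl
  have hftwo : ∀ γ, 2 • f γ = 0 := fun γ => by rw [hf, nsmul_sub, htwo, htwo, sub_self]
  have hfiff : ∀ γ c, C.IsLift γ c → ∀ X : C.Div, C.cls X = f γ ↔
      C.deg X = 0 ∧ C.refJac X = C.toJac ((1 / 2 : ℝ) • C.cycleInt c) := by
    intro γ c hc X
    rw [hf, ← cls_sub, cls_eq_iff, deg_sub, hdeg, hdeg, sub_self, map_sub, hjac _ _ hc, hD0,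
      add_sub_cancel_left]
  have hinj : Function.Injective f := by
    refine (injective_iff_map_eq_zero f).2 fun γ hγ => ?_
    obtain ⟨c, hc⟩ := hlift γ
    refine hc.eq_zero_of_toJac_half ?_
    rw [← ((hfiff γ c hc 0).1 hγ.symm).2, map_zero]
  have hsurj : ∀ x : C.Pic, 2 • x = 0 → ∃ γ, f γ = x := by
    intro x hx
    obtain ⟨X, rfl⟩ := cls_surjective x
    obtain ⟨hX, γ, c, hc, h⟩ := exists_lift_eq_half hx
    exact ⟨γ, ((hfiff γ c hc X).2 ⟨hX, h⟩).symm⟩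
  refine ⟨-C.abelJacobi p₀ (D 0), fun γ => C.cls (D γ), ⟨hD0 ▸ hd.isRiemannConstant p₀, fun κ' h =>
    h.unique (hD0 ▸ hd.isRiemannConstant p₀)⟩, fun X => ?_, C.exists_simpleLift, fun γ hγ =>
    ⟨C.canonical - D γ, D γ, (hnz γ hγ).2, ?_, rfl⟩, ⟨fun γ _ => ⟨⟨D γ, hdeg γ, rfl⟩, htwo γ⟩,
    fun γ _ δ _ h => hinj (congrArg (· - C.cls (D 0)) h), fun x hx => ?_⟩, ?_, fun γ => ?_⟩
  · rw [cls_eq_iff, hdeg, neg_neg]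
    refine and_congr_right fun h => ?_
    rw [abelJacobi_eq, abelJacobi_eq, h, hdeg, sub_left_inj]
  -- The outgoing divisor is `K` minus the incoming one, and `K` is equivalent to twice the incoming
  -- one.
  · rw [cls_sub, ← htwo γ, two_smul, add_sub_cancel_right]
  · obtain ⟨γ, hγ⟩ := hsurj (x - C.cls (D 0)) (by rw [nsmul_sub, hx.2, htwo, sub_self])
    exact ⟨γ, trivial, sub_left_injective hγ⟩
  · let g : C.H1 (ZMod 2) →+ Submodule.torsionBy ℤ C.Pic 2 :=
      AddMonoidHom.mk' (fun γ => ⟨f γ, (Submodule.mem_torsionBy_iff _ _).2 (by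
        rw [← hftwo γ]; exact ofNat_smul_eq_nsmul ℤ 2 (f γ))⟩)
        fun γ δ => Subtype.ext (f.map_add γ δ)
    have hg : Function.Bijective g := by
      refine ⟨fun γ δ h => hinj (congrArg Subtype.val h), fun x => ?_⟩
      obtain ⟨γ, hγ⟩ := hsurj x (by
        rw [← (Submodule.mem_torsionBy_iff _ _).1 x.2]
        exact (ofNat_smul_eq_nsmul ℤ 2 (x : C.Pic)).symm)
      exact ⟨γ, Subtype.ext hγ⟩
    refine ⟨AddEquiv.ofBijective g hg, hadd, fun γ c hc X => ?_⟩
    refine (hfiff γ c hc X).trans (and_congr_right fun h => ?_)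
    rw [abelJacobi_eq, h, zero_smul, sub_zero]
  · refine ⟨fun h => by_contra fun hγ => h ⟨D γ, (hnz γ hγ).1, rfl⟩, ?_⟩
    rintro rfl
    change ¬ C.IsEffective (C.cls (D 0))
    rw [hD0]
    exact hd.isOrientation_zero.not_isEffective
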